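/- **Setting.** Let $\mathbb N_*=\{1,2,\dots\}$, $\overline{\mathbb N}_*=\mathbb N_*\cup\{\infty\}$, and let $0<\alpha_1<\alpha_2<\cdots<1$ with $\alpha_n\to1$. On a probability space, let the following be independent: * for each $k\ge1$ and $y\in\mathbb N_*^{k-1}$, the decreasingly ordered marks $\gamma_k(y1)>\gamma_k(y2)>\cdots>0$ of a Poisson point process on $(0,\infty)$ with intensity $c_k t^{-1-\alpha_k}\,dt$, $c_k=\alpha_k/\Gamma(1-\alpha_k/\alpha_{k+1})$; * mean-one exponential variables $T^{k,x}_i$ ($k,x,i\in\mathbb N_*$); * rate-one Poisson processes $N^{k,x}$ ($k,x\in\mathbb N_*$) with marks $0<\sigma^{k,x}_1<\sigma^{k,x}_2<\cdots$. Put $X_0\equiv\emptyset$ and, recursively for $k\ge1$, $t\ge0$, $$\Xi_k(t)=\sum_{x\in\mathbb N_*}\sum_{i=1}^{N^{k,x}(t)}\gamma_k(X_{k-1}(\sigma^{k,x}_i)x)\,T^{k,x}_i,\qquad X_k(t)=(X_{k-1}(\Xi_k^{-1}(t)),z),$$ where $\Xi_k^{-1}(t)=\inf\{r\ge 0:\Xi_k(r)>t\}$,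 and $z=x$ if $t\in\bigcup_i[\Xi_k(\sigma^{k,x}_i-),\Xi_k(\sigma^{k,x}_i))$ for some $x\in\mathbb N_*$, $z=\infty$ otherwise. (Almost surely $X_{k-1}(\sigma_i^{k,x})$ has only finite coordinates, so the convention for $\gamma_k$ at other nodes is irrelevant.) For $x\in\mathbb N_*^k$, $k\ge0$, let $\overline\gamma_k(x)=\prod_{j=1}^k\gamma_j(x_1\cdots x_j)$ and $$W(x)=\lim_{n\to\infty}\ \sum_{y\in\mathbb N_*^n,\ (y_1,\dots,y_k)=x}\Big(\frac{\overline\gamma_n(y)}{\overline\gamma_k(x)}\Big)^{\alpha_{n+1}}.$$ The adjusted clocks are $$\widetilde\Xi_n(t)=\sum_{x\in\mathbb N_*}\sum_{i=1}^{N^{n,x}(t)}W(X_{n-1}(\sigma^{n,x}_i)x)\,\gamma_n(X_{n-1}(\sigma^{n,x}_i)x)\,T^{n,x}_i,\qquad \widetilde\theta^n_k=\widetilde\Xi_n\circ\Xi_{n-1}\circ\cdots\circ\Xi_k\quad(n\ge k).$$ **Theorem.** Almost surely, for every $k\ge 0$ and $x\in\mathbb N_*^k$ the limit defining $W(x)$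 exists and is finite. For every $k\in\mathbb N_*$ there are a countable deterministic dense set $D_k\subset[0,\infty)$ and a process $\theta_k^\infty=(\theta_k^\infty(t))_{t\ge0}$ with values in $[0,\infty)$ whose paths are almost surely nondecreasing and right-continuous, such that, almost surely, $$\lim_{n\to\infty}\widetilde\theta^n_k(t)=\theta^\infty_k(t)\qquad\text{for all }t\in D_k.$$ Furthermore, for every $k\ge0$, $x\in\mathbb N_*^k$ and $t\ge0$, let $\nu^\infty_{k+1}$ be the random measure on $[0,\infty)$ with $\nu^\infty_{k+1}([0,s])=\theta^\infty_{k+1}(s)$ for all $s\ge0$, let $L_k(x,s)=\int_0^s\mathbf 1\{X_k(u)=x\}\,du$, and let $$\theta^\infty_x(t)=\nu^\infty_{k+1}\big(\{s\ge0:\ L_k(x,s)\le t,\ X_k(s)=x\}\big).$$ Then $\theta_x^\infty(t)$ is a random variable (defined up to null events) and, with $\mathbb E_\gamma$ the conditional expectation given the environment $\underline\gamma=(\gamma_j(y))_{j\ge1,\,y\in\mathbb N_*^j}$, $$\mathbb E_\gamma\big(\theta^\infty_x(t)\big)\le t\,W(x)\qquad\text{almost surely.}$$ -/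

import Mathlib

open MeasureTheory ProbabilityTheory Filter Topology
open scoped ENNReal NNReal

noncomputable section

namespace KTree

/-! ### Conventions

Levels, offspring labels and marks are numbered from `0`.  Thus `α k` stands for `α_{k+1}`, a label
`x : ℕ` stands for the element `x + 1` of `{1, 2, …}`, and the infinite label is `⊤ : ℕ∞`.
A node at depth `k` is a list of length `k` (the root is `[]`), and `g y x` is the
environment variable `γ_{k+1}(y x)` of the `x`-th child of the node `y` of depth `k`.
Times and clocks take values in `[0, ∞]`. -/

/-! ### The random inputs -/

/-- The number of points (with multiplicity) of the sequence `ξ` that lie in `A`. -/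
def pointCount {Ω : Type*} (ξ : ℕ → Ω → ℝ) (A : Set ℝ) (ω : Ω) : ℝ≥0∞ :=
  ∑' i, A.indicator (fun _ => (1 : ℝ≥0∞)) (ξ i ω)

/-- The random points `ξ 0, ξ 1, …` are the marks of a Poisson point process on `ℝ` with the
(σ-finite) intensity measure `μ`: the number of points in a set `A` of finite intensity has the
Poisson law of mean `μ A`, and the numbers of points in disjoint sets are independent. -/
structure IsPoissonPoints {Ω : Type*} [MeasurableSpace Ω] (ξ : ℕ → Ω → ℝ) (μ : Measure ℝ)
    (P : Measure Ω) : Prop where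
  measurable : ∀ i, Measurable (ξ i)
  count_law : ∀ A : Set ℝ, MeasurableSet A → μ A ≠ ∞ →
    HasLaw (pointCount ξ A) ((poissonMeasure (μ A).toNNReal).map (fun n : ℕ => (n : ℝ≥0∞))) P
  indep : ∀ (m : ℕ) (A : Fin m → Set ℝ), (∀ j, MeasurableSet (A j)) →
    Pairwise (fun i j => Disjoint (A i) (A j)) → iIndepFun (fun j => pointCount ξ (A j)) P

/-- The constant `c_{k+1} = α_{k+1} / Γ(1 - α_{k+1} / α_{k+2})`. -/
def levelConst (α : ℕ → ℝ) (k : ℕ) : ℝ := α k / Real.Gamma (1 - α k / α (k + 1))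

/-- The intensity measure `μ_{k+1}(dt) = c_{k+1} / t^(1 + α_{k+1}) dt` on `(0, ∞)`. -/
def levelIntensity (α : ℕ → ℝ) (k : ℕ) : Measure ℝ :=
  (volume.restrict (Set.Ioi (0 : ℝ))).withDensity
    (fun t => ENNReal.ofReal (levelConst α k / t ^ (1 + α k)))

/-- The random inputs of the construction.  `γ ω y x` is the environment, `T ω k x i` are the
exponential variables and `σ ω k x i` is the `i`-th mark of the rate one Poisson process attached
to the label `x` at level `k + 1`. -/
structure IsInput (α : ℕ → ℝ) {Ω : Type*} [MeasurableSpace Ω] (γ : Ω → List ℕ → ℕ → ℝ)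
    (σ T : Ω → ℕ → ℕ → ℕ → ℝ) (P : Measure Ω) : Prop where
  env_poisson : ∀ y : List ℕ,
    IsPoissonPoints (fun x ω => γ ω y x) (levelIntensity α y.length) P
  env_ordered : ∀ᵐ ω ∂P, ∀ y, StrictAnti (γ ω y) ∧ ∀ x, 0 < γ ω y x
  env_indep : iIndepFun (fun (y : List ℕ) ω => γ ω y) P
  exp_measurable : ∀ k x i, Measurable (fun ω => T ω k x i)
  exp_law : ∀ k x i, HasLaw (fun ω => T ω k x i) (expMeasure 1) P
  exp_indep : iIndepFun (fun (p : ℕ × ℕ × ℕ) ω => T ω p.1 p.2.1 p.2.2) P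
  mark_poisson : ∀ k x,
    IsPoissonPoints (fun i ω => σ ω k x i) (volume.restrict (Set.Ioi (0 : ℝ))) P
  mark_ordered : ∀ᵐ ω ∂P, ∀ k x, StrictMono (σ ω k x) ∧ ∀ i, 0 < σ ω k x i
  mark_indep : iIndepFun (fun (p : ℕ × ℕ) ω => σ ω p.1 p.2) P
  exp_indep_mark : IndepFun T σ P
  env_indep_dynamics : IndepFun γ (fun ω => (T ω, σ ω)) P

/-- The σ-algebra generated by the environment. -/
abbrev envSigma {Ω : Type*} (γ : Ω → List ℕ → ℕ → ℝ) : MeasurableSpace Ω :=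
  MeasurableSpace.comap γ inferInstance

/-! ### The variables `W` -/

/-- `∏_{j ≤ k} γ_j(y|_j)` for a node `y` of depth `k`. -/
def envProd (g : List ℕ → ℕ → ℝ) (y : List ℕ) : ℝ :=
  ∏ j : Fin y.length, g (y.take j) y[j]

/-- The sum over the descendants `y` of `x` at depth `n` of the ratio of the products of `y` and
`x` to the power `α_{n+1}`. -/
def WApprox (α : ℕ → ℝ) (g : List ℕ → ℕ → ℝ) (x : List ℕ) (n : ℕ) : ℝ≥0∞ :=
  ∑' y : {y : List ℕ // y.length = n ∧ x <+: y},
    ENNReal.ofReal ((envProd g y / envProd g x) ^ α n)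

/-- `W(x)`: the limit of `WApprox α g x n` as `n → ∞`, wherever that limit exists. -/
def W (α : ℕ → ℝ) (g : List ℕ → ℕ → ℝ) (x : List ℕ) : ℝ≥0∞ :=
  limsup (WApprox α g x) atTop

/-! ### The processes with finitely many levels, for a fixed realization of the inputs -/

/-- A function on the nodes with finite labels, extended by `0` to those with an infinite label. -/
def extendNode (w : List ℕ → ℝ≥0∞) : List ℕ∞ → ℝ≥0∞ :=
  Function.extend (List.map (fun n : ℕ => (n : ℕ∞))) w 0

/-- `t ↦ ∑_x ∑_{i : s x i ≤ t} w(X(s x i) x) τ x i`, a clock with marks `s`, holding variables `τ`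
and weights `w`, driven by the process `X`. -/
def clockOf (s τ : ℕ → ℕ → ℝ) (w : List ℕ → ℕ → ℝ≥0∞) (X : ℝ≥0∞ → List ℕ∞) (t : ℝ≥0∞) : ℝ≥0∞ :=
  ∑' x : ℕ, ∑' i : ℕ,
    if ENNReal.ofReal (s x i) ≤ t then
      extendNode (fun y => w y x) (X (ENNReal.ofReal (s x i))) * ENNReal.ofReal (τ x i)
    else 0

/-- Generalized inverse `inf {r ≥ 0 : Ξ(r) > t}`. -/
def genInv (Ξ : ℝ≥0∞ → ℝ≥0∞) (t : ℝ≥0∞) : ℝ≥0∞ := sInf {r | t < Ξ r}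

open scoped Classical in
/-- The label `x` with `t ∈ ⋃ i, [Ξ(s x i -), Ξ(s x i))`, and `∞` if there is none. (The least such
label is taken; almost surely there is at most one.) -/
def lastLabel (s : ℕ → ℕ → ℝ) (Ξ : ℝ≥0∞ → ℝ≥0∞) (t : ℝ≥0∞) : ℕ∞ :=
  if h : ∃ x : ℕ, ∃ i : ℕ, Function.leftLim Ξ (ENNReal.ofReal (s x i)) ≤ t ∧
      t < Ξ (ENNReal.ofReal (s x i))
  then ((Nat.find h : ℕ) : ℕ∞) else ⊤

/-- The K process `X_k` with `k` levels. -/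
def kState (g : List ℕ → ℕ → ℝ) (σ T : ℕ → ℕ → ℕ → ℝ) : ℕ → ℝ≥0∞ → List ℕ∞
  | 0, _ => []
  | k + 1, t =>
    let Ξ := clockOf (σ k) (T k) (fun y x => ENNReal.ofReal (g y x)) (kState g σ T k)
    kState g σ T k (genInv Ξ t) ++ [lastLabel (σ k) Ξ t]

/-- The clock process `Ξ_{k+1}`. -/
def clock (g : List ℕ → ℕ → ℝ) (σ T : ℕ → ℕ → ℕ → ℝ) (k : ℕ) : ℝ≥0∞ → ℝ≥0∞ :=
  clockOf (σ k) (T k) (fun y x => ENNReal.ofReal (g y x)) (kState g σ T k)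

/-- The adjusted clock process: `Ξ_{k+1}` with the weight `W(y x) γ(y x)` in place of `γ(y x)`. -/
def adjClock (α : ℕ → ℝ) (g : List ℕ → ℕ → ℝ) (σ T : ℕ → ℕ → ℕ → ℝ) (k : ℕ) : ℝ≥0∞ → ℝ≥0∞ :=
  clockOf (σ k) (T k) (fun y x => W α g (y ++ [x]) * ENNReal.ofReal (g y x)) (kState g σ T k)

/-- The composition `Ξ_{k+m} ∘ ⋯ ∘ Ξ_{k+1}` of `m` clocks. -/
def clockComp (g : List ℕ → ℕ → ℝ) (σ T : ℕ → ℕ → ℕ → ℝ) (k : ℕ) : ℕ → ℝ≥0∞ → ℝ≥0∞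
  | 0 => id
  | m + 1 => clock g σ T (k + m) ∘ clockComp g σ T k m

/-- The adjusted clock composition `θ̃_{k+1}^{k+1+m} = Ξ̃_{k+1+m} ∘ Ξ_{k+m} ∘ ⋯ ∘ Ξ_{k+1}`. -/
def adjClockComp (α : ℕ → ℝ) (g : List ℕ → ℕ → ℝ) (σ T : ℕ → ℕ → ℕ → ℝ) (k m : ℕ) :
    ℝ≥0∞ → ℝ≥0∞ :=
  adjClock α g σ T (k + m) ∘ clockComp g σ T k m

/-! ### The part of a clock that belongs to a node -/

/-- `X_k(s) = x`, for a node `x` of depth `k` with finite labels. -/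
def IsAt (g : List ℕ → ℕ → ℝ) (σ T : ℕ → ℕ → ℕ → ℝ) (x : List ℕ) (s : ℝ) : Prop :=
  kState g σ T x.length (ENNReal.ofReal s) = x.map (fun n : ℕ => (n : ℕ∞))

/-- The time `L_k(x, t) = ∫_0^t 1{X_k(s) = x} ds` spent at `x` up to time `t`. -/
def occupation (g : List ℕ → ℕ → ℝ) (σ T : ℕ → ℕ → ℕ → ℝ) (x : List ℕ) (t : ℝ) : ℝ≥0∞ :=
  ∫⁻ s in Set.Icc 0 t, {s : ℝ | IsAt g σ T x s}.indicator (fun _ => (1 : ℝ≥0∞)) s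

/-- Extension of a function on `[0, ∞)` to the real line by `0`. -/
def extendZero (f : ℝ≥0 → ℝ≥0) (s : ℝ) : ℝ := if 0 ≤ s then f s.toNNReal else 0

theorem extendZero_mono {f : ℝ≥0 → ℝ≥0} (hf : Monotone f) : Monotone (extendZero f) := by
  intro a b hab
  unfold extendZero
  split_ifs with ha hb hb
  · exact_mod_cast hf (Real.toNNReal_le_toNNReal hab)
  · exact absurd (ha.trans hab) hb
  · exact NNReal.coe_nonneg _
  · exact le_rfl

open scoped Classical in
/-- The measure `ν` on `[0, ∞)` (seen as a measure on `ℝ`) with `ν([0, t]) = f t`, for a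
nondecreasing right-continuous `f`. -/
def clockMeasure (f : ℝ≥0 → ℝ≥0) : Measure ℝ :=
  if hf : Monotone f then (extendZero_mono hf).stieltjesFunction.measure else 0

/-- The part of the clock `f = θ_{k+1}` that belongs to the node `x` of depth `k`:
`θ_x(t) = ν {s ≥ 0 : L_k(x, s) ≤ t, X_k(s) = x}` with `ν([0, t]) = f t`. -/
def nodeClock (g : List ℕ → ℕ → ℝ) (σ T : ℕ → ℕ → ℕ → ℝ) (f : ℝ≥0 → ℝ≥0) (x : List ℕ)
    (t : ℝ≥0) : ℝ≥0∞ :=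
  clockMeasure f {s : ℝ | 0 ≤ s ∧ occupation g σ T x s ≤ t ∧ IsAt g σ T x s}

end KTree

end

/-! The environment and the dynamics are treated by the same device: a nonnegative sequence is
passed through `lap`, that is exp(-·), which makes it bounded, and the transform is a submartingale.
No integrability is then needed for convergence in [0, ∞], and finiteness is proved separately.
Conditioning is expressed by resampling: one integrates over a fresh copy of some coordinates while
the others stay frozen (`ae_exists_tendsto_of_resample`).

Environment. The level constants are chosen so that the sum of the powers γ^(α (n+1)) over the
children of a node of depth n has Laplace exponent b ↦ b^(α n / α (n+1))
(`lintegral_levelIntensity`). Multiplying over independent nodes, exp(-r^(α n) · `WApprox α g x n`)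
is a martingale in the depth n. Taking r = 1 gives convergence to W(x). Passing to the limit in the
means gives E exp(-r W(x)) = exp(-r^(α |x|)), and r → 0 shows that W(x) is finite. Fatou's lemma in
the decomposition over the children z of x gives ∑ γ(xz) W(xz) ≤ W(x) (`childSum_W_le`).

Dynamics, in a fixed environment. Since the marks have rate one and the holding variables mean one,
averaging a clock increment over its own level gives the integral, along the driving path, of the
weights summed over children. Conversely, a time integral along the path with one more level is at
most a clock increment (`GoodMarks.occInt_nextState_le`). With the inequality for W, increments of
the adjusted clocks form supermartingales (`DynLaw.lintegral_adjInc_succ_le`). Hence the adjusted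
clocks converge, and given the levels below k the mean of the limit over (0, t] is at most the
integral of W(X_k) over (0, t]. This integral is finite by an induction on levels
(`DynLaw.ae_regularPath`).

The limit is monotone in time. Its right limits define θ, and they agree with it almost surely at
each fixed time outside a countable set (`exists_dense_rightInf_eq`).

Mean bound. Given the levels below k, the mean of the random measure is at most W(X_k(s)) ds
(`DynLaw.ae_lintegral_clockMeasure_le`). The set of times that defines the clock of x is determined
by these levels; it has Lebesgue measure at most t and the density is W(x) on it. Independence of
environment and dynamics turns the resulting bound t W(x) into one on the conditional expectation.
-/

noncomputable section

namespace KTree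

/-! ### The function `exp (-x)` on `[0, ∞]` -/

/-- The function `x ↦ exp (-x)` on `[0, ∞]`. -/
def lap (x : ℝ≥0∞) : ℝ≥0∞ := EReal.exp (-(x : EReal))

theorem lap_zero : lap 0 = 1 := by simp [lap]

theorem lap_top : lap ∞ = 0 := by simp [lap]

theorem lap_add (x y : ℝ≥0∞) : lap (x + y) = lap x * lap y := by
  unfold lap
  rw [← EReal.exp_add, EReal.coe_ennreal_add, EReal.neg_add]
  · rfl
  · exact Or.inl (EReal.coe_ennreal_ne_bot x)
  · exact Or.inr (EReal.coe_ennreal_ne_bot y)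

theorem lap_strictAnti : StrictAnti lap := fun x y h => by
  unfold lap
  rw [EReal.exp_lt_exp_iff, EReal.neg_lt_neg_iff]
  exact_mod_cast h

theorem lap_antitone : Antitone lap := lap_strictAnti.antitone

theorem lap_le_one (x : ℝ≥0∞) : lap x ≤ 1 := lap_zero ▸ lap_antitone zero_le

theorem lap_ne_top (x : ℝ≥0∞) : lap x ≠ ∞ := ((lap_le_one x).trans_lt ENNReal.one_lt_top).ne

theorem lap_ofReal {x : ℝ} (hx : 0 ≤ x) : lap (ENNReal.ofReal x) = ENNReal.ofReal (Real.exp (-x)) := by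
  unfold lap
  rw [EReal.coe_ennreal_ofReal, max_eq_left hx, ← EReal.coe_neg, EReal.exp_coe]

theorem continuous_lap : Continuous lap := by
  unfold lap
  exact ENNReal.continuous_exp.comp (continuous_neg.comp continuous_coe_ennreal_ereal)

@[fun_prop]
theorem measurable_lap : Measurable lap := continuous_lap.measurable

theorem lap_eq_zero_iff {x : ℝ≥0∞} : lap x = 0 ↔ x = ∞ := by
  rw [← lap_top, lap_strictAnti.injective.eq_iff]

theorem lap_sum {ι : Type*} (s : Finset ι) (f : ι → ℝ≥0∞) :
    lap (∑ i ∈ s, f i) = ∏ i ∈ s, lap (f i) := by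
  classical
  induction s using Finset.induction_on with
  | empty => simp [lap_zero]
  | insert a s ha ih => rw [Finset.sum_insert ha, Finset.prod_insert ha, lap_add, ih]

theorem lap_mul_natCast (a : ℝ≥0∞) (n : ℕ) : lap (a * n) = lap a ^ n := by
  induction n with
  | zero => simp [lap_zero]
  | succ n ih => rw [Nat.cast_succ, mul_add, mul_one, lap_add, ih, pow_succ]

/-- Convergence in [0, ∞], infinite limits included, may thus be tested on the transforms. -/
theorem isClosedEmbedding_lap : IsClosedEmbedding lap :=
  continuous_lap.isClosedEmbedding lap_strictAnti.injective

/-- The tangent line inequality for `exp (-x)`. -/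
theorem lap_tangent {m : ℝ≥0∞} (hm : m ≠ ∞) (y : ℝ≥0∞) :
    lap m * (1 + m) ≤ lap y + lap m * y := by
  rcases eq_or_ne y ∞ with rfl | hy
  · rw [ENNReal.mul_top (by rwa [Ne, lap_eq_zero_iff])]; simp
  · lift m to ℝ≥0 using hm
    lift y to ℝ≥0 using hy
    rw [← ENNReal.ofReal_coe_nnreal, ← ENNReal.ofReal_coe_nnreal (p := y), lap_ofReal m.coe_nonneg,
      lap_ofReal y.coe_nonneg, ← ENNReal.ofReal_one, ← ENNReal.ofReal_add zero_le_one m.coe_nonneg,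
      ← ENNReal.ofReal_mul (Real.exp_pos _).le, ← ENNReal.ofReal_mul (Real.exp_pos _).le,
      ← ENNReal.ofReal_add (Real.exp_pos _).le (by positivity)]
    apply ENNReal.ofReal_le_ofReal
    have h := Real.add_one_le_exp ((m : ℝ) - y)
    have h2 : Real.exp (-(y : ℝ)) = Real.exp (-m) * Real.exp (m - y) := by
      rw [← Real.exp_add]; ring_nf
    rw [h2]
    nlinarith [Real.exp_pos (-(m : ℝ))]

/-- Jensen's inequality for `exp (-x)`. -/
theorem lap_lintegral_le {α : Type*} [MeasurableSpace α] (μ : Measure α) [IsProbabilityMeasure μ]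
    {f : α → ℝ≥0∞} (hf : Measurable f) : lap (∫⁻ a, f a ∂μ) ≤ ∫⁻ a, lap (f a) ∂μ := by
  rcases eq_or_ne (∫⁻ a, f a ∂μ) ∞ with h | h
  · rw [h, lap_top]; exact zero_le
  · set m := ∫⁻ a, f a ∂μ with hm
    -- Integrate the tangent inequality at the mean `m`; the term `lap m * m` is finite and cancels.
    have h1 : lap m * (1 + m) ≤ (∫⁻ a, lap (f a) ∂μ) + lap m * m := by
      calc lap m * (1 + m) = ∫⁻ _, lap m * (1 + m) ∂μ := by simp
        _ ≤ ∫⁻ a, lap (f a) + lap m * f a ∂μ := lintegral_mono fun a => lap_tangent h (f a)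
        _ = _ := by
          rw [lintegral_add_left (by fun_prop), lintegral_const_mul _ hf]
    rw [mul_add, mul_one] at h1
    exact (ENNReal.add_le_add_iff_right (ENNReal.mul_ne_top (lap_ne_top _) h)).1 h1

/-! ### Sums over Poisson points -/

theorem lintegral_poissonMeasure (r : ℝ≥0) (f : ℕ → ℝ≥0∞) :
    ∫⁻ n, f n ∂(poissonMeasure r)
      = ∑' n : ℕ, ENNReal.ofReal (Real.exp (-r) * r ^ n / n.factorial) * f n := by
  rw [poissonMeasure, lintegral_sum_measure]
  simp

/-- This is the generating function ∑ e^(-r) (r q)^n / n! = e^(-r(1-q)) at q = `lap a`. -/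
theorem lap_poissonMeasure (r : ℝ≥0) (a : ℝ≥0∞) :
    ∫⁻ n : ℕ, lap (a * n) ∂(poissonMeasure r) = lap (r * (1 - lap a)) := by
  rw [lintegral_poissonMeasure]
  obtain ⟨q, hq⟩ : ∃ q : ℝ≥0, lap a = q := ⟨(lap a).toNNReal, (ENNReal.coe_toNNReal (lap_ne_top a)).symm⟩
  have hq1 : q ≤ 1 := by
    have := lap_le_one a
    rw [hq] at this
    exact_mod_cast this
  simp_rw [lap_mul_natCast, hq]
  have h1 : ∀ n : ℕ, ENNReal.ofReal (Real.exp (-r) * r ^ n / n.factorial) * (q : ℝ≥0∞) ^ n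
      = ENNReal.ofReal (Real.exp (-r) * ((r * q : ℝ) ^ n / n.factorial)) := by
    intro n
    rw [← ENNReal.coe_pow, ← ENNReal.ofReal_coe_nnreal (p := q ^ n),
      ← ENNReal.ofReal_mul (by positivity)]
    congr 1
    rw [NNReal.coe_pow, mul_pow]; ring
  simp_rw [h1]
  have h2 : HasSum (fun n : ℕ => Real.exp (-r) * ((r * q : ℝ) ^ n / n.factorial))
      (Real.exp (-r) * Real.exp (r * q)) := by
    rw [Real.exp_eq_exp_ℝ]
    exact (NormedSpace.expSeries_div_hasSum_exp (r * q : ℝ)).mul_left _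
  rw [← ENNReal.ofReal_tsum_of_nonneg (fun n => by positivity) h2.summable, h2.tsum_eq,
    ← Real.exp_add]
  have h3 : (r : ℝ≥0∞) * (1 - (q : ℝ≥0∞)) = ENNReal.ofReal (r * (1 - q)) := by
    rw [ENNReal.ofReal_mul r.coe_nonneg, ENNReal.ofReal_sub _ q.coe_nonneg]
    simp
  have h4 : (q : ℝ) ≤ 1 := by exact_mod_cast hq1
  rw [h3, lap_ofReal (mul_nonneg r.coe_nonneg (by linarith))]
  congr 2
  ring

theorem mean_poissonMeasure (r : ℝ≥0) : ∫⁻ n : ℕ, (n : ℝ≥0∞) ∂(poissonMeasure r) = r := by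
  rw [lintegral_poissonMeasure, tsum_eq_zero_add' ENNReal.summable]
  have h1 : ∀ n : ℕ, ENNReal.ofReal (Real.exp (-r) * r ^ (n + 1) / (n + 1).factorial) *
      ((n + 1 : ℕ) : ℝ≥0∞) = ENNReal.ofReal (Real.exp (-r) * r * ((r : ℝ) ^ n / n.factorial)) := by
    intro n
    rw [← ENNReal.ofReal_natCast, ← ENNReal.ofReal_mul (by positivity)]
    congr 1
    rw [Nat.factorial_succ]
    push_cast
    field_simp
    ring
  simp_rw [h1]
  have h2 : HasSum (fun n : ℕ => Real.exp (-r) * r * ((r : ℝ) ^ n / n.factorial))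
      (Real.exp (-r) * r * Real.exp r) := by
    rw [Real.exp_eq_exp_ℝ]
    exact (NormedSpace.expSeries_div_hasSum_exp (r : ℝ)).mul_left _
  rw [← ENNReal.ofReal_tsum_of_nonneg (fun n => by positivity) h2.summable, h2.tsum_eq]
  have : Real.exp (-(r : ℝ)) * r * Real.exp r = r := by
    rw [mul_right_comm, ← Real.exp_add]; simp
  rw [this]; simp

/-- Monotone convergence for sums. -/
theorem tendsto_tsum_of_monotone {ι : Type*} [Countable ι] {f : ℕ → ι → ℝ≥0∞} {g : ι → ℝ≥0∞}
    (hf : ∀ i, Monotone fun n => f n i) (h : ∀ i, Tendsto (fun n => f n i) atTop (𝓝 (g i))) :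
    Tendsto (fun n => ∑' i, f n i) atTop (𝓝 (∑' i, g i)) := by
  let _ : MeasurableSpace ι := ⊤
  simp_rw [← lintegral_count]
  exact lintegral_tendsto_of_tendsto_of_monotone (fun n => measurable_from_top.aemeasurable)
    (ae_of_all _ hf) (ae_of_all _ h)

section Poisson

variable {Ω : Type*} [MeasurableSpace Ω] {P : Measure Ω} {ξ : ℕ → Ω → ℝ} {μ : Measure ℝ}

theorem IsPoissonPoints.measurable_pointCount (h : IsPoissonPoints ξ μ P) {A : Set ℝ}
    (hA : MeasurableSet A) : Measurable (pointCount ξ A) := by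
  have h0 := h.measurable
  unfold pointCount
  exact Measurable.tsum fun i => (measurable_const.indicator hA).comp (h0 i)

theorem IsPoissonPoints.mean_pointCount (h : IsPoissonPoints ξ μ P) {A : Set ℝ}
    (hA : MeasurableSet A) (hμ : μ A ≠ ∞) : ∫⁻ ω, pointCount ξ A ω ∂P = μ A := by
  have h1 := (h.count_law A hA hμ).lintegral_comp (f := id) measurable_id.aemeasurable
  simp only [id] at h1
  rw [h1, lintegral_map (f := fun x => x) measurable_id (by fun_prop), mean_poissonMeasure, ENNReal.coe_toNNReal hμ]

theorem IsPoissonPoints.lap_pointCount (h : IsPoissonPoints ξ μ P) {A : Set ℝ}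
    (hA : MeasurableSet A) (hμ : μ A ≠ ∞) (a : ℝ≥0∞) :
    ∫⁻ ω, lap (a * pointCount ξ A ω) ∂P = lap (μ A * (1 - lap a)) := by
  rw [(h.count_law A hA hμ).lintegral_comp (f := fun x => lap (a * x)) (by fun_prop),
    lintegral_map (by fun_prop) (by fun_prop), lap_poissonMeasure, ENNReal.coe_toNNReal hμ]

/-- The expected counts identify the two measures on sets of finite intensity; exhaustion by
spanning sets does the rest. Campbell's formula is then a change of variables. -/
theorem IsPoissonPoints.sum_map_eq [SigmaFinite μ] (h : IsPoissonPoints ξ μ P) :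
    Measure.sum (fun i => P.map (ξ i)) = μ := by
  have key : ∀ A : Set ℝ, MeasurableSet A → μ A ≠ ∞ →
      Measure.sum (fun i => P.map (ξ i)) A = μ A := by
    intro A hA hμ
    rw [Measure.sum_apply _ hA, ← h.mean_pointCount hA hμ]
    unfold pointCount
    have hm : ∀ i, Measurable fun ω => A.indicator (fun _ => (1 : ℝ≥0∞)) (ξ i ω) := fun i =>
      (measurable_const.indicator hA).comp (h.measurable i)
    rw [lintegral_tsum fun i => (hm i).aemeasurable]
    refine tsum_congr fun i => ?_
    rw [← lintegral_map (measurable_const.indicator hA) (h.measurable i)]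
    simp [hA]
  refine Measure.ext fun A hA => ?_
  have hm : Monotone fun n => A ∩ spanningSets μ n := fun m n hmn =>
    Set.inter_subset_inter_right _ (monotone_spanningSets μ hmn)
  have hu : A = ⋃ n, A ∩ spanningSets μ n := by
    rw [← Set.inter_iUnion, iUnion_spanningSets, Set.inter_univ]
  rw [hu, hm.measure_iUnion, hm.measure_iUnion]
  refine iSup_congr fun n => key _ (hA.inter (measurableSet_spanningSets μ n)) ?_
  exact ((measure_mono Set.inter_subset_right).trans_lt (measure_spanningSets_lt_top μ n)).ne

/-- Campbell's formula. -/
theorem IsPoissonPoints.campbell [SigmaFinite μ] (h : IsPoissonPoints ξ μ P) {f : ℝ → ℝ≥0∞}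
    (hf : Measurable f) : ∑' i, ∫⁻ ω, f (ξ i ω) ∂P = ∫⁻ t, f t ∂μ := by
  conv_rhs => rw [← h.sum_map_eq, lintegral_sum_measure]
  exact tsum_congr fun i => (lintegral_map hf (h.measurable i)).symm

/-- Each single point has a law dominated by the intensity. This rules out coinciding marks later.
-/
theorem IsPoissonPoints.map_apply_eq_zero [SigmaFinite μ] (h : IsPoissonPoints ξ μ P) (i : ℕ)
    {A : Set ℝ} (hA : μ A = 0) : P.map (ξ i) A = 0 := by
  rw [← h.sum_map_eq, Measure.sum_apply_eq_zero] at hA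
  exact hA i

/-- The fibres of `φ` inside `S` are disjoint, so the sum is a linear combination of independent
Poisson counts and its transform factorizes. -/
theorem IsPoissonPoints.laplace_simple (h : IsPoissonPoints ξ μ P) (φ : SimpleFunc ℝ ℝ≥0∞)
    {S : Set ℝ} (hS : MeasurableSet S) (hμ : μ S ≠ ∞) :
    ∫⁻ ω, lap (∑' i, S.indicator φ (ξ i ω)) ∂P = lap (∫⁻ t, (1 - lap (S.indicator φ t)) ∂μ) := by
  classical
  set m := φ.range.card
  let e := φ.range.equivFin
  let A : Fin m → Set ℝ := fun j => φ ⁻¹' {(e.symm j : ℝ≥0∞)} ∩ S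
  let a : Fin m → ℝ≥0∞ := fun j => (e.symm j : ℝ≥0∞)
  have hA : ∀ j, MeasurableSet (A j) := fun j => (φ.measurableSet_fiber _).inter hS
  have hμA : ∀ j, μ (A j) ≠ ∞ := fun j =>
    ((measure_mono Set.inter_subset_right).trans_lt hμ.lt_top).ne
  have hdisj : Pairwise (fun i j => Disjoint (A i) (A j)) := by
    intro i j hij
    refine Set.disjoint_left.2 fun t ht ht' => hij ?_
    have h1 : φ t = a i := ht.1
    have h2 : φ t = a j := ht'.1
    exact e.symm.injective (Subtype.ext (h1.symm.trans h2))
  -- A general `G` vanishing at 0 is allowed because the splitting is used twice: for the identity,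
  -- and for `1 - lap` under the intensity.
  have hsplit : ∀ G : ℝ≥0∞ → ℝ≥0∞, G 0 = 0 → ∀ t, G (S.indicator φ t)
      = ∑ j, G (a j) * (A j).indicator (fun _ => (1 : ℝ≥0∞)) t := by
    intro G hG t
    by_cases ht : t ∈ S
    · rw [Set.indicator_of_mem ht]
      have hmem : φ t ∈ φ.range := φ.mem_range_self t
      rw [Finset.sum_eq_single (e ⟨φ t, hmem⟩)]
      · have : t ∈ A (e ⟨φ t, hmem⟩) := ⟨by simp, ht⟩
        simp [this, a]
      · intro j _ hj
        have : t ∉ A j := fun h' => hj <| by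
          have h1 : φ t = a j := h'.1
          refine (e.symm_apply_eq).1 (Subtype.ext ?_)
          exact h1.symm
        simp [this]
      · simp
    · rw [Set.indicator_of_notMem ht, hG]
      symm
      refine Finset.sum_eq_zero fun j _ => ?_
      rw [Set.indicator_of_notMem (fun h' => ht h'.2), mul_zero]
  have hsum : ∀ ω, ∑' i, S.indicator φ (ξ i ω) = ∑ j, a j * pointCount ξ (A j) ω := by
    intro ω
    simp_rw [fun i => hsplit (fun x => x) rfl (ξ i ω)]
    rw [Summable.tsum_finsetSum fun _ _ => ENNReal.summable]
    exact Finset.sum_congr rfl fun j _ => ENNReal.tsum_mul_left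
  have hint : ∫⁻ t, (1 - lap (S.indicator φ t)) ∂μ = ∑ j, μ (A j) * (1 - lap (a j)) := by
    simp_rw [fun t => hsplit (fun x => 1 - lap x) (by simp [lap_zero]) t]
    rw [lintegral_finsetSum _ fun j _ => (measurable_const.indicator (hA j)).const_mul _]
    refine Finset.sum_congr rfl fun j _ => ?_
    rw [lintegral_const_mul _ (measurable_const.indicator (hA j)), lintegral_indicator (hA j)]
    simp [mul_comm]
  simp_rw [hsum, hint, lap_sum]
  have hind : iIndepFun (fun j ω => lap (a j * pointCount ξ (A j) ω)) P :=
    (h.indep m A hA hdisj).comp (fun j x => lap (a j * x)) (fun j => by fun_prop)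
  rw [lintegral_prod_eq_prod_lintegral_of_indepFun _ _ hind]
  · exact Finset.prod_congr rfl fun j _ => h.lap_pointCount (hA j) (hμA j) (a j)
  · intro j
    have := h.measurable_pointCount (hA j)
    fun_prop

/-- The Laplace functional of a Poisson process. -/
theorem IsPoissonPoints.laplace [IsProbabilityMeasure P] [SigmaFinite μ]
    (h : IsPoissonPoints ξ μ P) {f : ℝ → ℝ≥0∞} (hf : Measurable f) :
    ∫⁻ ω, lap (∑' i, f (ξ i ω)) ∂P = lap (∫⁻ t, (1 - lap (f t)) ∂μ) := by
  have hξ := h.measurable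
  -- Cutting off outside the spanning sets makes `laplace_simple` applicable, and `F n` still
  -- increases to `f`.
  let F : ℕ → ℝ → ℝ≥0∞ := fun n => (spanningSets μ n).indicator (SimpleFunc.eapprox f n)
  have hFm : ∀ n, Measurable (F n) := fun n =>
    (SimpleFunc.eapprox f n).measurable.indicator (measurableSet_spanningSets μ n)
  have hmono : ∀ t, Monotone fun n => F n t := by
    intro t m n hmn
    exact (Set.indicator_le_indicator_of_subset (monotone_spanningSets μ hmn)
      (fun _ => zero_le) t).trans
        (Set.indicator_le_indicator (SimpleFunc.monotone_eapprox f hmn t))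
  have hlim : ∀ t, Tendsto (fun n => F n t) atTop (𝓝 (f t)) := by
    intro t
    have h1 : Tendsto (fun n => SimpleFunc.eapprox f n t) atTop (𝓝 (f t)) := by
      have := tendsto_atTop_iSup (fun m n hmn => SimpleFunc.monotone_eapprox f hmn t)
      rwa [SimpleFunc.iSup_eapprox_apply hf] at this
    refine h1.congr' ?_
    obtain ⟨N, hN⟩ := Set.mem_iUnion.1 ((iUnion_spanningSets μ).symm ▸ Set.mem_univ t)
    filter_upwards [eventually_ge_atTop N] with n hn
    exact (Set.indicator_of_mem (monotone_spanningSets μ hn hN) _).symm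
  have hL : Tendsto (fun n => ∫⁻ ω, lap (∑' i, F n (ξ i ω)) ∂P) atTop
      (𝓝 (∫⁻ ω, lap (∑' i, f (ξ i ω)) ∂P)) := by
    refine tendsto_lintegral_of_dominated_convergence (fun _ => 1) (fun n => ?_) (fun n => ?_)
      (by simp) ?_
    · exact measurable_lap.comp (Measurable.tsum fun i => (hFm n).comp (hξ i))
    · exact ae_of_all _ fun ω => lap_le_one _
    · exact ae_of_all _ fun ω => (continuous_lap.tendsto _).comp
        (tendsto_tsum_of_monotone (fun i => hmono _) (fun i => hlim _))
  have hR : Tendsto (fun n => lap (∫⁻ t, (1 - lap (F n t)) ∂μ)) atTop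
      (𝓝 (lap (∫⁻ t, (1 - lap (f t)) ∂μ))) := by
    refine (continuous_lap.tendsto _).comp (lintegral_tendsto_of_tendsto_of_monotone
      (fun n => ?_) (ae_of_all _ fun t m n hmn => ?_) (ae_of_all _ fun t => ?_))
    · have := hFm n
      fun_prop
    · exact tsub_le_tsub_left (lap_antitone (hmono t hmn)) 1
    · exact ENNReal.Tendsto.sub tendsto_const_nhds ((continuous_lap.tendsto _).comp (hlim t))
        (Or.inl ENNReal.one_ne_top)
  refine tendsto_nhds_unique hL (hR.congr fun n => ?_)
  exact (h.laplace_simple _ (measurableSet_spanningSets μ n) (measure_spanningSets_lt_top μ n).ne).symm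

end Poisson

/-! ### Resampling independent families -/

/-- Resampling the coordinates in `S` of an independent family does not change its law. -/
theorem map_resample {ι Ω E : Type*} [MeasurableSpace Ω] [MeasurableSpace E] {P : Measure Ω}
    [IsProbabilityMeasure P] {ξ : ι → Ω → E} (hm : ∀ i, Measurable (ξ i)) (h : iIndepFun ξ P)
    (S : Set ι) [DecidablePred (· ∈ S)] :
    (P.prod P).map (fun p i => if i ∈ S then ξ i p.2 else ξ i p.1) = P.map (fun ω i => ξ i ω) := by
  have _ i := Measure.isProbabilityMeasure_map (μ := P) (hm i).aemeasurable
  rw [h.map_fun_eq_infinitePi_map hm]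
  have hmm : Measurable (fun (p : Ω × Ω) i => if i ∈ S then ξ i p.2 else ξ i p.1) := by
    refine measurable_pi_lambda _ fun i => ?_
    split_ifs
    · exact (hm i).comp measurable_snd
    · exact (hm i).comp measurable_fst
  refine Measure.eq_infinitePi _ fun s t ht => ?_
  rw [Measure.map_apply hmm (MeasurableSet.pi s.countable_toSet fun i _ => ht i)]
  -- A box pulls back to a product: coordinates outside `S` constrain only the first copy, those in
  -- `S` only the second.
  have hset : (fun (p : Ω × Ω) i => if i ∈ S then ξ i p.2 else ξ i p.1) ⁻¹' (Set.pi s t)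
      = (⋂ i ∈ s.filter (· ∉ S), ξ i ⁻¹' t i) ×ˢ (⋂ i ∈ s.filter (· ∈ S), ξ i ⁻¹' t i) := by
    ext p
    simp only [Set.mem_preimage, Set.mem_pi, Finset.mem_coe, Set.mem_prod, Set.mem_iInter,
      Finset.mem_filter]
    constructor
    · intro hp
      refine ⟨fun i hi => ?_, fun i hi => ?_⟩
      · simpa [hi.2] using hp i hi.1
      · simpa [hi.2] using hp i hi.1
    · intro hp i hi
      split_ifs with hS
      · exact hp.2 i ⟨hi, hS⟩
      · exact hp.1 i ⟨hi, hS⟩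
  rw [hset, Measure.prod_prod, h.measure_inter_preimage_eq_mul _ fun i _ => ht i,
    h.measure_inter_preimage_eq_mul _ fun i _ => ht i]
  rw [mul_comm, Finset.prod_filter_mul_prod_filter_not]
  exact Finset.prod_congr rfl fun i _ => (Measure.map_apply (hm i) (ht i)).symm

/-! ### Almost sure convergence and finiteness by means of bounded transforms. -/

section Convergence

variable {Z : Type*} [MeasurableSpace Z] {ν : Measure Z} [IsProbabilityMeasure ν]

/-- The σ-algebra of the sets that are invariant under a resampling map. -/
@[reducible]
def invariantSigma (M : Z → Z → Z) : MeasurableSpace Z where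
  MeasurableSet' A := ∀ z w, M z w ∈ A ↔ z ∈ A
  measurableSet_empty := by simp
  measurableSet_compl A h z w := not_congr (h z w)
  measurableSet_iUnion f h z w := by
    simp only [Set.mem_iUnion]
    exact exists_congr fun i => h i z w

/-- Let `M n` resample the `n`-th coordinate. If `Y n` depends on the first `n` coordinates only and
`lap (Y n)` is a submartingale, then `Y n` converges in `[0, ∞]` almost surely. -/
theorem ae_exists_tendsto_of_resample {M : ℕ → Z → Z → Z}
    (hM : ∀ n, Measurable fun p : Z × Z => M n p.1 p.2)
    (hMν : ∀ n, (ν.prod ν).map (fun p => M n p.1 p.2) = ν) {Y : ℕ → Z → ℝ≥0∞}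
    (hY : ∀ n, Measurable (Y n)) (hinv : ∀ n, ∀ m ≤ n, ∀ z w, Y m (M n z w) = Y m z)
    (hsub : ∀ n, ∀ᵐ z ∂ν, lap (Y n z) ≤ ∫⁻ w, lap (Y (n + 1) (M n z w)) ∂ν) :
    ∀ᵐ z ∂ν, ∃ c, Tendsto (fun n => Y n z) atTop (𝓝 c) := by
  have hlY : ∀ n, Measurable fun z => lap (Y n z) := fun n => measurable_lap.comp (hY n)
  let f : ℕ → Z → ℝ := fun n z => (lap (Y n z)).toReal
  have hf : ∀ n, Measurable (f n) := fun n => (hlY n).ennreal_toReal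
  have hfs : ∀ n, StronglyMeasurable (f n) := fun n => (hf n).stronglyMeasurable
  let ℱ := Filtration.natural f hfs
  have hbd : ∀ n z, ‖f n z‖ ≤ 1 := by
    intro n z
    rw [Real.norm_of_nonneg ENNReal.toReal_nonneg]
    exact ENNReal.toReal_mono ENNReal.one_ne_top (lap_le_one _)
  have hint : ∀ n, Integrable (f n) ν := fun n =>
    Integrable.of_bound (hfs n).aestronglyMeasurable 1 (ae_of_all _ (hbd n))
  -- The filtration up to `n` is generated by variables that resampling the `n`-th coordinate leaves
  -- unchanged, so its events are invariant. This replaces any conditional expectation.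
  have hℱ : ∀ n, ∀ A, MeasurableSet[ℱ n] A → ∀ z w, M n z w ∈ A ↔ z ∈ A := by
    intro n
    have : ℱ n ≤ invariantSigma (M n) := by
      refine iSup₂_le fun j hj => ?_
      rintro A ⟨B, -, rfl⟩ z w
      simp only [Set.mem_preimage, f, hinv n j hj z w]
    exact this
  have hstep : ∀ n A, MeasurableSet[ℱ n] A →
      ∫⁻ z in A, lap (Y n z) ∂ν ≤ ∫⁻ z in A, lap (Y (n + 1) z) ∂ν := by
    intro n A hA
    have hAm : MeasurableSet A := ℱ.le n _ hA
    have hm1 : Measurable (A.indicator fun z => lap (Y (n + 1) z)) := (hlY (n + 1)).indicator hAm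
    have hm2 : Measurable fun p : Z × Z => A.indicator (fun z => lap (Y (n + 1) z)) (M n p.1 p.2) :=
      hm1.comp (hM n)
    rw [← lintegral_indicator hAm, ← lintegral_indicator hAm]
    -- Replacing `z` by `M n z w` preserves the law and membership in `A`, so the inner integral
    -- over `w` is the one bounded in `hsub`.
    conv_rhs => rw [← hMν n]
    rw [lintegral_map hm1 (hM n), lintegral_prod _ hm2.aemeasurable]
    refine lintegral_mono_ae ?_
    filter_upwards [hsub n] with z hz
    by_cases hzA : z ∈ A
    · rw [Set.indicator_of_mem hzA]
      refine hz.trans_eq (lintegral_congr fun w => ?_)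
      rw [Set.indicator_of_mem ((hℱ n A hA z w).2 hzA)]
    · rw [Set.indicator_of_notMem hzA]
      exact zero_le
  have hsm : Submartingale f ℱ ν := by
    refine submartingale_of_setIntegral_le_succ (Filtration.stronglyAdapted_natural hfs) hint
      fun n A hA => ?_
    simp only [f]
    rw [integral_toReal (hlY n).aemeasurable
        (ae_of_all _ fun z => (lap_ne_top _).lt_top),
      integral_toReal (hlY (n + 1)).aemeasurable
        (ae_of_all _ fun z => (lap_ne_top _).lt_top)]
    refine ENNReal.toReal_mono (ne_of_lt ?_) (hstep n A hA)
    calc ∫⁻ z in A, lap (Y (n + 1) z) ∂ν ≤ ∫⁻ z in A, 1 ∂ν := lintegral_mono fun z => lap_le_one _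
      _ < ∞ := by simp
  have hL1 : ∀ n, eLpNorm (f n) 1 ν ≤ (1 : ℝ≥0) := by
    intro n
    refine (eLpNorm_le_of_ae_bound (C := 1) (ae_of_all _ (hbd n))).trans ?_
    simp
  filter_upwards [hsm.exists_ae_tendsto_of_bdd hL1] with z hz
  obtain ⟨c, hc⟩ := hz
  have h1 : Tendsto (fun n => lap (Y n z)) atTop (𝓝 (ENNReal.ofReal c)) := by
    have := (ENNReal.continuous_ofReal.tendsto c).comp hc
    refine this.congr fun n => ?_
    simp [f, ENNReal.ofReal_toReal (lap_ne_top _)]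
  -- The range of `lap` is closed, so the limit of the transforms is itself a transform.
  obtain ⟨d, hd⟩ : ENNReal.ofReal c ∈ Set.range lap :=
    isClosedEmbedding_lap.isClosed_range.mem_of_tendsto h1 (Eventually.of_forall fun n => ⟨_, rfl⟩)
  refine ⟨d, isClosedEmbedding_lap.isInducing.tendsto_nhds_iff.2 ?_⟩
  rw [hd]
  exact h1

/-- A variable whose Laplace transform tends to `1` at `0` is finite. -/
theorem ae_ne_top_of_lap {Y : Z → ℝ≥0∞} (hY : Measurable Y) (c b : ℕ → ℝ≥0∞)
    (hc : ∀ j, c j ≠ 0) (hb : Tendsto b atTop (𝓝 0))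
    (h : ∀ j, lap (b j) ≤ ∫⁻ z, lap (c j * Y z) ∂ν) : ∀ᵐ z ∂ν, Y z ≠ ∞ := by
  have hms : MeasurableSet {z | Y z ≠ ∞} := (hY (measurableSet_singleton ∞)).compl
  -- As `c j ≠ 0`, the integrand vanishes where `Y = ∞`; the probability of `Y < ∞` is thus at least
  -- `lap (b j)`, which tends to 1.
  have h1 : ∀ j, lap (b j) ≤ ν {z | Y z ≠ ∞} := by
    intro j
    refine (h j).trans ?_
    rw [← lintegral_indicator_one hms]
    refine lintegral_mono fun z => ?_
    by_cases hz : Y z = ∞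
    · simp [hz, ENNReal.mul_top (hc j), lap_top]
    · rw [Set.indicator_of_mem (show z ∈ {z | Y z ≠ ∞} from hz)]
      exact lap_le_one _
  have h2 : (1 : ℝ≥0∞) ≤ ν {z | Y z ≠ ∞} := by
    have := (continuous_lap.tendsto 0).comp hb
    rw [lap_zero] at this
    exact le_of_tendsto' this h1
  rw [ae_iff]
  have := (prob_compl_eq_zero_iff (μ := ν) hms).2 (le_antisymm prob_le_one h2)
  simpa [Set.compl_def] using this

/-- If `lap` of each of countably many independent variables has mean `lap (b i)`, then `lap` of
their sum has mean `lap (∑' i, b i)`. -/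
theorem lap_tsum_of_iIndepFun {ι : Type*} [Countable ι] {Y : ι → Z → ℝ≥0∞}
    (hY : ∀ i, Measurable (Y i)) (hind : iIndepFun Y ν) {b : ι → ℝ≥0∞}
    (h : ∀ i, ∫⁻ z, lap (Y i z) ∂ν = lap (b i)) :
    ∫⁻ z, lap (∑' i, Y i z) ∂ν = lap (∑' i, b i) := by
  have h1 : Tendsto (fun s : Finset ι => ∫⁻ z, lap (∑ i ∈ s, Y i z) ∂ν) atTop
      (𝓝 (∫⁻ z, lap (∑' i, Y i z) ∂ν)) := by
    refine tendsto_lintegral_filter_of_dominated_convergence (fun _ => 1)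
      (Eventually.of_forall fun s => ?_) (Eventually.of_forall fun s => ae_of_all _ fun z =>
        lap_le_one _) (by simp) (ae_of_all _ fun z => ?_)
    · fun_prop
    · exact (continuous_lap.tendsto _).comp ENNReal.summable.hasSum
  have h2 : Tendsto (fun s : Finset ι => lap (∑ i ∈ s, b i)) atTop (𝓝 (lap (∑' i, b i))) :=
    (continuous_lap.tendsto _).comp ENNReal.summable.hasSum
  refine tendsto_nhds_unique h1 (h2.congr fun s => ?_)
  simp_rw [lap_sum]
  have hind' : iIndepFun (fun i z => lap (Y i z)) ν :=
    hind.comp (fun _ => lap) (fun _ => measurable_lap)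
  rw [lintegral_prod_eq_prod_lintegral_of_indepFun s _ hind' fun i => measurable_lap.comp (hY i)]
  exact Finset.prod_congr rfl fun i _ => (h i).symm

end Convergence

/-! ### Stable laws -/

/-- Writing 1 - e^(-v) as an integral over u ≤ v prepares the exchange of integrals that yields a
Gamma integral. -/
theorem one_sub_lap_eq_lintegral {v : ℝ} (hv : 0 ≤ v) :
    1 - lap (ENNReal.ofReal v) = ∫⁻ u in Set.Ioi (0 : ℝ),
      (Set.Iic v).indicator (fun u => ENNReal.ofReal (Real.exp (-u))) u := by
  rw [lap_ofReal hv, ← ENNReal.ofReal_one, ← ENNReal.ofReal_sub _ (Real.exp_pos _).le,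
    lintegral_indicator measurableSet_Iic, Measure.restrict_restrict measurableSet_Iic,
    Set.inter_comm, Set.Ioi_inter_Iic, ← ofReal_integral_eq_lintegral_ofReal]
  · rw [← intervalIntegral.integral_of_le hv]
    have : ∫ u in (0 : ℝ)..v, Real.exp (-u) = 1 - Real.exp (-v) := by
      rw [intervalIntegral.integral_comp_neg (fun u => Real.exp u)]
      simp
    rw [this]
  · exact ((Continuous.integrableOn_Icc (by fun_prop)).mono_set Set.Ioc_subset_Icc_self)
  · exact ae_of_all _ fun u => (Real.exp_pos _).le

theorem lintegral_Ici_power {a c s : ℝ} (ha : 0 < a) (hc : 0 ≤ c) (hs : 0 < s) :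
    ∫⁻ t in Set.Ici s, ENNReal.ofReal (c / t ^ (1 + a)) = ENNReal.ofReal (c / a * s ^ (-a)) := by
  rw [setLIntegral_congr Ioi_ae_eq_Ici.symm]
  have h1 : ∀ t ∈ Set.Ioi s, c / t ^ (1 + a) = c * t ^ (-1 - a) := by
    intro t ht
    have : 0 < t := hs.trans ht
    rw [div_eq_mul_inv, ← Real.rpow_neg this.le]
    ring_nf
  rw [setLIntegral_congr_fun measurableSet_Ioi (fun t ht => by rw [h1 t ht]),
    ← ofReal_integral_eq_lintegral_ofReal]
  · rw [integral_const_mul, integral_Ioi_rpow_of_lt (by linarith) hs]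
    congr 1
    have : -1 - a + 1 = -a := by ring
    rw [this]
    field_simp
  · exact (integrableOn_Ioi_rpow_of_lt (by linarith) hs).const_mul c
  · filter_upwards [ae_restrict_mem measurableSet_Ioi] with t ht
    exact mul_nonneg hc (Real.rpow_nonneg (hs.trans ht).le _)

instance (α : ℕ → ℝ) (k : ℕ) : SigmaFinite (levelIntensity α k) :=
  SigmaFinite.withDensity_ofReal (fun t => levelConst α k / t ^ (1 + α k))

/-- The Laplace exponent of a stable law. -/
theorem lintegral_levelIntensity {α : ℕ → ℝ} (hα : StrictMono α) (hα0 : 0 < α 0) (k : ℕ) {b : ℝ}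
    (hb : 0 ≤ b) :
    ∫⁻ t, (1 - lap (ENNReal.ofReal (b * t ^ α (k + 1)))) ∂(levelIntensity α k)
      = ENNReal.ofReal (b ^ (α k / α (k + 1))) := by
  have ha : 0 < α k := hα0.trans_le (hα.monotone (Nat.zero_le k))
  have hap : α k < α (k + 1) := hα (Nat.lt_succ_self k)
  set a := α k
  set p := α (k + 1)
  have hp : 0 < p := ha.trans hap
  have hap1 : a / p < 1 := (div_lt_one hp).2 hap
  rcases hb.eq_or_lt with rfl | hb
  · simp [lap_zero, (div_pos ha hp).ne']
  have hG : 0 < Real.Gamma (1 - a / p) := Real.Gamma_pos_of_pos (by linarith)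
  set c := levelConst α k with hc
  have hc' : c = a / Real.Gamma (1 - a / p) := rfl
  have hc0 : 0 < c := div_pos ha hG
  have hden : Measurable fun t : ℝ => ENNReal.ofReal (c / t ^ (1 + a)) := by fun_prop
  unfold levelIntensity
  rw [lintegral_withDensity_eq_lintegral_mul _ hden (by fun_prop)]
  have h1 : ∀ t ∈ Set.Ioi (0 : ℝ), ((fun t => ENNReal.ofReal (c / t ^ (1 + a))) *
      fun t => 1 - lap (ENNReal.ofReal (b * t ^ p))) t = ∫⁻ u in Set.Ioi (0 : ℝ),
        ENNReal.ofReal (c / t ^ (1 + a)) *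
          (Set.Iic (b * t ^ p)).indicator (fun u => ENNReal.ofReal (Real.exp (-u))) u := by
    intro t ht
    rw [Pi.mul_apply, one_sub_lap_eq_lintegral (mul_nonneg hb.le (Real.rpow_nonneg (le_of_lt ht) _)),
      lintegral_const_mul]
    exact Measurable.indicator (by fun_prop) measurableSet_Iic
  rw [setLIntegral_congr_fun measurableSet_Ioi h1, lintegral_lintegral_swap]
  swap
  · have : MeasurableSet {q : ℝ × ℝ | q.2 ≤ b * q.1 ^ p} :=
      measurableSet_le (by fun_prop) (by fun_prop)
    have hm : Measurable fun q : ℝ × ℝ => ENNReal.ofReal (c / q.1 ^ (1 + a)) *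
        {q : ℝ × ℝ | q.2 ≤ b * q.1 ^ p}.indicator
          (fun q => ENNReal.ofReal (Real.exp (-q.2))) q :=
      Measurable.mul (by fun_prop) (Measurable.indicator (by fun_prop) this)
    exact hm.aemeasurable
  -- After the exchange, the power tail is integrated over t ≥ (u/b)^(1/p), leaving u^(-a/p) e^(-u).
  -- Its integral is Γ(1 - a/p), the constant in the denominator of `levelConst`.
  have h2 : ∀ u ∈ Set.Ioi (0 : ℝ), ∫⁻ t in Set.Ioi (0 : ℝ), ENNReal.ofReal (c / t ^ (1 + a)) *
        (Set.Iic (b * t ^ p)).indicator (fun u => ENNReal.ofReal (Real.exp (-u))) u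
      = ENNReal.ofReal (c / a * b ^ (a / p) * (Real.exp (-u) * u ^ ((1 - a / p) - 1))) := by
    intro u hu
    have hu' : 0 < u := hu
    set s := (u / b) ^ (1 / p) with hs
    have hs0 : 0 < s := Real.rpow_pos_of_pos (div_pos hu' hb) _
    have hiff : ∀ t ∈ Set.Ioi (0 : ℝ), u ≤ b * t ^ p ↔ s ≤ t := by
      intro t ht
      have ht' : 0 < t := ht
      rw [hs, one_div, Real.rpow_inv_le_iff_of_pos (div_pos hu' hb).le ht'.le hp,
        div_le_iff₀ hb, mul_comm]
    have h3 : ∀ t ∈ Set.Ioi (0 : ℝ), ENNReal.ofReal (c / t ^ (1 + a)) *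
        (Set.Iic (b * t ^ p)).indicator (fun u => ENNReal.ofReal (Real.exp (-u))) u
        = (Set.Ici s).indicator (fun t => ENNReal.ofReal (c / t ^ (1 + a))) t *
          ENNReal.ofReal (Real.exp (-u)) := by
      intro t ht
      by_cases h : s ≤ t
      · rw [Set.indicator_of_mem (show u ∈ Set.Iic _ from (hiff t ht).2 h),
          Set.indicator_of_mem (show t ∈ Set.Ici s from h)]
      · rw [Set.indicator_of_notMem (fun h' : u ∈ Set.Iic (b * t ^ p) => h ((hiff t ht).1 h')),
          Set.indicator_of_notMem (show t ∉ Set.Ici s from h), mul_zero, zero_mul]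
    rw [setLIntegral_congr_fun measurableSet_Ioi h3,
      lintegral_mul_const _ (Measurable.indicator hden measurableSet_Ici),
      lintegral_indicator measurableSet_Ici, Measure.restrict_restrict measurableSet_Ici,
      Set.inter_eq_left.2 (Set.Ici_subset_Ioi.2 hs0),
      lintegral_Ici_power ha hc0.le hs0, ← ENNReal.ofReal_mul (by positivity)]
    congr 1
    have h4 : s ^ (-a) = b ^ (a / p) * u ^ ((1 - a / p) - 1) := by
      rw [hs, ← Real.rpow_mul (div_pos hu' hb).le, Real.div_rpow hu'.le hb.le, div_eq_mul_inv,
        ← Real.rpow_neg hb.le, mul_comm]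
      congr 2
      · field_simp
      · field_simp; ring
    rw [h4]; ring
  rw [setLIntegral_congr_fun measurableSet_Ioi h2, ← ofReal_integral_eq_lintegral_ofReal]
  · rw [integral_const_mul, ← Real.Gamma_eq_integral (by linarith), hc']
    congr 1
    have hG' := hG.ne'
    generalize Real.Gamma (1 - a / p) = G at hG'
    field_simp
  · exact (Real.GammaIntegral_convergent (by linarith)).const_mul _
  · filter_upwards [ae_restrict_mem measurableSet_Ioi] with u hu
    have hu' : (0 : ℝ) < u := hu
    positivity

/-! ### Sums over descendants -/

theorem envProd_eq_prod_range (g : List ℕ → ℕ → ℝ) (y : List ℕ) :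
    envProd g y = ∏ j ∈ Finset.range y.length, g (y.take j) (y.getD j 0) := by
  rw [envProd, Finset.prod_range]
  exact Finset.prod_congr rfl fun j _ => by simp

theorem envProd_concat (g : List ℕ → ℕ → ℝ) (y : List ℕ) (z : ℕ) :
    envProd g (y ++ [z]) = envProd g y * g y z := by
  rw [envProd_eq_prod_range, envProd_eq_prod_range, List.length_append, List.length_singleton,
    Finset.prod_range_succ]
  congr 1
  · refine Finset.prod_congr rfl fun j hj => ?_
    have hj' := Finset.mem_range.1 hj
    rw [List.take_append_of_le_length hj'.le, List.getD_append _ _ _ _ hj']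
  · simp

theorem envProd_congr {g g' : List ℕ → ℕ → ℝ} {y : List ℕ}
    (h : ∀ v : List ℕ, v.length < y.length → g v = g' v) : envProd g y = envProd g' y := by
  rw [envProd_eq_prod_range, envProd_eq_prod_range]
  refine Finset.prod_congr rfl fun j hj => ?_
  have hj' := Finset.mem_range.1 hj
  rw [h _ (by simp [hj'])]

theorem envProd_pos {g : List ℕ → ℕ → ℝ} (hg : ∀ y z, 0 < g y z) (y : List ℕ) : 0 < envProd g y :=
  Finset.prod_pos fun _ _ => hg _ _

/-- The sum over the descendants `y` of `x` at depth `n` of the ratio of the products of `y` and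
`x` to the power `p`. -/
def descSum (p : ℝ) (g : List ℕ → ℕ → ℝ) (x : List ℕ) (n : ℕ) : ℝ≥0∞ :=
  ∑' y : {y : List ℕ // y.length = n ∧ x <+: y}, ENNReal.ofReal ((envProd g y / envProd g x) ^ p)

theorem WApprox_eq_descSum (α : ℕ → ℝ) (g : List ℕ → ℕ → ℝ) (x : List ℕ) (n : ℕ) :
    WApprox α g x n = descSum (α n) g x n := rfl

/-- The descendants of `x` at depth `n + 1` are the children of those at depth `n`. -/
def descLast {x : List ℕ} {n : ℕ} (hn : x.length ≤ n) :
    {y : List ℕ // y.length = n ∧ x <+: y} × ℕ ≃ {y : List ℕ // y.length = n + 1 ∧ x <+: y} :=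
  Equiv.ofBijective
    (fun q => ⟨q.1.1 ++ [q.2], by simp [q.1.2.1], q.1.2.2.trans (List.prefix_append _ _)⟩) <| by
    constructor
    · rintro ⟨⟨y, hy⟩, z⟩ ⟨⟨y', hy'⟩, z'⟩ h
      simp only [Subtype.mk.injEq] at h
      obtain ⟨h1, h2⟩ := List.append_inj' h rfl
      simp only [List.cons.injEq, and_true] at h2
      simp [h1, h2]
    · rintro ⟨y, hy, hxy⟩
      have hne : y ≠ [] := by rintro rfl; simp at hy
      have hlen : y.dropLast.length = n := by simp [hy]
      refine ⟨(⟨y.dropLast, hlen, ?_⟩, y.getLast hne), ?_⟩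
      · exact List.prefix_of_prefix_length_le hxy (List.dropLast_prefix y) (by omega)
      · exact Subtype.ext (List.dropLast_append_getLast hne)

/-- The descendants of `x` at depth `n > |x|` are those of its children. -/
def descFirst {x : List ℕ} {n : ℕ} (hn : x.length < n) :
    (Σ z : ℕ, {y : List ℕ // y.length = n ∧ (x ++ [z]) <+: y}) ≃
      {y : List ℕ // y.length = n ∧ x <+: y} :=
  Equiv.ofBijective
    (fun q => ⟨q.2.1, q.2.2.1, (List.prefix_append _ _).trans q.2.2.2⟩) <| by
    constructor
    · rintro ⟨z, ⟨y, hy⟩⟩ ⟨z', ⟨y', hy'⟩⟩ h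
      simp only [Subtype.mk.injEq] at h
      subst h
      have := (List.prefix_of_prefix_length_le hy.2 hy'.2 (by simp)).eq_of_length (by simp)
      have hz : z = z' := by simpa using this
      subst hz
      rfl
    · rintro ⟨y, hy, ⟨t, rfl⟩⟩
      cases t with
      | nil => simp at hy; omega
      | cons z t => exact ⟨⟨z, ⟨x ++ z :: t, hy, ⟨t, by simp⟩⟩⟩, rfl⟩

/-- Splitting off the last generation isolates the variables that are fresh at depth `n`, as the
martingale step requires. -/
theorem descSum_succ (p : ℝ) (g : List ℕ → ℕ → ℝ) {x : List ℕ} {n : ℕ} (hn : x.length ≤ n) :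
    descSum p g x (n + 1) = ∑' y : {y : List ℕ // y.length = n ∧ x <+: y}, ∑' z : ℕ,
      ENNReal.ofReal ((envProd g y / envProd g x * g y z) ^ p) := by
  rw [descSum, ← (descLast hn).tsum_eq, ENNReal.tsum_prod']
  refine tsum_congr fun y => tsum_congr fun z => ?_
  congr 2
  change envProd g (y.1 ++ [z]) / _ = _
  rw [envProd_concat]
  ring

/-- Splitting off the first generation instead gives the recursion that passes to the limit `W`. -/
theorem descSum_eq_tsum_child (p : ℝ) {g : List ℕ → ℕ → ℝ} (hg : ∀ y z, 0 < g y z) {x : List ℕ}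
    {n : ℕ} (hn : x.length < n) :
    descSum p g x n = ∑' z : ℕ, ENNReal.ofReal (g x z ^ p) * descSum p g (x ++ [z]) n := by
  rw [descSum, ← (descFirst hn).tsum_eq, ENNReal.tsum_sigma']
  refine tsum_congr fun z => ?_
  rw [descSum, ← ENNReal.tsum_mul_left]
  refine tsum_congr fun y => ?_
  have h1 := envProd_pos hg x
  have h2 := envProd_pos hg y.1
  have h3 := hg x z
  rw [← ENNReal.ofReal_mul (Real.rpow_nonneg h3.le _), envProd_concat,
    ← Real.mul_rpow h3.le (by positivity)]
  congr 2
  change envProd g y.1 / _ = _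
  field_simp

theorem descSum_self (p : ℝ) {g : List ℕ → ℕ → ℝ} (hg : ∀ y z, 0 < g y z) (x : List ℕ) :
    descSum p g x x.length = 1 := by
  have h0 : ∀ y : {y : List ℕ // y.length = x.length ∧ x <+: y}, y = ⟨x, rfl, List.prefix_rfl⟩ :=
    fun y => Subtype.ext (y.2.2.eq_of_length y.2.1.symm).symm
  rw [descSum, tsum_eq_single ⟨x, rfl, List.prefix_rfl⟩ fun y hy => absurd (h0 y) hy]
  simp [div_self (envProd_pos hg x).ne']

@[fun_prop]
theorem measurable_envProd (y : List ℕ) : Measurable fun g : List ℕ → ℕ → ℝ => envProd g y := by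
  unfold envProd
  fun_prop

@[fun_prop]
theorem measurable_descSum (p : ℝ) (x : List ℕ) (n : ℕ) :
    Measurable fun g : List ℕ → ℕ → ℝ => descSum p g x n := by
  unfold descSum
  exact Measurable.tsum fun y => by fun_prop

@[fun_prop]
theorem measurable_WApprox (α : ℕ → ℝ) (x : List ℕ) (n : ℕ) :
    Measurable fun g : List ℕ → ℕ → ℝ => WApprox α g x n :=
  measurable_descSum (α n) x n

@[fun_prop]
theorem measurable_W (α : ℕ → ℝ) (x : List ℕ) : Measurable fun g : List ℕ → ℕ → ℝ => W α g x := by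
  unfold W
  exact Measurable.limsup fun n => measurable_WApprox α x n

/-- If a sum of powers below `1` is finite, so is the sum itself. -/
theorem descSum_one_ne_top {p : ℝ} (hp : 0 < p) (hp1 : p < 1) {g : List ℕ → ℕ → ℝ}
    (hg : ∀ y z, 0 < g y z) {x : List ℕ} {n : ℕ} (h : descSum p g x n ≠ ∞) :
    descSum 1 g x n ≠ ∞ := by
  set S := descSum p g x n with hS
  -- Write r = (r^p)^((1-p)/p) · r^p and bound the first factor by means of r^p ≤ S.
  have hbound : ∀ y : {y : List ℕ // y.length = n ∧ x <+: y},
      ENNReal.ofReal ((envProd g y / envProd g x) ^ (1 : ℝ)) ≤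
        S ^ ((1 - p) / p) * ENNReal.ofReal ((envProd g y / envProd g x) ^ p) := by
    intro y
    have hr : 0 < envProd g y / envProd g x := div_pos (envProd_pos hg _) (envProd_pos hg _)
    set r := envProd g y / envProd g x
    have h1 : ENNReal.ofReal (r ^ p) ≤ S := ENNReal.le_tsum y
    have h2 : ENNReal.ofReal (r ^ (1 : ℝ))
        = ENNReal.ofReal (r ^ p) ^ ((1 - p) / p) * ENNReal.ofReal (r ^ p) := by
      rw [ENNReal.ofReal_rpow_of_pos (by positivity), ← ENNReal.ofReal_mul (by positivity),
        ← Real.rpow_mul hr.le, ← Real.rpow_add hr]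
      congr 2
      field_simp
      ring
    rw [h2]
    gcongr
  refine ((ENNReal.tsum_le_tsum hbound).trans_lt ?_).ne
  rw [ENNReal.tsum_mul_left]
  exact ENNReal.mul_lt_top (ENNReal.rpow_lt_top_of_nonneg (div_nonneg (by linarith) hp.le) h)
    h.lt_top

/-- The sum `∑ z, g y z * F (y z)` over the children of `y`. -/
def childSum (g : List ℕ → ℕ → ℝ) (F : List ℕ → ℝ≥0∞) (y : List ℕ) : ℝ≥0∞ :=
  ∑' z : ℕ, F (y ++ [z]) * ENNReal.ofReal (g y z)

/-- Fatou's lemma for counting measure; mass may escape along the index, hence only an inequality.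
-/
theorem tsum_le_liminf {ι : Type*} [Countable ι] {f : ℕ → ι → ℝ≥0∞} {g : ι → ℝ≥0∞} {a : ℝ≥0∞}
    (h : ∀ i, Tendsto (fun n => f n i) atTop (𝓝 (g i)))
    (ha : Tendsto (fun n => ∑' i, f n i) atTop (𝓝 a)) : ∑' i, g i ≤ a := by
  let _ : MeasurableSpace ι := ⊤
  have h1 : ∫⁻ i, liminf (fun n => f n i) atTop ∂Measure.count
      ≤ liminf (fun n => ∫⁻ i, f n i ∂Measure.count) atTop :=
    lintegral_liminf_le fun n => measurable_from_top
  simp only [lintegral_count, ha.liminf_eq] at h1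
  rwa [tsum_congr fun i => (h i).liminf_eq] at h1

/-- Pass to the limit in the first-generation recursion; since α n → 1, the weights γ^(α n) tend to
γ. The inequality is all that the supermartingale argument uses. -/
theorem childSum_W_le {α : ℕ → ℝ} (hα_lim : Tendsto α atTop (𝓝 1)) {g : List ℕ → ℕ → ℝ}
    (hg : ∀ y z, 0 < g y z) (hW : ∀ x, W α g x ≠ ∞)
    (hWt : ∀ x, Tendsto (WApprox α g x) atTop (𝓝 (W α g x))) (x : List ℕ) :
    childSum g (W α g) x ≤ W α g x := by
  refine tsum_le_liminf
    (f := fun n z => WApprox α g (x ++ [z]) n * ENNReal.ofReal (g x z ^ α n)) (fun z => ?_) ?_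
  · refine ENNReal.Tendsto.mul (hWt _) (Or.inr ENNReal.ofReal_ne_top) ?_ (Or.inr (hW _))
    refine ENNReal.tendsto_ofReal ?_
    have h1 : Tendsto (fun n => g x z ^ α n) atTop (𝓝 (g x z ^ (1 : ℝ))) :=
      tendsto_const_nhds.rpow hα_lim (Or.inl (hg x z).ne')
    rwa [Real.rpow_one] at h1
  · refine (hWt x).congr' ?_
    filter_upwards [eventually_gt_atTop x.length] with n hn
    rw [WApprox_eq_descSum, descSum_eq_tsum_child _ hg hn]
    exact tsum_congr fun z => mul_comm _ _

/-- The properties of the environment that are used in the analysis of the dynamics. -/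
structure GoodEnv (α : ℕ → ℝ) (g : List ℕ → ℕ → ℝ) : Prop where
  pos : ∀ y z, 0 < g y z
  W_ne_top : ∀ x, W α g x ≠ ∞
  W_tendsto : ∀ x, Tendsto (WApprox α g x) atTop (𝓝 (W α g x))
  childSum_W : ∀ x, childSum g (W α g) x ≤ W α g x
  descSum_ne_top : ∀ n, descSum 1 g [] n ≠ ∞

/-! ### The environment -/

/-- Replacement of the nodes of depth `n`. -/
def resampleEnv (n : ℕ) (g g' : List ℕ → ℕ → ℝ) : List ℕ → ℕ → ℝ :=
  fun y => if y.length = n then g' y else g y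

section Environment

variable {Ω : Type*} [MeasurableSpace Ω] {P : Measure Ω}
  {α : ℕ → ℝ} {γ : Ω → List ℕ → ℕ → ℝ} {σ T : Ω → ℕ → ℕ → ℕ → ℝ}

theorem IsInput.measurable_env (h : IsInput α γ σ T P) : Measurable γ :=
  measurable_pi_lambda _ fun y => measurable_pi_lambda _ fun x => (h.env_poisson y).measurable x

theorem IsInput.ae_pos (h : IsInput α γ σ T P) : ∀ᵐ g ∂(P.map γ), ∀ y z, 0 < g y z := by
  rw [ae_map_iff h.measurable_env.aemeasurable]
  · filter_upwards [h.env_ordered] with ω hω y z using (hω y).2 z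
  · simp only [Set.ofPred_forall]
    exact MeasurableSet.iInter fun y => MeasurableSet.iInter fun z =>
      measurableSet_lt measurable_const (by fun_prop)

variable [IsProbabilityMeasure P]

theorem measurable_resampleEnv (n : ℕ) :
    Measurable fun p : (List ℕ → ℕ → ℝ) × (List ℕ → ℕ → ℝ) => resampleEnv n p.1 p.2 := by
  refine measurable_pi_lambda _ fun y => ?_
  unfold resampleEnv
  split_ifs <;> fun_prop

theorem IsInput.map_resampleEnv (h : IsInput α γ σ T P) (n : ℕ) :
    ((P.map γ).prod (P.map γ)).map (fun p => resampleEnv n p.1 p.2) = P.map γ := by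
  have hγ := h.measurable_env
  have := Measure.isProbabilityMeasure_map (μ := P) hγ.aemeasurable
  rw [Measure.map_prod_map _ _ hγ hγ, Measure.map_map (measurable_resampleEnv n) (by fun_prop)]
  exact map_resample (ξ := fun y ω => γ ω y) (fun y => (measurable_pi_apply y).comp hγ)
    h.env_indep {y | y.length = n}

/-- At a single node, `lintegral_levelIntensity` with b = c^(α (n+1)) produces the exponent c^(α n).
Distinct nodes are independent, so the exponents add up. -/
theorem IsInput.lap_level (h : IsInput α γ σ T P) (hα : StrictMono α) (hα0 : 0 < α 0)
    (x : List ℕ) (n : ℕ) {c : {y : List ℕ // y.length = n ∧ x <+: y} → ℝ} (hc : ∀ y, 0 ≤ c y) :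
    ∫⁻ ω, lap (∑' y : {y : List ℕ // y.length = n ∧ x <+: y}, ∑' z : ℕ,
      ENNReal.ofReal ((c y * γ ω y z) ^ α (n + 1))) ∂P = lap (∑' y, ENNReal.ofReal (c y ^ α n)) := by
  have hγ := h.measurable_env
  have hG : ∀ y, Measurable fun v : ℕ → ℝ => ∑' z, ENNReal.ofReal ((c y * v z) ^ α (n + 1)) :=
    fun y => Measurable.tsum fun z => by fun_prop
  refine lap_tsum_of_iIndepFun (fun y => (hG y).comp ((measurable_pi_apply _).comp hγ))
    ((h.env_indep.precomp Subtype.val_injective).comp _ hG) fun y => ?_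
  have hp : 0 < α (n + 1) := hα0.trans_le (hα.monotone (Nat.zero_le _))
  have h1 : ∀ᵐ ω ∂P, lap (∑' z, ENNReal.ofReal ((c y * γ ω y z) ^ α (n + 1)))
      = lap (∑' z, ENNReal.ofReal (c y ^ α (n + 1) * γ ω y z ^ α (n + 1))) := by
    filter_upwards [h.env_ordered] with ω hω
    congr 1
    refine tsum_congr fun z => ?_
    rw [Real.mul_rpow (hc y) ((hω y).2 z).le]
  change ∫⁻ ω, lap (∑' z, ENNReal.ofReal ((c y * γ ω y z) ^ α (n + 1))) ∂P = _
  rw [lintegral_congr_ae h1,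
    (h.env_poisson y).laplace (f := fun t => ENNReal.ofReal (c y ^ α (n + 1) * t ^ α (n + 1)))
      (by fun_prop), y.2.1, lintegral_levelIntensity hα hα0 n (Real.rpow_nonneg (hc y) _),
    ← Real.rpow_mul (hc y), mul_div_cancel₀ _ hp.ne']

/-- The martingale identity: the integral over `g'` is the conditional expectation given the
variables at nodes of depth below `n`. The scale `r` enters every coefficient, so its exponent
changes with the level too. -/
theorem IsInput.lap_resampleEnv (h : IsInput α γ σ T P) (hα : StrictMono α) (hα0 : 0 < α 0)
    {x : List ℕ} {n : ℕ} (hn : x.length ≤ n) {r : ℝ} (hr : 0 ≤ r) {g : List ℕ → ℕ → ℝ}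
    (hg : ∀ y z, 0 < g y z) :
    ∫⁻ g', lap (ENNReal.ofReal (r ^ α (n + 1)) * WApprox α (resampleEnv n g g') x (n + 1)) ∂(P.map γ)
      = lap (ENNReal.ofReal (r ^ α n) * WApprox α g x n) := by
  have hγ := h.measurable_env
  have hm := measurable_resampleEnv n
  have hm' : Measurable fun g' => resampleEnv n g g' := hm.comp measurable_prodMk_left
  have hF : Measurable fun g' => lap (ENNReal.ofReal (r ^ α (n + 1)) *
      WApprox α (resampleEnv n g g') x (n + 1)) :=
    measurable_lap.comp (((measurable_WApprox α x (n + 1)).comp hm').const_mul _)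
  have hpos : ∀ y, 0 < envProd g y := envProd_pos hg
  rw [lintegral_map hF hγ]
  have h1 : ∀ᵐ ω ∂P, lap (ENNReal.ofReal (r ^ α (n + 1)) *
      WApprox α (resampleEnv n g (γ ω)) x (n + 1)) =
        lap (∑' y : {y : List ℕ // y.length = n ∧ x <+: y}, ∑' z : ℕ,
          ENNReal.ofReal ((r * (envProd g y / envProd g x) * γ ω y z) ^ α (n + 1))) := by
    filter_upwards [h.env_ordered] with ω hω
    rw [WApprox_eq_descSum, descSum_succ _ _ hn, ← ENNReal.tsum_mul_left]
    congr 1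
    refine tsum_congr fun y => ?_
    rw [← ENNReal.tsum_mul_left]
    refine tsum_congr fun z => ?_
    have hloc : ∀ v : List ℕ, v.length ≤ n → envProd (resampleEnv n g (γ ω)) v = envProd g v :=
      fun v hv => envProd_congr fun u hu => if_neg (by omega)
    have h2 : resampleEnv n g (γ ω) y = γ ω y := if_pos y.2.1
    rw [hloc _ y.2.1.le, hloc _ hn, h2, ← ENNReal.ofReal_mul (Real.rpow_nonneg hr _),
      ← Real.mul_rpow hr (mul_nonneg (div_nonneg (hpos _).le (hpos _).le) ((hω _).2 z).le), mul_assoc]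
  rw [lintegral_congr_ae h1, h.lap_level hα hα0 x n
    (fun y => mul_nonneg hr (div_nonneg (hpos _).le (hpos _).le)),
    WApprox_eq_descSum, descSum, ← ENNReal.tsum_mul_left]
  congr 1
  refine tsum_congr fun y => ?_
  rw [← ENNReal.ofReal_mul (Real.rpow_nonneg hr _),
    ← Real.mul_rpow hr (div_nonneg (hpos _).le (hpos _).le)]

/-- Iterating the martingale identity leads back to the depth of `x`, where the sum is 1. -/
theorem IsInput.lap_WApprox (h : IsInput α γ σ T P) (hα : StrictMono α) (hα0 : 0 < α 0)
    (x : List ℕ) {r : ℝ} (hr : 0 ≤ r) (m : ℕ) :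
    ∫⁻ g, lap (ENNReal.ofReal (r ^ α (x.length + m)) * WApprox α g x (x.length + m)) ∂(P.map γ)
      = lap (ENNReal.ofReal (r ^ α x.length)) := by
  have := Measure.isProbabilityMeasure_map (μ := P) h.measurable_env.aemeasurable
  induction m with
  | zero =>
    rw [add_zero]
    have : ∀ᵐ g ∂(P.map γ), lap (ENNReal.ofReal (r ^ α x.length) * WApprox α g x x.length)
        = lap (ENNReal.ofReal (r ^ α x.length)) := by
      filter_upwards [h.ae_pos] with g hg
      rw [WApprox_eq_descSum, descSum_self _ hg, mul_one]
    rw [lintegral_congr_ae this]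
    simp
  | succ m ih =>
    have hF : Measurable fun g : List ℕ → ℕ → ℝ =>
        lap (ENNReal.ofReal (r ^ α (x.length + m + 1)) * WApprox α g x (x.length + m + 1)) :=
      measurable_lap.comp ((measurable_WApprox α x _).const_mul _)
    rw [← ih, ← add_assoc]
    conv_lhs => rw [← h.map_resampleEnv (x.length + m)]
    have hm := measurable_resampleEnv (x.length + m)
    have hF' : Measurable fun p : (List ℕ → ℕ → ℝ) × (List ℕ → ℕ → ℝ) =>
        lap (ENNReal.ofReal (r ^ α (x.length + m + 1)) *
          WApprox α (resampleEnv (x.length + m) p.1 p.2) x (x.length + m + 1)) := hF.comp hm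
    rw [lintegral_map hF hm, lintegral_prod _ hF'.aemeasurable]
    refine lintegral_congr_ae ?_
    filter_upwards [h.ae_pos] with g hg
    exact h.lap_resampleEnv hα hα0 (Nat.le_add_right _ _) hr hg

theorem tendsto_ofReal_inv_rpow {a : ℝ} (ha : 0 < a) :
    Tendsto (fun j : ℕ => ENNReal.ofReal ((1 / ((j : ℝ) + 1)) ^ a)) atTop (𝓝 0) := by
  have h1 : Tendsto (fun j : ℕ => (1 / ((j : ℝ) + 1)) ^ a) atTop (𝓝 (0 ^ a)) :=
    tendsto_one_div_add_atTop_nhds_zero_nat.rpow_const (Or.inr ha.le)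
  rw [Real.zero_rpow ha.ne'] at h1
  simpa using ENNReal.tendsto_ofReal h1

theorem ofReal_inv_rpow_ne_zero (j : ℕ) (p : ℝ) :
    ENNReal.ofReal ((1 / ((j : ℝ) + 1)) ^ p) ≠ 0 := by
  have h1 : (0 : ℝ) < 1 / ((j : ℝ) + 1) := Nat.one_div_pos_of_nat
  simpa only [ne_eq, ENNReal.ofReal_eq_zero, not_le] using Real.rpow_pos_of_pos h1 p

theorem IsInput.ae_WApprox_ne_top (h : IsInput α γ σ T P) (hα : StrictMono α) (hα0 : 0 < α 0)
    (x : List ℕ) (m : ℕ) : ∀ᵐ g ∂(P.map γ), WApprox α g x (x.length + m) ≠ ∞ := by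
  have := Measure.isProbabilityMeasure_map (μ := P) h.measurable_env.aemeasurable
  exact ae_ne_top_of_lap (measurable_WApprox α x _) _ _ (fun j => ofReal_inv_rpow_ne_zero j _)
    (tendsto_ofReal_inv_rpow (hα0.trans_le (hα.monotone (Nat.zero_le _))))
    fun j => (h.lap_WApprox hα hα0 x (Nat.one_div_pos_of_nat).le m).ge

theorem WApprox_resampleEnv {x : List ℕ} {n m : ℕ} (hx : x.length ≤ n) (hm : m ≤ n)
    (g g' : List ℕ → ℕ → ℝ) : WApprox α (resampleEnv n g g') x m = WApprox α g x m := by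
  have hloc : ∀ v : List ℕ, v.length ≤ n → envProd (resampleEnv n g g') v = envProd g v :=
    fun v hv => envProd_congr fun u hu => if_neg (by omega)
  refine tsum_congr fun y => ?_
  rw [hloc y (by rw [y.2.1]; exact hm), hloc x hx]

theorem IsInput.ae_tendsto_WApprox (h : IsInput α γ σ T P) (hα : StrictMono α) (hα0 : 0 < α 0)
    (x : List ℕ) : ∀ᵐ g ∂(P.map γ), Tendsto (WApprox α g x) atTop (𝓝 (W α g x)) := by
  have := Measure.isProbabilityMeasure_map (μ := P) h.measurable_env.aemeasurable
  have := ae_exists_tendsto_of_resample (ν := P.map γ) (M := fun n => resampleEnv (x.length + n))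
    (Y := fun n g => WApprox α g x (x.length + n)) (fun n => measurable_resampleEnv _)
    (fun n => h.map_resampleEnv _) (fun n => measurable_WApprox α x _)
    (fun n m hmn g g' => WApprox_resampleEnv (by omega) (by omega) g g') ?_
  · filter_upwards [this] with g hg
    obtain ⟨c, hc⟩ := hg
    have h2 : Tendsto (WApprox α g x) atTop (𝓝 c) := by
      rw [← tendsto_add_atTop_iff_nat x.length]
      simpa only [add_comm] using hc
    rw [W, h2.limsup_eq]
    exact h2
  · intro n
    filter_upwards [h.ae_pos] with g hg
    -- The scale r = 1 makes the prefactors disappear.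
    have h3 := h.lap_resampleEnv hα hα0 (x := x) (n := x.length + n) (by omega) zero_le_one hg
    simp only [Real.one_rpow, ENNReal.ofReal_one, one_mul] at h3
    exact h3.ge

/-- Letting the depth tend to infinity in `lap_WApprox` gives E exp(-r W) = exp(-r^(α |x|)); the
scales r = 1/(j+1) tend to 0. -/
theorem IsInput.ae_W_ne_top (h : IsInput α γ σ T P) (hα : StrictMono α) (hα0 : 0 < α 0)
    (hα_lim : Tendsto α atTop (𝓝 1)) (x : List ℕ) : ∀ᵐ g ∂(P.map γ), W α g x ≠ ∞ := by
  have := Measure.isProbabilityMeasure_map (μ := P) h.measurable_env.aemeasurable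
  refine ae_ne_top_of_lap (measurable_W α x) _ _ (fun j => ofReal_inv_rpow_ne_zero j 1)
    (tendsto_ofReal_inv_rpow (hα0.trans_le (hα.monotone (Nat.zero_le x.length)))) fun j => ?_
  have hr : (0 : ℝ) < 1 / ((j : ℝ) + 1) := Nat.one_div_pos_of_nat
  have h1 : Tendsto (fun m => ∫⁻ g, lap (ENNReal.ofReal ((1 / ((j : ℝ) + 1)) ^ α (x.length + m)) *
      WApprox α g x (x.length + m)) ∂(P.map γ)) atTop
      (𝓝 (∫⁻ g, lap (ENNReal.ofReal ((1 / ((j : ℝ) + 1)) ^ (1 : ℝ)) * W α g x) ∂(P.map γ))) := by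
    refine tendsto_lintegral_of_dominated_convergence (fun _ => 1) (fun m => ?_)
      (fun m => ae_of_all _ fun g => lap_le_one _) (by simp) ?_
    · exact measurable_lap.comp ((measurable_WApprox α x _).const_mul _)
    · filter_upwards [h.ae_tendsto_WApprox hα hα0 x] with g hg
      refine (continuous_lap.tendsto _).comp ?_
      have hadd : Tendsto (fun m => x.length + m) atTop atTop := by
        simpa only [add_comm] using tendsto_add_atTop_nat x.length
      refine ENNReal.Tendsto.mul ?_ (Or.inl (ofReal_inv_rpow_ne_zero j 1)) (hg.comp hadd)
        (Or.inr ENNReal.ofReal_ne_top)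
      exact ENNReal.tendsto_ofReal
        (tendsto_const_nhds.rpow (hα_lim.comp hadd) (Or.inl hr.ne'))
  rw [funext fun m => h.lap_WApprox hα hα0 x hr.le m] at h1
  exact (tendsto_nhds_unique tendsto_const_nhds h1).le

theorem IsInput.ae_goodEnv (h : IsInput α γ σ T P) (hα : StrictMono α) (hα0 : 0 < α 0)
    (hα_lim : Tendsto α atTop (𝓝 1)) : ∀ᵐ g ∂(P.map γ), GoodEnv α g := by
  have hαlt : ∀ n, α n < 1 := fun n =>
    (hα (Nat.lt_succ_self n)).trans_le (hα.monotone.ge_of_tendsto hα_lim _)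
  filter_upwards [h.ae_pos, ae_all_iff.2 fun m => h.ae_WApprox_ne_top hα hα0 [] m,
    ae_all_iff.2 fun x => h.ae_tendsto_WApprox hα hα0 x,
    ae_all_iff.2 fun x => h.ae_W_ne_top hα hα0 hα_lim x] with g hg h1 h2 h3
  -- Finiteness with exponent 1, needed for the unadjusted clocks, follows from that with exponent α
  -- n < 1.
  refine ⟨hg, h3, h2, childSum_W_le hα_lim hg h3 h2, fun n => ?_⟩
  refine descSum_one_ne_top (hα0.trans_le (hα.monotone (Nat.zero_le n))) (hαlt n) hg ?_
  have := h1 n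
  rwa [List.length_nil, zero_add] at this

end Environment

/-! ### The law of the dynamics -/

/-- The inputs of the dynamics: the holding variables and the marks. -/
abbrev Dyn : Type := (ℕ → ℕ → ℕ → ℝ) × (ℕ → ℕ → ℕ → ℝ)

open scoped Classical in
/-- Replacement of the levels in `S`. -/
def mixLevels {E : Type*} (S : Set ℕ) (a b : ℕ → E) : ℕ → E := fun k => if k ∈ S then b k else a k

/-- Replacement of the levels in `S`. -/
def resampleDyn (S : Set ℕ) (d d' : Dyn) : Dyn := (mixLevels S d.1 d'.1, mixLevels S d.2 d'.2)

theorem measurable_mixLevels {E : Type*} [MeasurableSpace E] (S : Set ℕ) :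
    Measurable fun p : (ℕ → E) × (ℕ → E) => mixLevels S p.1 p.2 := by
  refine measurable_pi_lambda _ fun k => ?_
  unfold mixLevels
  split_ifs <;> fun_prop

theorem measurable_resampleDyn (S : Set ℕ) :
    Measurable fun p : Dyn × Dyn => resampleDyn S p.1 p.2 := by
  refine Measurable.prodMk ?_ ?_
  · exact (measurable_mixLevels S).comp
      (measurable_fst.fst.prodMk measurable_snd.fst : Measurable fun p : Dyn × Dyn => (p.1.1, p.2.1))
  · exact (measurable_mixLevels S).comp
      (measurable_fst.snd.prodMk measurable_snd.snd : Measurable fun p : Dyn × Dyn => (p.1.2, p.2.2))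

theorem resampleDyn_of_mem {S : Set ℕ} {k : ℕ} (hk : k ∈ S) (d d' : Dyn) :
    (resampleDyn S d d').1 k = d'.1 k ∧ (resampleDyn S d d').2 k = d'.2 k :=
  ⟨if_pos hk, if_pos hk⟩

theorem resampleDyn_of_notMem {S : Set ℕ} {k : ℕ} (hk : k ∉ S) (d d' : Dyn) :
    (resampleDyn S d d').1 k = d.1 k ∧ (resampleDyn S d d').2 k = d.2 k :=
  ⟨if_neg hk, if_neg hk⟩

theorem map_prod_prod {X Y : Type*} [MeasurableSpace X] [MeasurableSpace Y] {μ : Measure X}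
    {ρ : Measure Y} [IsProbabilityMeasure μ] [IsProbabilityMeasure ρ] {A : X → X → X}
    {B : Y → Y → Y} (hA : Measurable fun p : X × X => A p.1 p.2)
    (hB : Measurable fun p : Y × Y => B p.1 p.2)
    (hAμ : (μ.prod μ).map (fun p => A p.1 p.2) = μ) (hBρ : (ρ.prod ρ).map (fun p => B p.1 p.2) = ρ) :
    ((μ.prod ρ).prod (μ.prod ρ)).map (fun p => (A p.1.1 p.2.1, B p.1.2 p.2.2)) = μ.prod ρ := by
  have hAB : Measurable fun p : (X × Y) × (X × Y) => (A p.1.1 p.2.1, B p.1.2 p.2.2) :=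
    (hA.comp (measurable_fst.fst.prodMk measurable_snd.fst :
      Measurable fun p : (X × Y) × (X × Y) => (p.1.1, p.2.1))).prodMk
    (hB.comp (measurable_fst.snd.prodMk measurable_snd.snd :
      Measurable fun p : (X × Y) × (X × Y) => (p.1.2, p.2.2)))
  symm
  refine Measure.prod_eq fun s t hs ht => ?_
  rw [Measure.map_apply hAB (hs.prod ht), Measure.prod_apply (hAB (hs.prod ht))]
  have h1 : ∀ q : X × Y, (μ.prod ρ) (Prod.mk q ⁻¹'
      ((fun p : (X × Y) × (X × Y) => (A p.1.1 p.2.1, B p.1.2 p.2.2)) ⁻¹' s ×ˢ t))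
      = μ (Prod.mk q.1 ⁻¹' ((fun p : X × X => A p.1 p.2) ⁻¹' s)) *
        ρ (Prod.mk q.2 ⁻¹' ((fun p : Y × Y => B p.1 p.2) ⁻¹' t)) := by
    intro q
    rw [← Measure.prod_prod]
    rfl
  simp_rw [h1]
  rw [lintegral_prod_mul (measurable_measure_prodMk_left (hA hs)).aemeasurable
    (measurable_measure_prodMk_left (hB ht)).aemeasurable, ← Measure.prod_apply (hA hs),
    ← Measure.prod_apply (hB ht), ← Measure.map_apply hA hs, ← Measure.map_apply hB ht, hAμ, hBρ]

theorem lintegral_expMeasure : ∫⁻ t, ENNReal.ofReal t ∂(expMeasure 1) = 1 := by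
  have hm : Measurable (gammaPDF 1 1) := (measurable_gammaPDFReal 1 1).ennreal_ofReal
  rw [expMeasure, gammaMeasure, lintegral_withDensity_eq_lintegral_mul _ hm (by fun_prop)]
  have h1 : ∀ t : ℝ, (gammaPDF 1 1 * fun t => ENNReal.ofReal t) t
      = (Set.Ioi (0 : ℝ)).indicator
        (fun t => ENNReal.ofReal (Real.exp (-t) * t ^ ((2 : ℝ) - 1))) t := by
    intro t
    rw [Pi.mul_apply]
    by_cases ht : 0 < t
    · rw [gammaPDF_of_nonneg ht.le, Set.indicator_of_mem (Set.mem_Ioi.2 ht),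
        ← ENNReal.ofReal_mul (by positivity)]
      congr 1
      norm_num
    · rw [Set.indicator_of_notMem (by simpa using ht), ENNReal.ofReal_of_nonpos (not_lt.1 ht),
        mul_zero]
  simp_rw [h1]
  rw [lintegral_indicator measurableSet_Ioi, ← ofReal_integral_eq_lintegral_ofReal]
  · rw [← Real.Gamma_eq_integral (by norm_num), Real.Gamma_two, ENNReal.ofReal_one]
  · exact Real.GammaIntegral_convergent (by norm_num)
  · filter_upwards [ae_restrict_mem measurableSet_Ioi] with t ht
    have : (0 : ℝ) < t := ht
    positivity

/-- A fixed positive chance for a holding variable to exceed 1 feeds the second Borel–Cantelli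
lemma. -/
theorem expMeasure_Ioi_ne_zero : expMeasure 1 (Set.Ioi 1) ≠ 0 := by
  intro h
  have := isProbabilityMeasure_expMeasure (r := 1) one_pos
  have h1 : expMeasure 1 (Set.Iic 1) = 1 := by
    rw [← Set.compl_Ioi]
    exact (prob_compl_eq_one_iff measurableSet_Ioi).2 h
  have h2 := cdf_expMeasure_eq (r := 1) one_pos 1
  rw [cdf_eq_real, measureReal_def, h1, if_pos zero_le_one] at h2
  have := Real.exp_pos (-(1 * 1))
  rw [ENNReal.toReal_one] at h2
  linarith

/-- The properties of the law of the inputs of the dynamics that are used below. -/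
structure DynLaw (ν : Measure Dyn) : Prop where
  isProb : IsProbabilityMeasure ν
  map_resample : ∀ S, (ν.prod ν).map (fun p => resampleDyn S p.1 p.2) = ν
  campbell : ∀ n x (f : ℝ → ℝ≥0∞), Measurable f →
    ∫⁻ d : Dyn, ∑' i, f (d.2 n x i) * ENNReal.ofReal (d.1 n x i) ∂ν = ∫⁻ s in Set.Ioi 0, f s
  ae_pos : ∀ᵐ d : Dyn ∂ν, ∀ n x i, 0 < d.2 n x i
  ae_inj : ∀ᵐ d : Dyn ∂ν, ∀ n x i x' i', d.2 n x i = d.2 n x' i' → x = x' ∧ i = i'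
  ae_infinite : ∀ n x (B : Set ℝ), MeasurableSet B → volume (B ∩ Set.Ioi 0) = ∞ →
    ∀ᵐ d : Dyn ∂ν, ∑' i, B.indicator 1 (d.2 n x i) * ENNReal.ofReal (d.1 n x i) = ∞

section DynLaw

variable {Ω : Type*} [MeasurableSpace Ω] {P : Measure Ω}
  {α : ℕ → ℝ} {γ : Ω → List ℕ → ℕ → ℝ} {σ T : Ω → ℕ → ℕ → ℕ → ℝ}

theorem IsInput.measurable_T (h : IsInput α γ σ T P) : Measurable T :=
  measurable_pi_lambda _ fun k => measurable_pi_lambda _ fun x => measurable_pi_lambda _ fun i =>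
    h.exp_measurable k x i

theorem IsInput.measurable_σ (h : IsInput α γ σ T P) : Measurable σ :=
  measurable_pi_lambda _ fun k => measurable_pi_lambda _ fun x => measurable_pi_lambda _ fun i =>
    (h.mark_poisson k x).measurable i

theorem IsInput.measurable_dyn (h : IsInput α γ σ T P) : Measurable fun ω => (T ω, σ ω) :=
  h.measurable_T.prodMk h.measurable_σ

/-- The holding variables are independent of the marks and have mean one, so they drop out of
Campbell's formula. -/
theorem IsInput.campbell_dyn (h : IsInput α γ σ T P) (n x : ℕ) {f : ℝ → ℝ≥0∞} (hf : Measurable f) :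
    ∫⁻ ω, ∑' i, f (σ ω n x i) * ENNReal.ofReal (T ω n x i) ∂P = ∫⁻ s in Set.Ioi 0, f s := by
  have hT := h.measurable_T
  have hσ := h.measurable_σ
  rw [lintegral_tsum fun i => by fun_prop, ← (h.mark_poisson n x).campbell hf]
  refine tsum_congr fun i => ?_
  have hind : IndepFun (fun ω => f (σ ω n x i)) (fun ω => ENNReal.ofReal (T ω n x i)) P :=
    h.exp_indep_mark.symm.comp (φ := fun s : ℕ → ℕ → ℕ → ℝ => f (s n x i))
      (ψ := fun t : ℕ → ℕ → ℕ → ℝ => ENNReal.ofReal (t n x i)) (by fun_prop) (by fun_prop)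
  rw [lintegral_mul_eq_lintegral_mul_lintegral_of_indepFun'' (by fun_prop) (by fun_prop) hind,
    (h.exp_law n x i).lintegral_comp (f := fun t => ENNReal.ofReal t) (by fun_prop),
    lintegral_expMeasure, mul_one]

variable [IsProbabilityMeasure P]

theorem IsInput.map_mix_T (h : IsInput α γ σ T P) (S : Set ℕ) :
    ((P.map T).prod (P.map T)).map (fun p => mixLevels S p.1 p.2) = P.map T := by
  classical
  have hT := h.measurable_T
  have := Measure.isProbabilityMeasure_map (μ := P) hT.aemeasurable
  rw [Measure.map_prod_map _ _ hT hT, Measure.map_map (measurable_mixLevels S) (by fun_prop)]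
  -- The independent family is indexed by triples; resampling those with first index in `S` and
  -- currying gives `mixLevels`.
  have h1 := map_resample (ξ := fun (p : ℕ × ℕ × ℕ) ω => T ω p.1 p.2.1 p.2.2)
    (fun p => h.exp_measurable _ _ _) h.exp_indep {p | p.1 ∈ S}
  let c : (ℕ × ℕ × ℕ → ℝ) → ℕ → ℕ → ℕ → ℝ := fun u k x i => u (k, x, i)
  have hc : Measurable c := by fun_prop
  have h2 := congrArg (Measure.map c) h1
  rw [Measure.map_map hc, Measure.map_map hc] at h2
  · convert h2 using 2
    funext p
    funext k x i
    simp only [Function.comp, mixLevels, Prod.map, c, Set.mem_ofPred_eq]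
    split_ifs <;> rfl
    rfl
  · exact measurable_pi_lambda _ fun p => h.exp_measurable _ _ _
  · refine measurable_pi_lambda _ fun p => ?_
    split_ifs
    · exact (h.exp_measurable _ _ _).comp measurable_snd
    · exact (h.exp_measurable _ _ _).comp measurable_fst

theorem IsInput.map_mix_σ (h : IsInput α γ σ T P) (S : Set ℕ) :
    ((P.map σ).prod (P.map σ)).map (fun p => mixLevels S p.1 p.2) = P.map σ := by
  classical
  have hσ := h.measurable_σ
  have := Measure.isProbabilityMeasure_map (μ := P) hσ.aemeasurable
  have hσ' : ∀ k x, Measurable fun ω => σ ω k x := fun k x => by fun_prop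
  rw [Measure.map_prod_map _ _ hσ hσ, Measure.map_map (measurable_mixLevels S) (by fun_prop)]
  have h1 := map_resample (ξ := fun (p : ℕ × ℕ) ω => σ ω p.1 p.2)
    (fun p => hσ' _ _) h.mark_indep {p | p.1 ∈ S}
  let c : (ℕ × ℕ → ℕ → ℝ) → ℕ → ℕ → ℕ → ℝ := fun u k x => u (k, x)
  have hc : Measurable c := by fun_prop
  have h2 := congrArg (Measure.map c) h1
  rw [Measure.map_map hc, Measure.map_map hc] at h2
  · convert h2 using 2
    funext p
    funext k x
    simp only [Function.comp, mixLevels, Prod.map, c, Set.mem_ofPred_eq]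
    split_ifs <;> rfl
    rfl
  · exact measurable_pi_lambda _ fun p => hσ' _ _
  · refine measurable_pi_lambda _ fun p => ?_
    split_ifs
    · exact (hσ' _ _).comp measurable_snd
    · exact (hσ' _ _).comp measurable_fst

theorem IsInput.map_dyn (h : IsInput α γ σ T P) :
    P.map (fun ω => (T ω, σ ω)) = (P.map T).prod (P.map σ) :=
  (indepFun_iff_map_prod_eq_prod_map_map h.measurable_T.aemeasurable
    h.measurable_σ.aemeasurable).1 h.exp_indep_mark

/-- Marks of one label are strictly ordered. Those of two labels are independent with atomless laws,
so they coincide with probability zero. -/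
theorem IsInput.ae_mark_inj (h : IsInput α γ σ T P) :
    ∀ᵐ ω ∂P, ∀ n x i x' i', σ ω n x i = σ ω n x' i' → x = x' ∧ i = i' := by
  have hσ := h.measurable_σ
  have hne : ∀ n x i x' i', x ≠ x' → ∀ᵐ ω ∂P, σ ω n x i ≠ σ ω n x' i' := by
    intro n x i x' i' hx
    have hX : Measurable fun ω => σ ω n x i := (h.mark_poisson n x).measurable i
    have hY : Measurable fun ω => σ ω n x' i' := (h.mark_poisson n x').measurable i'
    have h0 : IndepFun (fun ω => σ ω n x) (fun ω => σ ω n x') P :=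
      h.mark_indep.indepFun (i := (n, x)) (j := (n, x')) fun e => hx (congrArg Prod.snd e)
    have hind : IndepFun (fun ω => σ ω n x i) (fun ω => σ ω n x' i') P :=
      h0.comp (φ := fun v : ℕ → ℝ => v i) (ψ := fun v : ℕ → ℝ => v i') (by fun_prop) (by fun_prop)
    have hd : MeasurableSet {q : ℝ × ℝ | q.1 = q.2} := measurableSet_eq_fun (by fun_prop) (by fun_prop)
    have h0 : (P.map fun ω => (σ ω n x i, σ ω n x' i')) {q : ℝ × ℝ | q.1 = q.2} = 0 := by
      rw [(indepFun_iff_map_prod_eq_prod_map_map hX.aemeasurable hY.aemeasurable).1 hind,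
        Measure.measure_prod_null hd]
      refine ae_of_all _ fun a => ?_
      refine (h.mark_poisson n x').map_apply_eq_zero i' ?_
      have hsub : Prod.mk a ⁻¹' {q : ℝ × ℝ | q.1 = q.2} ⊆ {a} := fun b hb => Eq.symm hb
      exact measure_mono_null hsub (by simp)
    rw [Measure.map_apply (hX.prodMk hY) hd] at h0
    exact measure_eq_zero_iff_ae_notMem.1 h0
  have hall := ae_all_iff.2 fun n => ae_all_iff.2 fun x => ae_all_iff.2 fun i =>
    ae_all_iff.2 fun x' => ae_all_iff.2 fun i' => eventually_imp_distrib_left.2 (hne n x i x' i')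
  filter_upwards [hall, h.mark_ordered] with ω h1 h2 n x i x' i' he
  by_cases hx : x = x'
  · subst hx
    exact ⟨rfl, (h2 n x).1.injective he⟩
  · exact absurd he (h1 n x i x' i' hx)

/-- By Borel–Cantelli, infinitely many of the selected holding variables exceed 1. -/
theorem IsInput.ae_tsum_exp (h : IsInput α γ σ T P) (n x : ℕ) {I : Set ℕ} (hI : I.Infinite) :
    ∀ᵐ ω ∂P, ∑' i, I.indicator 1 i * ENNReal.ofReal (T ω n x i) = ∞ := by
  classical
  have hT := h.measurable_T
  -- Empty sets off `I` keep all of ℕ as index set without adding events.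
  let B : ℕ → Set ℝ := fun i => if i ∈ I then Set.Ioi 1 else ∅
  have hB : ∀ i, MeasurableSet (B i) := fun i => by
    simp only [B]; split_ifs <;> simp
  have hTm : ∀ i, Measurable fun ω => T ω n x i := fun i => h.exp_measurable n x i
  have hind : iIndepFun (fun i ω => T ω n x i) P :=
    h.exp_indep.precomp (g := fun i : ℕ => (n, x, i)) fun i j hij => by simpa using hij
  let s : ℕ → Set Ω := fun i => (fun ω => T ω n x i) ⁻¹' B i
  have hs : ∀ i, MeasurableSet (s i) := fun i => hTm i (hB i)
  have hsi : iIndepSet s P := (iIndepSet_iff_meas_biInter hs).2 fun t =>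
    hind.measure_inter_preimage_eq_mul _ fun i _ => hB i
  have hsum : ∑' i, P (s i) = ∞ := by
    have : ∀ i, P (s i) = I.indicator (fun _ => expMeasure 1 (Set.Ioi 1)) i := by
      intro i
      simp only [s]
      rw [← Measure.map_apply (hTm i) (hB i), (h.exp_law n x i).map_eq]
      by_cases hi : i ∈ I <;> simp [B, hi]
    simp_rw [this]
    rw [← tsum_subtype I fun _ => expMeasure 1 (Set.Ioi 1)]
    have := hI.to_subtype
    exact ENNReal.tsum_const_eq_top_of_ne_zero expMeasure_Ioi_ne_zero
  have hlim := measure_limsup_eq_one hs hsi hsum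
  have hms : MeasurableSet (limsup s atTop) := MeasurableSet.measurableSet_limsup hs
  have hae : ∀ᵐ ω ∂P, ω ∈ limsup s atTop := by
    rw [ae_iff]
    exact (prob_compl_eq_zero_iff hms).2 hlim
  filter_upwards [hae] with ω hω
  rw [mem_limsup_iff_frequently_mem] at hω
  have hinf := Nat.frequently_atTop_iff_infinite.1 hω
  by_contra hne
  have hsub : {i | ω ∈ s i} ⊆ {i | 1 ≤ I.indicator 1 i * ENNReal.ofReal (T ω n x i)} := by
    intro i hi
    have hi' : T ω n x i ∈ B i := hi
    by_cases hiI : i ∈ I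
    · simp only [B, if_pos hiI] at hi'
      simp only [Set.mem_ofPred_eq, Set.indicator_of_mem hiI, Pi.one_apply, one_mul]
      rw [ENNReal.one_le_ofReal]
      exact le_of_lt hi'
    · simp [B, hiI] at hi'
  exact (hinf.mono hsub) (ENNReal.finite_const_le_of_tsum_ne_top hne one_ne_zero)

/-- The Laplace exponent of the count in `B` is infinite, so the mean of `lap` of the count is zero
and the count is infinite. -/
theorem IsInput.ae_infinite_marks (h : IsInput α γ σ T P) (n x : ℕ) {B : Set ℝ}
    (hB : MeasurableSet B) (hvol : volume (B ∩ Set.Ioi 0) = ∞) :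
    ∀ᵐ ω ∂P, {i | σ ω n x i ∈ B}.Infinite := by
  have hσ := h.measurable_σ
  have hBm : Measurable (B.indicator (1 : ℝ → ℝ≥0∞)) := measurable_one.indicator hB
  have h1 := (h.mark_poisson n x).laplace hBm
  have h2 : ∫⁻ t in Set.Ioi (0 : ℝ), (1 - lap (B.indicator 1 t)) = ∞ := by
    have : ∀ t, 1 - lap (B.indicator 1 t) = B.indicator (fun _ => 1 - lap 1) t := by
      intro t
      by_cases ht : t ∈ B <;> simp [ht, lap_zero]
    simp_rw [this]
    rw [lintegral_indicator_const hB, Measure.restrict_apply hB, hvol]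
    refine ENNReal.mul_top ?_
    rw [Ne, tsub_eq_zero_iff_le, not_le]
    calc lap 1 < lap 0 := lap_strictAnti one_pos
      _ = 1 := lap_zero
  rw [h2, lap_top, lintegral_eq_zero_iff] at h1
  · filter_upwards [h1] with ω hω hfin
    rw [Pi.zero_apply, lap_eq_zero_iff] at hω
    refine absurd hω (ne_of_lt ?_)
    rw [tsum_eq_sum (s := hfin.toFinset) fun i hi => Set.indicator_of_notMem (by simpa using hi) _]
    refine ENNReal.sum_lt_top.2 fun i hi => ?_
    rw [Set.indicator_of_mem (by simpa using hi)]
    simp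
  · exact measurable_lap.comp (Measurable.tsum fun i => hBm.comp (by fun_prop))

theorem measurable_mark_sum (n x : ℕ) {B : Set ℝ} (hB : MeasurableSet B) :
    Measurable fun q : Dyn => ∑' i, B.indicator 1 (q.2 n x i) * ENNReal.ofReal (q.1 n x i) := by
  have hBm : Measurable (B.indicator (1 : ℝ → ℝ≥0∞)) := measurable_one.indicator hB
  refine Measurable.tsum fun i => ?_
  have h1 : Measurable fun q : Dyn => q.2 n x i := by fun_prop
  have h2 : Measurable fun q : Dyn => q.1 n x i := by fun_prop
  exact (hBm.comp h1).mul h2.ennreal_ofReal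

theorem IsInput.ae_infinite_marks_map (h : IsInput α γ σ T P) (n x : ℕ) {B : Set ℝ}
    (hB : MeasurableSet B) (hvol : volume (B ∩ Set.Ioi 0) = ∞) :
    ∀ᵐ s ∂(P.map σ), {i | s n x i ∈ B}.Infinite := by
  have hrw : ∀ s : ℕ → ℕ → ℕ → ℝ, {i | s n x i ∈ B}.Infinite ↔
      ∃ᶠ i in atTop, s n x i ∈ B := fun s => Nat.frequently_atTop_iff_infinite.symm
  rw [ae_map_iff h.measurable_σ.aemeasurable]
  · exact h.ae_infinite_marks n x hB hvol
  · simp_rw [hrw]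
    have : MeasurableSet (limsup (fun i => {s : ℕ → ℕ → ℕ → ℝ | s n x i ∈ B}) atTop) :=
      MeasurableSet.measurableSet_limsup fun i =>
        (show Measurable fun s : ℕ → ℕ → ℕ → ℝ => s n x i by fun_prop) hB
    convert this using 1
    ext s
    rw [mem_limsup_iff_frequently_mem]
    rfl

/-- With the marks frozen, those in `B` select an infinite index set for the holding variables. The
marks being the second factor, the iterated almost-everywhere statements have to be swapped. -/
theorem IsInput.ae_infinite_dyn (h : IsInput α γ σ T P) (n x : ℕ) {B : Set ℝ}
    (hB : MeasurableSet B) (hvol : volume (B ∩ Set.Ioi 0) = ∞) :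
    ∀ᵐ d : Dyn ∂((P.map T).prod (P.map σ)),
      ∑' i, B.indicator 1 (d.2 n x i) * ENNReal.ofReal (d.1 n x i) = ∞ := by
  have hT := h.measurable_T
  have hF := measurable_mark_sum n x hB
  have hae := h.ae_infinite_marks_map n x hB hvol
  have hexp : ∀ s : ℕ → ℕ → ℕ → ℝ, {i | s n x i ∈ B}.Infinite → ∀ᵐ ω ∂P,
      ∑' i, B.indicator 1 (s n x i) * ENNReal.ofReal (T ω n x i) = ∞ :=
    fun s hs => h.ae_tsum_exp n x hs
  have hpT := Measure.isProbabilityMeasure_map (μ := P) hT.aemeasurable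
  have hpσ := Measure.isProbabilityMeasure_map (μ := P) h.measurable_σ.aemeasurable
  set F : Dyn → ℝ≥0∞ :=
    fun q => ∑' i, B.indicator 1 (q.2 n x i) * ENNReal.ofReal (q.1 n x i)
  have hexp' : ∀ s : ℕ → ℕ → ℕ → ℝ, {i | s n x i ∈ B}.Infinite → ∀ᵐ ω ∂P, F (T ω, s) = ∞ := hexp
  change ∀ᵐ d : Dyn ∂((P.map T).prod (P.map σ)), F d = ∞
  clear_value F
  have hset : MeasurableSet {q : Dyn | F q = ∞} := hF (measurableSet_singleton ∞)
  have hswap : ∀ᵐ s ∂(P.map σ), ∀ᵐ t ∂(P.map T), F (t, s) = ∞ := by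
    filter_upwards [hae] with s hs
    refine (ae_map_iff hT.aemeasurable ?_).2 (hexp' s hs)
    exact (hF.comp measurable_prodMk_right) (measurableSet_singleton ∞)
  exact (Measure.ae_prod_iff_ae_ae hset).2
    ((Measure.ae_ae_comm (p := fun t s => F (t, s) = ∞) hset).2 hswap)

theorem IsInput.dynLaw (h : IsInput α γ σ T P) : DynLaw (P.map fun ω => (T ω, σ ω)) := by
  have hd := h.measurable_dyn
  have hT := h.measurable_T
  have hσ := h.measurable_σ
  have hpT := Measure.isProbabilityMeasure_map (μ := P) hT.aemeasurable
  have hpσ := Measure.isProbabilityMeasure_map (μ := P) hσ.aemeasurable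
  refine ⟨Measure.isProbabilityMeasure_map hd.aemeasurable, fun S => ?_, fun n x f hf => ?_,
    ?_, ?_, fun n x B hB hvol => ?_⟩
  · rw [h.map_dyn]
    exact map_prod_prod (measurable_mixLevels S) (measurable_mixLevels S) (h.map_mix_T S)
      (h.map_mix_σ S)
  · rw [lintegral_map (Measurable.tsum fun i => by fun_prop) hd]
    exact h.campbell_dyn n x hf
  · simp_rw [ae_all_iff]
    intro n x i
    refine (ae_map_iff hd.aemeasurable (measurableSet_lt (by fun_prop) (by fun_prop))).2 ?_
    filter_upwards [h.mark_ordered] with ω hω using (hω n x).2 i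
  · simp_rw [ae_all_iff]
    intro n x i x' i'
    by_cases hxi : x = x' ∧ i = i'
    · exact ae_of_all _ fun d _ => hxi
    · have h1 : ∀ᵐ d : Dyn ∂(P.map fun ω => (T ω, σ ω)), ¬ d.2 n x i = d.2 n x' i' := by
        refine (ae_map_iff hd.aemeasurable
          (measurableSet_eq_fun (by fun_prop) (by fun_prop)).compl).2 ?_
        filter_upwards [h.ae_mark_inj] with ω hω he using hxi (hω n x i x' i' he)
      filter_upwards [h1] with d hd he using absurd he hd
  · rw [h.map_dyn]
    exact h.ae_infinite_dyn n x hB hvol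

end DynLaw

/-! ### Functions on the nodes -/

theorem map_coe_injective : Function.Injective (List.map (fun n : ℕ => (n : ℕ∞))) :=
  List.map_injective_iff.2 Nat.cast_injective

theorem extendNode_map (w : List ℕ → ℝ≥0∞) (y : List ℕ) :
    extendNode w (y.map (fun n : ℕ => (n : ℕ∞))) = w y :=
  map_coe_injective.extend_apply _ _ _

theorem extendNode_of_notMem (w : List ℕ → ℝ≥0∞) {l : List ℕ∞}
    (hl : ¬ ∃ y : List ℕ, y.map (fun n : ℕ => (n : ℕ∞)) = l) : extendNode w l = 0 := by
  rw [extendNode, Function.extend_apply' _ _ _ hl]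
  rfl

theorem extendNode_mono {w v : List ℕ → ℝ≥0∞} (h : ∀ y, w y ≤ v y) (l : List ℕ∞) :
    extendNode w l ≤ extendNode v l := by
  by_cases hl : ∃ y : List ℕ, y.map (fun n : ℕ => (n : ℕ∞)) = l
  · obtain ⟨y, rfl⟩ := hl
    simpa only [extendNode_map] using h y
  · rw [extendNode_of_notMem _ hl]; exact zero_le

theorem extendNode_mul (w v : List ℕ → ℝ≥0∞) (l : List ℕ∞) :
    extendNode w l * extendNode v l = extendNode (fun y => w y * v y) l := by
  by_cases hl : ∃ y : List ℕ, y.map (fun n : ℕ => (n : ℕ∞)) = l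
  · obtain ⟨y, rfl⟩ := hl
    simp only [extendNode_map]
  · simp only [extendNode_of_notMem _ hl, zero_mul]

theorem tsum_extendNode {ι : Type*} (w : ι → List ℕ → ℝ≥0∞) (l : List ℕ∞) :
    ∑' i, extendNode (w i) l = extendNode (fun y => ∑' i, w i y) l := by
  by_cases hl : ∃ y : List ℕ, y.map (fun n : ℕ => (n : ℕ∞)) = l
  · obtain ⟨y, rfl⟩ := hl
    simp only [extendNode_map]
  · simp only [extendNode_of_notMem _ hl, tsum_zero]

theorem extendNode_concat_top (w : List ℕ → ℝ≥0∞) (l : List ℕ∞) : extendNode w (l ++ [⊤]) = 0 := by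
  refine extendNode_of_notMem _ ?_
  rintro ⟨y, hy⟩
  have : (⊤ : ℕ∞) ∈ y.map (fun n : ℕ => (n : ℕ∞)) := by rw [hy]; simp
  simp at this

theorem extendNode_concat_coe (w : List ℕ → ℝ≥0∞) (l : List ℕ∞) (x : ℕ) :
    extendNode w (l ++ [(x : ℕ∞)]) = extendNode (fun y => w (y ++ [x])) l := by
  by_cases hl : ∃ y : List ℕ, y.map (fun n : ℕ => (n : ℕ∞)) = l
  · obtain ⟨y, rfl⟩ := hl
    have := extendNode_map w (y ++ [x])
    rw [List.map_append] at this
    rw [extendNode_map, ← this]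
    rfl
  · rw [extendNode_of_notMem _ hl, extendNode_of_notMem]
    rintro ⟨y, hy⟩
    refine hl ⟨y.dropLast, ?_⟩
    rw [List.map_dropLast, hy, List.dropLast_concat]

/-! ### Clocks -/

/-- The increment over `(a, b]` of the clock `clockOf s τ w X`. -/
def clockInc (s τ : ℕ → ℕ → ℝ) (w : List ℕ → ℕ → ℝ≥0∞) (X : ℝ≥0∞ → List ℕ∞) (a b : ℝ≥0∞) : ℝ≥0∞ :=
  ∑' x : ℕ, ∑' i : ℕ,
    if a < ENNReal.ofReal (s x i) ∧ ENNReal.ofReal (s x i) ≤ b then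
      extendNode (fun y => w y x) (X (ENNReal.ofReal (s x i))) * ENNReal.ofReal (τ x i)
    else 0

/-- The jump of the clock `clockOf s τ w X` at the mark `s x i`. -/
def clockJump (s τ : ℕ → ℕ → ℝ) (w : List ℕ → ℕ → ℝ≥0∞) (X : ℝ≥0∞ → List ℕ∞) (x i : ℕ) : ℝ≥0∞ :=
  extendNode (fun y => w y x) (X (ENNReal.ofReal (s x i))) * ENNReal.ofReal (τ x i)

/-- The marks `s` are positive and distinct. -/
structure GoodMarks (s : ℕ → ℕ → ℝ) : Prop where
  pos : ∀ x i, 0 < s x i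
  inj : ∀ x i x' i', s x i = s x' i' → x = x' ∧ i = i'

section Clock

variable {s τ : ℕ → ℕ → ℝ} {w : List ℕ → ℕ → ℝ≥0∞} {X : ℝ≥0∞ → List ℕ∞}

theorem clockOf_mono (s τ : ℕ → ℕ → ℝ) (w : List ℕ → ℕ → ℝ≥0∞) (X : ℝ≥0∞ → List ℕ∞) :
    Monotone (clockOf s τ w X) := by
  intro a b hab
  refine ENNReal.tsum_le_tsum fun x => ENNReal.tsum_le_tsum fun i => ?_
  by_cases h : ENNReal.ofReal (s x i) ≤ a
  · rw [if_pos h, if_pos (h.trans hab)]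
  · rw [if_neg h]; exact zero_le

theorem clockOf_eq_add_clockInc {a b : ℝ≥0∞} (hab : a ≤ b) :
    clockOf s τ w X b = clockOf s τ w X a + clockInc s τ w X a b := by
  simp only [clockOf, clockInc]
  rw [← ENNReal.tsum_add]
  refine tsum_congr fun x => ?_
  rw [← ENNReal.tsum_add]
  refine tsum_congr fun i => ?_
  by_cases h : ENNReal.ofReal (s x i) ≤ a
  · rw [if_pos (h.trans hab), if_pos h, if_neg fun h' => absurd h'.1 (not_lt.2 h), add_zero]
  · simp [h, not_le.1 h]

theorem GoodMarks.ofReal_inj (hs : GoodMarks s) {x i x' i' : ℕ}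
    (h : ENNReal.ofReal (s x i) = ENNReal.ofReal (s x' i')) : x = x' ∧ i = i' :=
  hs.inj _ _ _ _ ((ENNReal.ofReal_eq_ofReal_iff (hs.pos _ _).le (hs.pos _ _).le).1 h)

theorem GoodMarks.ofReal_pos (hs : GoodMarks s) (x i : ℕ) : 0 < ENNReal.ofReal (s x i) :=
  ENNReal.ofReal_pos.2 (hs.pos x i)

theorem GoodMarks.clockOf_zero (hs : GoodMarks s) : clockOf s τ w X 0 = 0 := by
  simp only [clockOf]
  simp [hs.pos]

/-- For r < c one has Ξ(r) ≤ Ξ(c-) ≤ t, so nothing below `c` enters the infimum. -/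
theorem genInv_eq_of_mem {Ξ : ℝ≥0∞ → ℝ≥0∞} (hΞ : Monotone Ξ) {c t : ℝ≥0∞}
    (h1 : Function.leftLim Ξ c ≤ t) (h2 : t < Ξ c) : genInv Ξ t = c := by
  refine le_antisymm (sInf_le h2) (le_sInf fun r hr => ?_)
  by_contra hrc
  exact absurd (hr : t < Ξ r) (not_lt.2 ((hΞ.le_leftLim (not_le.1 hrc)).trans h1))

theorem leftLim_le_of_forall {Ξ : ℝ≥0∞ → ℝ≥0∞} (hΞ : Monotone Ξ) {c t : ℝ≥0∞} (hc : 0 < c)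
    (h : ∀ r < c, Ξ r ≤ t) : Function.leftLim Ξ c ≤ t := by
  have : (𝓝[<] c).NeBot := nhdsLT_neBot_of_exists_lt ⟨0, hc⟩
  rw [hΞ.leftLim_eq_sSup]
  exact sSup_le (by rintro _ ⟨r, hr, rfl⟩; exact h r hr)

theorem tsum_jump_lt_le_leftLim (c : ℝ≥0∞) :
    (∑' x, ∑' i, if ENNReal.ofReal (s x i) < c then clockJump s τ w X x i else 0)
      ≤ Function.leftLim (clockOf s τ w X) c := by
  rcases (zero_le (a := c)).eq_or_lt with rfl | hc
  · simp
  rw [← ENNReal.tsum_prod (f := fun x i => if ENNReal.ofReal (s x i) < c then clockJump s τ w X x i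
    else 0), ENNReal.tsum_eq_iSup_sum]
  refine iSup_le fun F => ?_
  -- A finite set of marks below `c` has a maximum below `c`, so its jumps are already counted at
  -- `r`. Local finiteness of the marks of all labels together is not needed.
  set r : ℝ≥0∞ := (F.filter fun p => ENNReal.ofReal (s p.1 p.2) < c).sup
    fun p => ENNReal.ofReal (s p.1 p.2) with hr
  have hrc : r < c := (Finset.sup_lt_iff hc).2 fun p hp => (Finset.mem_filter.1 hp).2
  refine le_trans ?_ ((clockOf_mono s τ w X).le_leftLim hrc)
  have h1 : clockOf s τ w X r = ∑' p : ℕ × ℕ,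
      if ENNReal.ofReal (s p.1 p.2) ≤ r then clockJump s τ w X p.1 p.2 else 0 :=
    (ENNReal.tsum_prod (f := fun x i => if ENNReal.ofReal (s x i) ≤ r then clockJump s τ w X x i
      else 0)).symm
  rw [h1]
  refine le_trans (Finset.sum_le_sum fun p hp => ?_) (ENNReal.sum_le_tsum F)
  by_cases h : ENNReal.ofReal (s p.1 p.2) < c
  · have hle : ENNReal.ofReal (s p.1 p.2) ≤ r :=
      Finset.le_sup (f := fun p : ℕ × ℕ => ENNReal.ofReal (s p.1 p.2)) (Finset.mem_filter.2 ⟨hp, h⟩)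
    rw [if_pos h, if_pos hle]
  · rw [if_neg h]; exact zero_le

/-- The clock jumps at the mark `s x i` by `clockJump s τ w X x i`. -/
theorem GoodMarks.clockOf_mark (hs : GoodMarks s) (x i : ℕ) :
    clockOf s τ w X (ENNReal.ofReal (s x i)) =
      Function.leftLim (clockOf s τ w X) (ENNReal.ofReal (s x i)) + clockJump s τ w X x i := by
  set c := ENNReal.ofReal (s x i) with hc
  have h1 : Function.leftLim (clockOf s τ w X) c
      = ∑' x, ∑' i, if ENNReal.ofReal (s x i) < c then clockJump s τ w X x i else 0 := by
    refine le_antisymm (leftLim_le_of_forall (clockOf_mono s τ w X) (hs.ofReal_pos x i)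
      fun r hr => ?_) (tsum_jump_lt_le_leftLim c)
    refine ENNReal.tsum_le_tsum fun x' => ENNReal.tsum_le_tsum fun i' => ?_
    by_cases h : ENNReal.ofReal (s x' i') ≤ r
    · rw [if_pos h, if_pos (h.trans_lt hr)]
      exact le_rfl
    · rw [if_neg h]; exact zero_le
  have h2 : clockJump s τ w X x i
      = ∑' x', ∑' i', if ENNReal.ofReal (s x' i') = c then clockJump s τ w X x' i' else 0 := by
    rw [tsum_eq_single x, tsum_eq_single i]
    · simp [hc]
    · intro i' hi'
      exact if_neg fun h => hi' (hs.ofReal_inj h).2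
    · intro x' hx'
      exact ENNReal.tsum_eq_zero.2 fun i' => if_neg fun h => hx' (hs.ofReal_inj h).1
  rw [h1, h2, ← ENNReal.tsum_add]
  refine tsum_congr fun x' => ?_
  rw [← ENNReal.tsum_add]
  refine tsum_congr fun i' => ?_
  rcases lt_trichotomy (ENNReal.ofReal (s x' i')) c with h | h | h
  · simp [h, h.le, h.ne, clockJump]
  · simp [h, clockJump]
  · simp [h.not_gt, h.ne', not_le.2 h]

/-- If the jumps sum up to infinity, the clock is not bounded on `[0, ∞)`. -/
theorem exists_lt_clockOf (h : ∑' x, ∑' i, clockJump s τ w X x i = ∞) {t : ℝ≥0∞} (ht : t ≠ ∞) :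
    ∃ u, u ≠ ∞ ∧ t < clockOf s τ w X u := by
  by_contra! hcon
  have h1 := tsum_jump_lt_le_leftLim (s := s) (τ := τ) (w := w) (X := X) ∞
  simp only [ENNReal.ofReal_lt_top, if_true, h] at h1
  have h2 := leftLim_le_of_forall (clockOf_mono s τ w X) ENNReal.zero_lt_top (t := t)
    fun r hr => hcon r hr.ne
  exact ht (top_le_iff.1 (h1.trans h2))

/-- The state of the process with one more level. -/
def nextState (s : ℕ → ℕ → ℝ) (Ξ : ℝ≥0∞ → ℝ≥0∞) (X : ℝ≥0∞ → List ℕ∞) (t : ℝ≥0∞) : List ℕ∞ :=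
  X (genInv Ξ t) ++ [lastLabel s Ξ t]

theorem GoodMarks.eq_of_mem (hs : GoodMarks s) {Ξ : ℝ≥0∞ → ℝ≥0∞} (hΞ : Monotone Ξ) {t : ℝ≥0∞}
    {x i x' i' : ℕ} (h1 : Function.leftLim Ξ (ENNReal.ofReal (s x i)) ≤ t)
    (h2 : t < Ξ (ENNReal.ofReal (s x i))) (h1' : Function.leftLim Ξ (ENNReal.ofReal (s x' i')) ≤ t)
    (h2' : t < Ξ (ENNReal.ofReal (s x' i'))) : x = x' ∧ i = i' :=
  hs.ofReal_inj ((genInv_eq_of_mem hΞ h1 h2).symm.trans (genInv_eq_of_mem hΞ h1' h2'))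

theorem GoodMarks.lastLabel_eq (hs : GoodMarks s) {Ξ : ℝ≥0∞ → ℝ≥0∞} (hΞ : Monotone Ξ) {t : ℝ≥0∞}
    {x i : ℕ} (h1 : Function.leftLim Ξ (ENNReal.ofReal (s x i)) ≤ t)
    (h2 : t < Ξ (ENNReal.ofReal (s x i))) : lastLabel s Ξ t = x := by
  classical
  have h : ∃ x : ℕ, ∃ i : ℕ, Function.leftLim Ξ (ENNReal.ofReal (s x i)) ≤ t ∧
      t < Ξ (ENNReal.ofReal (s x i)) := ⟨x, i, h1, h2⟩
  rw [lastLabel, dif_pos h]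
  obtain ⟨i', h1', h2'⟩ := Nat.find_spec h
  have := (hs.eq_of_mem hΞ h1' h2' h1 h2).1
  exact_mod_cast this

/-- The jump intervals are disjoint and the label is infinite off them, so at most one term
survives. Time integrals thereby become sums over jumps. -/
theorem GoodMarks.extendNode_nextState (hs : GoodMarks s) {Ξ : ℝ≥0∞ → ℝ≥0∞} (hΞ : Monotone Ξ)
    (F : List ℕ → ℝ≥0∞) (t : ℝ≥0∞) :
    extendNode F (nextState s Ξ X t) = ∑' x, ∑' i,
      if Function.leftLim Ξ (ENNReal.ofReal (s x i)) ≤ t ∧ t < Ξ (ENNReal.ofReal (s x i)) then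
        extendNode (fun y => F (y ++ [x])) (X (ENNReal.ofReal (s x i))) else 0 := by
  by_cases h : ∃ x : ℕ, ∃ i : ℕ, Function.leftLim Ξ (ENNReal.ofReal (s x i)) ≤ t ∧
      t < Ξ (ENNReal.ofReal (s x i))
  · obtain ⟨x, i, h1, h2⟩ := h
    rw [tsum_eq_single x, tsum_eq_single i, if_pos ⟨h1, h2⟩, nextState, hs.lastLabel_eq hΞ h1 h2,
      extendNode_concat_coe, genInv_eq_of_mem hΞ h1 h2]
    · intro i' hi'
      exact if_neg fun h => hi' (hs.eq_of_mem hΞ h.1 h.2 h1 h2).2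
    · intro x' hx'
      exact ENNReal.tsum_eq_zero.2 fun i' => if_neg fun h => hx' (hs.eq_of_mem hΞ h.1 h.2 h1 h2).1
  · have h1 : lastLabel s Ξ t = ⊤ := by rw [lastLabel, dif_neg h]
    rw [nextState, h1, extendNode_concat_top]
    symm
    exact ENNReal.tsum_eq_zero.2 fun x => ENNReal.tsum_eq_zero.2 fun i =>
      if_neg fun h' => h ⟨x, i, h'⟩

theorem measurableSet_interval (u v : ℝ≥0∞) :
    MeasurableSet {r : ℝ | u ≤ ENNReal.ofReal r ∧ ENNReal.ofReal r < v} := by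
  have h1 : MeasurableSet {r : ℝ | u ≤ ENNReal.ofReal r} :=
    measurableSet_le (by fun_prop) (by fun_prop)
  have h2 : MeasurableSet {r : ℝ | ENNReal.ofReal r < v} :=
    measurableSet_lt (by fun_prop) (by fun_prop)
  exact h1.inter h2

theorem lintegral_interval (u v e : ℝ≥0∞) :
    ∫⁻ r in Set.Ioi (0 : ℝ), (if u ≤ ENNReal.ofReal r ∧ ENNReal.ofReal r < v then e else 0)
      = e * (v - u) := by
  have hm := measurableSet_interval u v
  have h1 : ∀ r : ℝ, (if u ≤ ENNReal.ofReal r ∧ ENNReal.ofReal r < v then e else 0)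
      = {r : ℝ | u ≤ ENNReal.ofReal r ∧ ENNReal.ofReal r < v}.indicator (fun _ => e) r := by
    intro r
    simp only [Set.indicator_apply, Set.mem_ofPred_eq]
  simp_rw [h1]
  rw [lintegral_indicator_const hm, Measure.restrict_apply hm]
  congr 1
  rcases eq_or_ne u ∞ with rfl | hu
  · have : {r : ℝ | ∞ ≤ ENNReal.ofReal r ∧ ENNReal.ofReal r < v} ∩ Set.Ioi 0 = ∅ := by
      ext r; simp
    rw [this]; simp
  rcases eq_or_ne v ∞ with rfl | hv
  · rw [ENNReal.top_sub hu, ← top_le_iff]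
    refine (Real.volume_Ioi (a := u.toReal)).ge.trans (measure_mono fun r hr => ?_)
    have hr' : u.toReal < r := hr
    exact ⟨⟨(ENNReal.le_ofReal_iff_toReal_le hu (ENNReal.toReal_nonneg.trans hr'.le)).2 hr'.le,
      ENNReal.ofReal_lt_top⟩, ENNReal.toReal_nonneg.trans_lt hr'⟩
  · lift u to ℝ≥0 using hu
    lift v to ℝ≥0 using hv
    have hvol : (v : ℝ≥0∞) - u = ENNReal.ofReal ((v : ℝ) - u) := by
      rw [ENNReal.ofReal_sub _ u.coe_nonneg]; simp
    have hu0 : (0 : ℝ) ≤ u := u.coe_nonneg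
    rw [hvol]
    refine le_antisymm ?_ ?_
    · rw [← Real.volume_Icc]
      refine measure_mono fun r hr => ?_
      obtain ⟨⟨h1, h2⟩, h3⟩ := hr
      have h3' : (0 : ℝ) < r := h3
      rw [← ENNReal.ofReal_coe_nnreal, ENNReal.ofReal_le_ofReal_iff h3'.le] at h1
      rw [← ENNReal.ofReal_coe_nnreal, ENNReal.ofReal_lt_ofReal_iff'] at h2
      exact ⟨h1, h2.1.le⟩
    · rw [← Real.volume_Ioo]
      refine measure_mono fun r hr => ?_
      obtain ⟨h1, h2⟩ := hr
      have h3 : (0 : ℝ) < r := hu0.trans_lt h1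
      refine ⟨⟨?_, ?_⟩, h3⟩
      · rw [← ENNReal.ofReal_coe_nnreal]
        exact ENNReal.ofReal_le_ofReal h1.le
      · rw [← ENNReal.ofReal_coe_nnreal]
        exact (ENNReal.ofReal_lt_ofReal_iff (h3.trans h2)).2 h2

/-- The integral of `F (X s)` over the times `s ∈ (a, b]`. -/
def occInt (F : List ℕ → ℝ≥0∞) (X : ℝ≥0∞ → List ℕ∞) (a b : ℝ≥0∞) : ℝ≥0∞ :=
  ∫⁻ r in Set.Ioi (0 : ℝ),
    if a < ENNReal.ofReal r ∧ ENNReal.ofReal r ≤ b then extendNode F (X (ENNReal.ofReal r)) else 0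

theorem measurable_interval (u v e : ℝ≥0∞) : Measurable fun r : ℝ =>
    if u ≤ ENNReal.ofReal r ∧ ENNReal.ofReal r < v then e else 0 := by
  exact Measurable.ite (measurableSet_interval u v) measurable_const measurable_const

/-- The time change formula: an integral along the process with one more level is at most a clock
increment. -/
theorem GoodMarks.occInt_nextState_le (hs : GoodMarks s) (F : List ℕ → ℝ≥0∞) (a b : ℝ≥0∞) :
    occInt F (nextState s (clockOf s τ w X) X) (clockOf s τ w X a) (clockOf s τ w X b)
      ≤ clockInc s τ (fun y x => F (y ++ [x]) * w y x) X a b := by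
  have hΞ := clockOf_mono s τ w X
  set Ξ := clockOf s τ w X with hΞdef
  -- The jump intervals are closed on the left, the domain (Ξ a, Ξ b] on the right; discarding the
  -- single time Ξ b reconciles them.
  have hae : ∀ᵐ r : ℝ ∂(volume.restrict (Set.Ioi (0 : ℝ))), r ≠ (Ξ b).toReal := by
    refine ae_restrict_of_ae ?_
    rw [ae_iff]
    simp
  calc occInt F (nextState s Ξ X) (Ξ a) (Ξ b)
      ≤ ∫⁻ r in Set.Ioi (0 : ℝ), ∑' x, ∑' i,
          if Function.leftLim Ξ (ENNReal.ofReal (s x i)) ≤ ENNReal.ofReal r ∧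
            ENNReal.ofReal r < Ξ (ENNReal.ofReal (s x i)) then
          (if a < ENNReal.ofReal (s x i) ∧ ENNReal.ofReal (s x i) ≤ b then
            extendNode (fun y => F (y ++ [x])) (X (ENNReal.ofReal (s x i))) else 0) else 0 := by
        refine lintegral_mono_ae ?_
        filter_upwards [hae, ae_restrict_mem measurableSet_Ioi] with r hr hr0
        have hr0' : (0 : ℝ) < r := hr0
        split_ifs with hab
        · rw [hs.extendNode_nextState hΞ]
          have hlt : ENNReal.ofReal r < Ξ b := by
            refine lt_of_le_of_ne hab.2 fun he => hr ?_
            rw [← he, ENNReal.toReal_ofReal hr0'.le]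
          refine ENNReal.tsum_le_tsum fun x => ENNReal.tsum_le_tsum fun i => ?_
          by_cases hin : Function.leftLim Ξ (ENNReal.ofReal (s x i)) ≤ ENNReal.ofReal r ∧
            ENNReal.ofReal r < Ξ (ENNReal.ofReal (s x i))
          · rw [if_pos hin, if_pos hin, if_pos]
            constructor
            · by_contra hle
              exact absurd (hab.1.trans hin.2) (not_lt.2 (hΞ (not_lt.1 hle)))
            · by_contra hle
              exact absurd (hin.1.trans_lt hlt) (not_lt.2 (hΞ.le_leftLim (not_le.1 hle)))
          · rw [if_neg hin]; exact zero_le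
        · exact zero_le
    _ = ∑' x, ∑' i, (if a < ENNReal.ofReal (s x i) ∧ ENNReal.ofReal (s x i) ≤ b then
            extendNode (fun y => F (y ++ [x])) (X (ENNReal.ofReal (s x i))) else 0) *
          (Ξ (ENNReal.ofReal (s x i)) - Function.leftLim Ξ (ENNReal.ofReal (s x i))) := by
        rw [lintegral_tsum fun x => (Measurable.tsum fun i =>
          measurable_interval _ _ _).aemeasurable]
        refine tsum_congr fun x => ?_
        rw [lintegral_tsum fun i => (measurable_interval _ _ _).aemeasurable]
        exact tsum_congr fun i => lintegral_interval _ _ _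
    -- The interval length is at most the jump. It can be smaller if the left limit is infinite,
    -- because then ∞ - ∞ = 0.
    _ ≤ clockInc s τ (fun y x => F (y ++ [x]) * w y x) X a b := by
        refine ENNReal.tsum_le_tsum fun x => ENNReal.tsum_le_tsum fun i => ?_
        split_ifs with hab
        · rw [← extendNode_mul, mul_assoc]
          refine mul_le_mul_right ?_ _
          rw [hΞdef, hs.clockOf_mark x i]
          exact tsub_le_iff_left.2 le_rfl
        · simp

/-- For a finite clock the lengths equal the jumps. The exact formula is what carries the infinite
occupation time over to the next level. -/
theorem GoodMarks.lintegral_nextState (hs : GoodMarks s) (F : List ℕ → ℝ≥0∞)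
    (hfin : ∀ u, u ≠ ∞ → clockOf s τ w X u ≠ ∞) :
    ∫⁻ r in Set.Ioi (0 : ℝ), extendNode F (nextState s (clockOf s τ w X) X (ENNReal.ofReal r))
      = ∑' x, ∑' i, clockJump s τ (fun y x => F (y ++ [x]) * w y x) X x i := by
  have hΞ := clockOf_mono s τ w X
  simp_rw [hs.extendNode_nextState hΞ]
  rw [lintegral_tsum fun x => (Measurable.tsum fun i => measurable_interval _ _ _).aemeasurable]
  refine tsum_congr fun x => ?_
  rw [lintegral_tsum fun i => (measurable_interval _ _ _).aemeasurable]
  refine tsum_congr fun i => ?_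
  have hne : Function.leftLim (clockOf s τ w X) (ENNReal.ofReal (s x i)) ≠ ∞ :=
    ((hΞ.leftLim_le le_rfl).trans_lt (hfin _ ENNReal.ofReal_ne_top).lt_top).ne
  rw [lintegral_interval, hs.clockOf_mark x i, ENNReal.add_sub_cancel_left hne, clockJump, clockJump,
    ← mul_assoc, extendNode_mul]

end Clock

/-! ### Measurability -/

/-- The state space is countable, so with the discrete σ-algebra every function of the state is
measurable. -/
instance : MeasurableSpace (List ℕ∞) := ⊤

instance : DiscreteMeasurableSpace (List ℕ∞) := ⟨fun _ => trivial⟩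

section Measurability

variable {Z : Type*} [MeasurableSpace Z]

/-- By monotonicity, the infimum may be tested on a countable dense set of times. -/
theorem measurable_genInv {Ξ : Z → ℝ≥0∞ → ℝ≥0∞} (hΞ : Measurable fun q : Z × ℝ≥0∞ => Ξ q.1 q.2)
    (hmono : ∀ z, Monotone (Ξ z)) : Measurable fun q : Z × ℝ≥0∞ => genInv (Ξ q.1) q.2 := by
  refine measurable_of_Iio fun r => ?_
  have h1 : (fun q : Z × ℝ≥0∞ => genInv (Ξ q.1) q.2) ⁻¹' Set.Iio r
      = ⋃ n : ℕ, {q | TopologicalSpace.denseSeq ℝ≥0∞ n < r ∧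
        q.2 < Ξ q.1 (TopologicalSpace.denseSeq ℝ≥0∞ n)} := by
    ext q
    simp only [Set.mem_preimage, Set.mem_Iio, Set.mem_iUnion, Set.mem_ofPred_eq]
    constructor
    · intro h
      obtain ⟨a, ha, har⟩ := sInf_lt_iff.1 h
      obtain ⟨_, ⟨n, rfl⟩, hn1, hn2⟩ :=
        (TopologicalSpace.denseRange_denseSeq ℝ≥0∞).exists_between har
      exact ⟨n, hn2, lt_of_lt_of_le ha (hmono _ hn1.le)⟩
    · rintro ⟨n, h1, h2⟩
      exact lt_of_le_of_lt (sInf_le h2) h1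
  rw [h1]
  refine MeasurableSet.iUnion fun n => ?_
  by_cases hn : TopologicalSpace.denseSeq ℝ≥0∞ n < r
  · simp only [hn, true_and]
    exact measurableSet_lt measurable_snd (hΞ.comp (measurable_fst.prodMk measurable_const))
  · simp [hn]

theorem leftLim_eq_iSup {Ξ : ℝ≥0∞ → ℝ≥0∞} (hΞ : Monotone Ξ) (c : ℝ≥0∞) :
    Function.leftLim Ξ c = if c = 0 then Ξ 0 else
      ⨆ n : ℕ, if TopologicalSpace.denseSeq ℝ≥0∞ n < c then Ξ (TopologicalSpace.denseSeq ℝ≥0∞ n)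
        else 0 := by
  split_ifs with hc
  · subst hc
    have : 𝓝[<] (0 : ℝ≥0∞) = ⊥ := by simp
    rw [leftLim_eq_of_eq_bot _ this]
  · refine le_antisymm (leftLim_le_of_forall hΞ (pos_iff_ne_zero.2 hc) fun r hr => ?_)
      (iSup_le fun n => ?_)
    · obtain ⟨_, ⟨n, rfl⟩, hn1, hn2⟩ :=
        (TopologicalSpace.denseRange_denseSeq ℝ≥0∞).exists_between hr
      refine (hΞ hn1.le).trans (le_trans ?_ (le_iSup _ n))
      rw [if_pos hn2]
    · split_ifs with h
      · exact hΞ.le_leftLim h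
      · exact zero_le

theorem measurable_leftLim {Ξ : Z → ℝ≥0∞ → ℝ≥0∞} (hΞ : Measurable fun q : Z × ℝ≥0∞ => Ξ q.1 q.2)
    (hmono : ∀ z, Monotone (Ξ z)) :
    Measurable fun q : Z × ℝ≥0∞ => Function.leftLim (Ξ q.1) q.2 := by
  simp_rw [fun q : Z × ℝ≥0∞ => leftLim_eq_iSup (hmono q.1) q.2]
  have hc : ∀ c, Measurable fun q : Z × ℝ≥0∞ => Ξ q.1 c := fun c =>
    hΞ.comp (measurable_fst.prodMk measurable_const)
  refine Measurable.ite (measurableSet_eq_fun measurable_snd measurable_const) (hc 0)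
    (Measurable.iSup fun n => ?_)
  exact Measurable.ite (measurableSet_lt measurable_const measurable_snd) (hc _) measurable_const

theorem measurable_lastLabel {s : Z → ℕ → ℕ → ℝ} (hs : ∀ x i, Measurable fun z => s z x i)
    {Ξ : Z → ℝ≥0∞ → ℝ≥0∞} (hΞ : Measurable fun q : Z × ℝ≥0∞ => Ξ q.1 q.2)
    (hmono : ∀ z, Monotone (Ξ z)) :
    Measurable fun q : Z × ℝ≥0∞ => lastLabel (s q.1) (Ξ q.1) q.2 := by
  classical
  let A : ℕ → Set (Z × ℝ≥0∞) := fun x =>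
    {q | ∃ i, Function.leftLim (Ξ q.1) (ENNReal.ofReal (s q.1 x i)) ≤ q.2 ∧
      q.2 < Ξ q.1 (ENNReal.ofReal (s q.1 x i))}
  have hA : ∀ x, MeasurableSet (A x) := by
    intro x
    have : A x = ⋃ i, {q | Function.leftLim (Ξ q.1) (ENNReal.ofReal (s q.1 x i)) ≤ q.2} ∩
        {q | q.2 < Ξ q.1 (ENNReal.ofReal (s q.1 x i))} := by
      ext q
      simp [A]
    rw [this]
    refine MeasurableSet.iUnion fun i => ?_
    have hm : Measurable fun q : Z × ℝ≥0∞ => (q.1, ENNReal.ofReal (s q.1 x i)) :=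
      measurable_fst.prodMk ((hs x i).comp measurable_fst).ennreal_ofReal
    exact (measurableSet_le ((measurable_leftLim hΞ hmono).comp hm) measurable_snd).inter
      (measurableSet_lt measurable_snd (hΞ.comp hm))
  have hsome : ∀ n : ℕ, MeasurableSet ((fun q : Z × ℝ≥0∞ => lastLabel (s q.1) (Ξ q.1) q.2) ⁻¹'
      {(n : ℕ∞)}) := by
    intro n
    have : (fun q : Z × ℝ≥0∞ => lastLabel (s q.1) (Ξ q.1) q.2) ⁻¹' {(n : ℕ∞)}
        = A n ∩ ⋂ m ∈ Finset.range n, (A m)ᶜ := by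
      ext q
      simp only [Set.mem_preimage, Set.mem_singleton_iff, Set.mem_inter_iff, Set.mem_iInter,
        Finset.mem_range, Set.mem_compl_iff]
      rw [lastLabel]
      split_ifs with h
      · rw [Nat.cast_inj, Nat.find_eq_iff]
        exact Iff.rfl
      · constructor
        · intro h'; simp at h'
        · rintro ⟨h', -⟩; exact absurd ⟨n, h'⟩ h
    rw [this]
    exact (hA n).inter (Finset.measurableSet_biInter _ fun m _ => (hA m).compl)
  refine measurable_to_countable' fun y => ?_
  induction y with
  | coe n => exact hsome n
  | top =>
    have : (fun q : Z × ℝ≥0∞ => lastLabel (s q.1) (Ξ q.1) q.2) ⁻¹' {⊤}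
        = (⋃ n : ℕ, (fun q : Z × ℝ≥0∞ => lastLabel (s q.1) (Ξ q.1) q.2) ⁻¹' {(n : ℕ∞)})ᶜ := by
      ext q
      simp only [Set.mem_preimage, Set.mem_singleton_iff, Set.mem_compl_iff, Set.mem_iUnion,
        not_exists]
      constructor
      · intro h n; rw [h]; simp
      · intro h
        induction hl : lastLabel (s q.1) (Ξ q.1) q.2 with
        | top => rfl
        | coe n => exact absurd hl (h n)
    rw [this]
    exact (MeasurableSet.iUnion hsome).compl

theorem measurable_extendNode {w : Z → List ℕ → ℝ≥0∞} (hw : ∀ y, Measurable fun z => w z y) :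
    Measurable fun q : Z × List ℕ∞ => extendNode (w q.1) q.2 := by
  refine measurable_from_prod_countable_left fun l => ?_
  by_cases hl : ∃ y : List ℕ, y.map (fun n : ℕ => (n : ℕ∞)) = l
  · obtain ⟨y, rfl⟩ := hl
    simpa only [extendNode_map] using hw y
  · simp only [extendNode_of_notMem _ hl]
    exact measurable_const

theorem measurable_clockOf {s τ : Z → ℕ → ℕ → ℝ} (hs : ∀ x i, Measurable fun z => s z x i)
    (hτ : ∀ x i, Measurable fun z => τ z x i) {w : Z → List ℕ → ℕ → ℝ≥0∞}
    (hw : ∀ y x, Measurable fun z => w z y x) {X : Z → ℝ≥0∞ → List ℕ∞}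
    (hX : Measurable fun q : Z × ℝ≥0∞ => X q.1 q.2) :
    Measurable fun q : Z × ℝ≥0∞ => clockOf (s q.1) (τ q.1) (w q.1) (X q.1) q.2 := by
  unfold clockOf
  refine Measurable.tsum fun x => Measurable.tsum fun i => ?_
  have hm : Measurable fun q : Z × ℝ≥0∞ => ENNReal.ofReal (s q.1 x i) :=
    ((hs x i).comp measurable_fst).ennreal_ofReal
  refine Measurable.ite (measurableSet_le hm measurable_snd) (Measurable.mul ?_ ?_) measurable_const
  · have h1 : Measurable fun q : Z × ℝ≥0∞ => (q.1, X q.1 (ENNReal.ofReal (s q.1 x i))) :=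
      measurable_fst.prodMk (hX.comp (measurable_fst.prodMk hm))
    exact (measurable_extendNode (w := fun z y => w z y x) fun y => hw y x).comp h1
  · exact ((hτ x i).comp measurable_fst).ennreal_ofReal

theorem measurable_nextState {s : Z → ℕ → ℕ → ℝ} (hs : ∀ x i, Measurable fun z => s z x i)
    {Ξ : Z → ℝ≥0∞ → ℝ≥0∞} (hΞ : Measurable fun q : Z × ℝ≥0∞ => Ξ q.1 q.2)
    (hmono : ∀ z, Monotone (Ξ z)) {X : Z → ℝ≥0∞ → List ℕ∞}
    (hX : Measurable fun q : Z × ℝ≥0∞ => X q.1 q.2) :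
    Measurable fun q : Z × ℝ≥0∞ => nextState (s q.1) (Ξ q.1) (X q.1) q.2 := by
  have h1 : Measurable fun q : Z × ℝ≥0∞ => X q.1 (genInv (Ξ q.1) q.2) :=
    hX.comp (measurable_fst.prodMk (measurable_genInv hΞ hmono))
  have h2 : Measurable fun p : List ℕ∞ × ℕ∞ => p.1 ++ [p.2] := Measurable.of_discrete
  exact h2.comp (h1.prodMk (measurable_lastLabel hs hΞ hmono))

end Measurability

theorem kState_succ (g : List ℕ → ℕ → ℝ) (σ T : ℕ → ℕ → ℕ → ℝ) (k : ℕ) :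
    kState g σ T (k + 1) = nextState (σ k) (clock g σ T k) (kState g σ T k) := rfl

theorem measurable_kState_clock (k : ℕ) :
    (Measurable fun q : ((List ℕ → ℕ → ℝ) × Dyn) × ℝ≥0∞ => kState q.1.1 q.1.2.2 q.1.2.1 k q.2) ∧
    Measurable fun q : ((List ℕ → ℕ → ℝ) × Dyn) × ℝ≥0∞ => clock q.1.1 q.1.2.2 q.1.2.1 k q.2 := by
  have hσ : ∀ k x i, Measurable fun z : (List ℕ → ℕ → ℝ) × Dyn => z.2.2 k x i :=
    fun k x i => by fun_prop
  have hT : ∀ k x i, Measurable fun z : (List ℕ → ℕ → ℝ) × Dyn => z.2.1 k x i :=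
    fun k x i => by fun_prop
  have hg : ∀ y x, Measurable fun z : (List ℕ → ℕ → ℝ) × Dyn => ENNReal.ofReal (z.1 y x) :=
    fun y x => by fun_prop
  have hclock : ∀ k, (Measurable fun q : ((List ℕ → ℕ → ℝ) × Dyn) × ℝ≥0∞ =>
      kState q.1.1 q.1.2.2 q.1.2.1 k q.2) → Measurable fun q : ((List ℕ → ℕ → ℝ) × Dyn) × ℝ≥0∞ =>
        clock q.1.1 q.1.2.2 q.1.2.1 k q.2 := fun k hX =>
    measurable_clockOf (hσ k) (hT k) hg (X := fun z => kState z.1 z.2.2 z.2.1 k) hX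
  have hstate : Measurable fun q : ((List ℕ → ℕ → ℝ) × Dyn) × ℝ≥0∞ =>
      kState q.1.1 q.1.2.2 q.1.2.1 k q.2 := by
    induction k with
    | zero => exact measurable_const
    | succ k ih =>
      exact measurable_nextState (hσ k) (Ξ := fun z => clock z.1 z.2.2 z.2.1 k) (hclock k ih)
        (fun z => clockOf_mono _ _ _ _) (X := fun z => kState z.1 z.2.2 z.2.1 k) ih
  exact ⟨hstate, hclock k hstate⟩

theorem measurable_adjClock (α : ℕ → ℝ) (k : ℕ) :
    Measurable fun q : ((List ℕ → ℕ → ℝ) × Dyn) × ℝ≥0∞ => adjClock α q.1.1 q.1.2.2 q.1.2.1 k q.2 := by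
  have hσ : ∀ x i, Measurable fun z : (List ℕ → ℕ → ℝ) × Dyn => z.2.2 k x i := fun x i => by fun_prop
  have hT : ∀ x i, Measurable fun z : (List ℕ → ℕ → ℝ) × Dyn => z.2.1 k x i := fun x i => by fun_prop
  have hw : ∀ y x, Measurable fun z : (List ℕ → ℕ → ℝ) × Dyn =>
      W α z.1 (y ++ [x]) * ENNReal.ofReal (z.1 y x) := fun y x =>
    ((measurable_W α _).comp measurable_fst).mul
      ((measurable_pi_apply x).comp ((measurable_pi_apply y).comp measurable_fst)).ennreal_ofReal
  exact measurable_clockOf hσ hT hw (X := fun z => kState z.1 z.2.2 z.2.1 k)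
    (measurable_kState_clock k).1

theorem measurable_clockComp (k m : ℕ) :
    Measurable fun q : ((List ℕ → ℕ → ℝ) × Dyn) × ℝ≥0∞ =>
      clockComp q.1.1 q.1.2.2 q.1.2.1 k m q.2 := by
  induction m with
  | zero => exact measurable_snd
  | succ m ih => exact (measurable_kState_clock (k + m)).2.comp (measurable_fst.prodMk ih)

theorem measurable_adjClockComp (α : ℕ → ℝ) (k m : ℕ) :
    Measurable fun q : ((List ℕ → ℕ → ℝ) × Dyn) × ℝ≥0∞ =>
      adjClockComp α q.1.1 q.1.2.2 q.1.2.1 k m q.2 :=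
  (measurable_adjClock α (k + m)).comp (measurable_fst.prodMk (measurable_clockComp k m))

/-! ### Dependence on finitely many levels -/

theorem kState_congr (g : List ℕ → ℕ → ℝ) {d d' : Dyn} {k : ℕ}
    (h : ∀ j < k, d.1 j = d'.1 j ∧ d.2 j = d'.2 j) :
    kState g d.2 d.1 k = kState g d'.2 d'.1 k := by
  induction k with
  | zero => rfl
  | succ k ih =>
    have h1 := ih fun j hj => h j (hj.trans (Nat.lt_succ_self k))
    obtain ⟨h2, h3⟩ := h k (Nat.lt_succ_self k)
    rw [kState_succ, kState_succ, clock, clock, h1, h2, h3]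

theorem clock_congr (g : List ℕ → ℕ → ℝ) {d d' : Dyn} {k : ℕ}
    (h : ∀ j ≤ k, d.1 j = d'.1 j ∧ d.2 j = d'.2 j) : clock g d.2 d.1 k = clock g d'.2 d'.1 k := by
  obtain ⟨h2, h3⟩ := h k le_rfl
  rw [clock, clock, kState_congr g fun j hj => h j (le_of_lt hj), h2, h3]

theorem clockComp_congr (g : List ℕ → ℕ → ℝ) {d d' : Dyn} {k m : ℕ}
    (h : ∀ j < k + m, d.1 j = d'.1 j ∧ d.2 j = d'.2 j) :
    clockComp g d.2 d.1 k m = clockComp g d'.2 d'.1 k m := by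
  induction m with
  | zero => rfl
  | succ m ih =>
    rw [clockComp, clockComp, ih fun j hj => h j (by omega), clock_congr g fun j hj => h j (by omega)]

theorem adjClockComp_congr (α : ℕ → ℝ) (g : List ℕ → ℕ → ℝ) {d d' : Dyn} {k m : ℕ}
    (h : ∀ j ≤ k + m, d.1 j = d'.1 j ∧ d.2 j = d'.2 j) :
    adjClockComp α g d.2 d.1 k m = adjClockComp α g d'.2 d'.1 k m := by
  obtain ⟨h2, h3⟩ := h (k + m) le_rfl
  rw [adjClockComp, adjClockComp, clockComp_congr g fun j hj => h j (le_of_lt hj), adjClock, adjClock,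
    kState_congr g fun j hj => h j (le_of_lt hj), h2, h3]

theorem clockComp_mono (g : List ℕ → ℕ → ℝ) (d : Dyn) (k m : ℕ) :
    Monotone (clockComp g d.2 d.1 k m) := by
  induction m with
  | zero => exact monotone_id
  | succ m ih => exact (clockOf_mono _ _ _ _).comp ih

theorem adjClockComp_mono (α : ℕ → ℝ) (g : List ℕ → ℕ → ℝ) (d : Dyn) (k m : ℕ) :
    Monotone (adjClockComp α g d.2 d.1 k m) :=
  (clockOf_mono _ _ _ _).comp (clockComp_mono g d k m)

/-- The increment over `(a, b]` of the adjusted clock composition. -/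
def adjInc (α : ℕ → ℝ) (g : List ℕ → ℕ → ℝ) (d : Dyn) (k m : ℕ) (a b : ℝ≥0∞) : ℝ≥0∞ :=
  clockInc (d.2 (k + m)) (d.1 (k + m)) (fun y x => W α g (y ++ [x]) * ENNReal.ofReal (g y x))
    (kState g d.2 d.1 (k + m)) (clockComp g d.2 d.1 k m a) (clockComp g d.2 d.1 k m b)

theorem adjClockComp_eq_add_adjInc (α : ℕ → ℝ) (g : List ℕ → ℕ → ℝ) (d : Dyn) (k m : ℕ)
    {a b : ℝ≥0∞} (hab : a ≤ b) :
    adjClockComp α g d.2 d.1 k m b = adjClockComp α g d.2 d.1 k m a + adjInc α g d k m a b :=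
  clockOf_eq_add_clockInc (clockComp_mono g d k m hab)

theorem clockComp_zero {g : List ℕ → ℕ → ℝ} {d : Dyn} (hd : ∀ n, GoodMarks (d.2 n)) (k m : ℕ) :
    clockComp g d.2 d.1 k m 0 = 0 := by
  induction m with
  | zero => rfl
  | succ m ih =>
    rw [clockComp, Function.comp, ih]
    exact (hd _).clockOf_zero

theorem adjClockComp_zero {α : ℕ → ℝ} {g : List ℕ → ℕ → ℝ} {d : Dyn} (hd : ∀ n, GoodMarks (d.2 n))
    (k m : ℕ) : adjClockComp α g d.2 d.1 k m 0 = 0 := by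
  rw [adjClockComp, Function.comp, clockComp_zero hd]
  exact (hd _).clockOf_zero

/-- There are no marks at time 0, so bounds on increments cover the clocks themselves. -/
theorem adjClockComp_eq_adjInc {α : ℕ → ℝ} {g : List ℕ → ℕ → ℝ} {d : Dyn}
    (hd : ∀ n, GoodMarks (d.2 n)) (k m : ℕ) (t : ℝ≥0∞) :
    adjClockComp α g d.2 d.1 k m t = adjInc α g d k m 0 t := by
  rw [adjClockComp_eq_add_adjInc α g d k m (zero_le (a := t)), adjClockComp_zero hd, zero_add]

/-! ### Measurability for a fixed environment -/

theorem measurable_kState_dyn (g : List ℕ → ℕ → ℝ) (k : ℕ) :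
    Measurable fun q : Dyn × ℝ≥0∞ => kState g q.1.2 q.1.1 k q.2 :=
  (measurable_kState_clock k).1.comp (g := fun q : ((List ℕ → ℕ → ℝ) × Dyn) × ℝ≥0∞ =>
    kState q.1.1 q.1.2.2 q.1.2.1 k q.2) (f := fun q : Dyn × ℝ≥0∞ => ((g, q.1), q.2))
    ((measurable_const.prodMk measurable_fst).prodMk measurable_snd)

theorem measurable_kState_time (g : List ℕ → ℕ → ℝ) (d : Dyn) (k : ℕ) :
    Measurable (kState g d.2 d.1 k) :=
  (measurable_kState_dyn g k).comp (measurable_const.prodMk measurable_id : Measurable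
    fun t : ℝ≥0∞ => (d, t))

theorem measurable_clockComp_dyn (g : List ℕ → ℕ → ℝ) (k m : ℕ) (t : ℝ≥0∞) :
    Measurable fun d : Dyn => clockComp g d.2 d.1 k m t :=
  (measurable_clockComp k m).comp (g := fun q : ((List ℕ → ℕ → ℝ) × Dyn) × ℝ≥0∞ =>
    clockComp q.1.1 q.1.2.2 q.1.2.1 k m q.2) (f := fun d : Dyn => ((g, d), t))
    ((measurable_const.prodMk measurable_id).prodMk measurable_const)

theorem measurable_adjClockComp_dyn (α : ℕ → ℝ) (g : List ℕ → ℕ → ℝ) (k m : ℕ) (t : ℝ≥0∞) :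
    Measurable fun d : Dyn => adjClockComp α g d.2 d.1 k m t :=
  (measurable_adjClockComp α k m).comp (g := fun q : ((List ℕ → ℕ → ℝ) × Dyn) × ℝ≥0∞ =>
    adjClockComp α q.1.1 q.1.2.2 q.1.2.1 k m q.2) (f := fun d : Dyn => ((g, d), t))
    ((measurable_const.prodMk measurable_id).prodMk measurable_const)

theorem measurable_extendNode_const (F : List ℕ → ℝ≥0∞) : Measurable (extendNode F) :=
  Measurable.of_discrete

theorem measurable_clockInc {Z : Type*} [MeasurableSpace Z] {s τ : Z → ℕ → ℕ → ℝ}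
    (hs : ∀ x i, Measurable fun z => s z x i) (hτ : ∀ x i, Measurable fun z => τ z x i)
    (w : List ℕ → ℕ → ℝ≥0∞) {X : Z → ℝ≥0∞ → List ℕ∞}
    (hX : Measurable fun q : Z × ℝ≥0∞ => X q.1 q.2) {a b : Z → ℝ≥0∞} (ha : Measurable a)
    (hb : Measurable b) : Measurable fun z => clockInc (s z) (τ z) w (X z) (a z) (b z) := by
  unfold clockInc
  refine Measurable.tsum fun x => Measurable.tsum fun i => ?_
  have hm : Measurable fun z => ENNReal.ofReal (s z x i) := (hs x i).ennreal_ofReal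
  have h1 : MeasurableSet {z | a z < ENNReal.ofReal (s z x i)} := measurableSet_lt ha hm
  have h2 : MeasurableSet {z | ENNReal.ofReal (s z x i) ≤ b z} := measurableSet_le hm hb
  refine Measurable.ite (h1.inter h2) (Measurable.mul ?_ (hτ x i).ennreal_ofReal) measurable_const
  exact (measurable_extendNode_const _).comp (hX.comp (measurable_id.prodMk hm))

theorem measurable_dyn_mark (n x i : ℕ) : Measurable fun d : Dyn => d.2 n x i := by fun_prop

theorem measurable_dyn_hold (n x i : ℕ) : Measurable fun d : Dyn => d.1 n x i := by fun_prop

theorem measurable_adjInc (α : ℕ → ℝ) (g : List ℕ → ℕ → ℝ) (k m : ℕ) (a b : ℝ≥0∞) :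
    Measurable fun d : Dyn => adjInc α g d k m a b :=
  measurable_clockInc (fun x i => measurable_dyn_mark _ x i) (fun x i => measurable_dyn_hold _ x i) _
    (X := fun d => kState g d.2 d.1 (k + m)) (measurable_kState_dyn g (k + m))
    (measurable_clockComp_dyn g k m a) (measurable_clockComp_dyn g k m b)

/-! ### The law of the dynamics in a fixed environment -/

theorem occInt_mono_fun {F G : List ℕ → ℝ≥0∞} (h : ∀ y, F y ≤ G y) (X : ℝ≥0∞ → List ℕ∞)
    (a b : ℝ≥0∞) : occInt F X a b ≤ occInt G X a b := by
  refine lintegral_mono fun r => ?_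
  split_ifs
  · exact extendNode_mono h _
  · exact le_rfl

theorem occInt_mono_right (F : List ℕ → ℝ≥0∞) (X : ℝ≥0∞ → List ℕ∞) (a : ℝ≥0∞) {b b' : ℝ≥0∞}
    (h : b ≤ b') : occInt F X a b ≤ occInt F X a b' := by
  refine lintegral_mono fun r => ?_
  by_cases h1 : a < ENNReal.ofReal r ∧ ENNReal.ofReal r ≤ b
  · rw [if_pos h1, if_pos ⟨h1.1, h1.2.trans h⟩]
  · rw [if_neg h1]; exact zero_le

theorem clockInc_mono {s τ : ℕ → ℕ → ℝ} {w v : List ℕ → ℕ → ℝ≥0∞} (h : ∀ y x, w y x ≤ v y x)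
    (X : ℝ≥0∞ → List ℕ∞) (a : ℝ≥0∞) {b b' : ℝ≥0∞} (hb : b ≤ b') :
    clockInc s τ w X a b ≤ clockInc s τ v X a b' := by
  refine ENNReal.tsum_le_tsum fun x => ENNReal.tsum_le_tsum fun i => ?_
  by_cases h1 : a < ENNReal.ofReal (s x i) ∧ ENNReal.ofReal (s x i) ≤ b
  · rw [if_pos h1, if_pos ⟨h1.1, h1.2.trans hb⟩]
    exact mul_le_mul_left (extendNode_mono (fun y => h y x) _) _
  · rw [if_neg h1]; exact zero_le

section Law

variable {ν : Measure Dyn}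

theorem DynLaw.ae_goodMarks (hν : DynLaw ν) : ∀ᵐ d ∂ν, ∀ n, GoodMarks (d.2 n) := by
  filter_upwards [hν.ae_pos, hν.ae_inj] with d h1 h2 n
  exact ⟨h1 n, h2 n⟩

/-- The mean of a clock increment driven by a deterministic path. -/
theorem DynLaw.lintegral_clockInc (hν : DynLaw ν) (n : ℕ) (w : List ℕ → ℕ → ℝ≥0∞)
    {X : ℝ≥0∞ → List ℕ∞} (hX : Measurable X) (a b : ℝ≥0∞) :
    ∫⁻ d : Dyn, clockInc (d.2 n) (d.1 n) w X a b ∂ν = occInt (fun y => ∑' x, w y x) X a b := by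
  let f : ℕ → ℝ → ℝ≥0∞ := fun x r => if a < ENNReal.ofReal r ∧ ENNReal.ofReal r ≤ b then
    extendNode (fun y => w y x) (X (ENNReal.ofReal r)) else 0
  have hset : MeasurableSet {r : ℝ | a < ENNReal.ofReal r ∧ ENNReal.ofReal r ≤ b} := by
    have h1 : MeasurableSet {r : ℝ | a < ENNReal.ofReal r} :=
      measurableSet_lt (by fun_prop) (by fun_prop)
    have h2 : MeasurableSet {r : ℝ | ENNReal.ofReal r ≤ b} :=
      measurableSet_le (by fun_prop) (by fun_prop)
    exact h1.inter h2
  have hf : ∀ x, Measurable (f x) := fun x => Measurable.ite hset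
    ((measurable_extendNode_const _).comp (hX.comp ENNReal.measurable_ofReal)) measurable_const
  have h1 : ∀ d : Dyn, clockInc (d.2 n) (d.1 n) w X a b
      = ∑' x, ∑' i, f x (d.2 n x i) * ENNReal.ofReal (d.1 n x i) := by
    intro d
    refine tsum_congr fun x => tsum_congr fun i => ?_
    simp only [f, ite_mul, zero_mul]
  simp_rw [h1]
  have hm : ∀ x, Measurable fun d : Dyn => ∑' i, f x (d.2 n x i) * ENNReal.ofReal (d.1 n x i) :=
    fun x => Measurable.tsum fun i => ((hf x).comp (measurable_dyn_mark n x i)).mul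
      (measurable_dyn_hold n x i).ennreal_ofReal
  rw [lintegral_tsum fun x => (hm x).aemeasurable]
  -- Campbell's formula for each label; summing over labels inside the integral produces the sum
  -- over children.
  simp_rw [fun x => hν.campbell n x (f x) (hf x)]
  rw [← lintegral_tsum fun x => (hf x).aemeasurable]
  refine lintegral_congr fun r => ?_
  simp only [f]
  split_ifs
  · exact tsum_extendNode _ _
  · simp

/-- This and the next two lemmas serve as conditioning: `d` carries the frozen levels, `d'` the
fresh levels in `S`. -/
theorem DynLaw.ae_of_resample (hν : DynLaw ν) (S : Set ℕ) {p : Dyn → Prop}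
    (hp : MeasurableSet {d | p d}) (h : ∀ᵐ d ∂ν, ∀ᵐ d' ∂ν, p (resampleDyn S d d')) :
    ∀ᵐ d ∂ν, p d := by
  have := hν.isProb
  have hm := measurable_resampleDyn S
  rw [← hν.map_resample S, ae_map_iff hm.aemeasurable hp]
  exact (Measure.ae_prod_iff_ae_ae (p := fun q : Dyn × Dyn => p (resampleDyn S q.1 q.2)) (hm hp)).2 h

theorem DynLaw.ae_resample (hν : DynLaw ν) (S : Set ℕ) {p : Dyn → Prop} (h : ∀ᵐ d ∂ν, p d) :
    ∀ᵐ d ∂ν, ∀ᵐ d' ∂ν, p (resampleDyn S d d') := by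
  have := hν.isProb
  rw [← hν.map_resample S] at h
  exact Measure.ae_ae_of_ae_prod (ae_of_ae_map (measurable_resampleDyn S).aemeasurable h)

theorem DynLaw.lintegral_resample (hν : DynLaw ν) (S : Set ℕ) {f : Dyn → ℝ≥0∞} (hf : Measurable f) :
    ∫⁻ d, ∫⁻ d', f (resampleDyn S d d') ∂ν ∂ν = ∫⁻ d, f d ∂ν := by
  have := hν.isProb
  have hm := measurable_resampleDyn S
  have hfm : Measurable fun q : Dyn × Dyn => f (resampleDyn S q.1 q.2) := hf.comp hm
  conv_rhs => rw [← hν.map_resample S, lintegral_map hf hm, lintegral_prod _ hfm.aemeasurable]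

end Law

/-! ### Finiteness of the integrals along the processes -/

/-- The indicator of the node `x`. -/
def nodeInd (x : List ℕ) (y : List ℕ) : ℝ≥0∞ := if y = x then 1 else 0

theorem extendNode_nodeInd (x : List ℕ) (l : List ℕ∞) :
    extendNode (nodeInd x) l = if l = x.map (fun n : ℕ => (n : ℕ∞)) then 1 else 0 := by
  by_cases hl : ∃ y : List ℕ, y.map (fun n : ℕ => (n : ℕ∞)) = l
  · obtain ⟨y, rfl⟩ := hl
    rw [extendNode_map, nodeInd]
    simp only [map_coe_injective.eq_iff]
  · rw [extendNode_of_notMem _ hl, if_neg]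
    rintro rfl
    exact hl ⟨x, rfl⟩

/-- A weight that dominates `W`, the constant `1`, and its own sums over children. -/
def domWeight (α : ℕ → ℝ) (g : List ℕ → ℕ → ℝ) (m : ℕ) (y : List ℕ) : ℝ≥0∞ :=
  W α g y + descSum 1 g y (y.length + m)

/-- The first summand obeys `childSum_W`, the second the first-generation recursion. A child is one
level deeper, which raises `m` by one; this is why regularity has to include all `m`. -/
theorem GoodEnv.childSum_domWeight_le {α : ℕ → ℝ} {g : List ℕ → ℕ → ℝ} (hg : GoodEnv α g) (m : ℕ)
    (y : List ℕ) : childSum g (domWeight α g m) y ≤ domWeight α g (m + 1) y := by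
  have h1 := descSum_eq_tsum_child 1 hg.pos (x := y) (n := y.length + (m + 1)) (by omega)
  rw [domWeight, h1]
  simp only [childSum, domWeight, add_mul]
  rw [ENNReal.tsum_add]
  refine add_le_add (hg.childSum_W y) (le_of_eq (tsum_congr fun z => ?_))
  rw [Real.rpow_one, mul_comm, List.length_append, List.length_singleton,
    show y.length + 1 + m = y.length + (m + 1) by omega]

theorem GoodEnv.domWeight_nil_ne_top {α : ℕ → ℝ} {g : List ℕ → ℕ → ℝ} (hg : GoodEnv α g) (m : ℕ) :
    domWeight α g m [] ≠ ∞ :=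
  ENNReal.add_ne_top.2 ⟨hg.W_ne_top _, hg.descSum_ne_top _⟩

theorem GoodEnv.one_le_domWeight {α : ℕ → ℝ} {g : List ℕ → ℕ → ℝ} (hg : GoodEnv α g)
    (y : List ℕ) : 1 ≤ domWeight α g 0 y := by
  rw [domWeight, add_zero, descSum_self 1 hg.pos]
  exact le_add_self

/-- The path `X` spends an infinite time at the node `0⋯0` of depth `k`, and the integrals along it
of the dominating weights over bounded intervals are finite. -/
structure RegularPath (α : ℕ → ℝ) (g : List ℕ → ℕ → ℝ) (k : ℕ) (X : ℝ≥0∞ → List ℕ∞) : Prop where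
  occInt_ne_top : ∀ m j : ℕ, occInt (domWeight α g m) X 0 j ≠ ∞
  recurrent : ∫⁻ r in Set.Ioi (0 : ℝ),
    extendNode (nodeInd (List.replicate k 0)) (X (ENNReal.ofReal r)) = ∞

theorem GoodEnv.regularPath_zero {α : ℕ → ℝ} {g : List ℕ → ℕ → ℝ} (hg : GoodEnv α g) :
    RegularPath α g 0 fun _ => [] := by
  refine ⟨fun m j => ?_, ?_⟩
  · have h1 : ∀ F : List ℕ → ℝ≥0∞, extendNode F [] = F [] := fun F => extendNode_map F []
    have h2 : occInt (domWeight α g m) (fun _ => []) 0 j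
        ≤ ∫⁻ r in Set.Ioi (0 : ℝ), (Set.Iic (j : ℝ)).indicator (fun _ => domWeight α g m []) r := by
      refine lintegral_mono fun r => ?_
      by_cases hr : 0 < ENNReal.ofReal r ∧ ENNReal.ofReal r ≤ j
      · have : r ≤ j := by
          have := ENNReal.toReal_mono (by simp) hr.2
          rwa [ENNReal.toReal_ofReal (ENNReal.ofReal_pos.1 hr.1).le, ENNReal.toReal_natCast] at this
        rw [if_pos hr, h1, Set.indicator_of_mem (by exact this)]
      · rw [if_neg hr]; exact zero_le
    refine ne_top_of_le_ne_top ?_ h2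
    rw [lintegral_indicator measurableSet_Iic, Measure.restrict_restrict measurableSet_Iic,
      setLIntegral_const, Set.inter_comm, Set.Ioi_inter_Iic, Real.volume_Ioc]
    exact ENNReal.mul_ne_top (hg.domWeight_nil_ne_top m) ENNReal.ofReal_ne_top
  · have : ∀ r : ℝ, extendNode (nodeInd (List.replicate 0 0)) [] = 1 := fun _ => by
      rw [extendNode_nodeInd]; simp
    simp [extendNode_nodeInd]

/-- Keep only label 0 at times spent at 0⋯0: there the jumps are at least a fixed positive multiple
of the holding variables. The weight `w` is left general to serve both the clock and the occupation
time of the next node. -/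
theorem tsum_clockJump_eq_top {g : List ℕ → ℕ → ℝ} {s τ : ℕ → ℕ → ℝ} {X : ℝ≥0∞ → List ℕ∞}
    {k : ℕ} (hg : ∀ y z, 0 < g y z) {w : List ℕ → ℕ → ℝ≥0∞}
    (hw : ∀ y x, nodeInd (List.replicate (k + 1) 0) (y ++ [x]) * ENNReal.ofReal (g y x) ≤ w y x)
    (h : ∑' i, {r : ℝ | X (ENNReal.ofReal r) = (List.replicate k 0).map
      (fun n : ℕ => (n : ℕ∞))}.indicator 1 (s 0 i) * ENNReal.ofReal (τ 0 i) = ∞) :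
    ∑' x, ∑' i, clockJump s τ w X x i = ∞ := by
  set c := ENNReal.ofReal (g (List.replicate k 0) 0) with hc
  have hc0 : c ≠ 0 := (ENNReal.ofReal_pos.2 (hg _ _)).ne'
  refine top_le_iff.1 (le_trans (le_of_eq ?_) (ENNReal.le_tsum 0))
  have h1 : (∞ : ℝ≥0∞) = c * ∑' i, {r : ℝ | X (ENNReal.ofReal r) = (List.replicate k 0).map
      (fun n : ℕ => (n : ℕ∞))}.indicator 1 (s 0 i) * ENNReal.ofReal (τ 0 i) := by
    rw [h, ENNReal.mul_top hc0]
  refine le_antisymm ?_ le_top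
  rw [h1, ← ENNReal.tsum_mul_left]
  refine ENNReal.tsum_le_tsum fun i => ?_
  rw [← mul_assoc]
  refine mul_le_mul_left ?_ _
  by_cases hX : X (ENNReal.ofReal (s 0 i)) = (List.replicate k 0).map (fun n : ℕ => (n : ℕ∞))
  · rw [hX, extendNode_map]
    refine le_trans ?_ (hw _ _)
    rw [nodeInd, if_pos (by rw [List.replicate_succ']), one_mul,
      Set.indicator_of_mem (by exact hX), Pi.one_apply, mul_one]
  · rw [Set.indicator_of_notMem (by exact hX), mul_zero]; exact zero_le

/-- One level of the construction preserves regularity of paths. -/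
theorem GoodEnv.regularPath_nextState {α : ℕ → ℝ} {g : List ℕ → ℕ → ℝ} (hg : GoodEnv α g)
    {s τ : ℕ → ℕ → ℝ} (hs : GoodMarks s) {X : ℝ≥0∞ → List ℕ∞} {k : ℕ}
    (h1 : ∀ m j : ℕ, clockInc s τ (fun y x => domWeight α g m (y ++ [x]) * ENNReal.ofReal (g y x))
      X 0 j ≠ ∞)
    (h2 : ∑' i, {r : ℝ | X (ENNReal.ofReal r) = (List.replicate k 0).map
      (fun n : ℕ => (n : ℕ∞))}.indicator 1 (s 0 i) * ENNReal.ofReal (τ 0 i) = ∞) :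
    RegularPath α g (k + 1)
      (nextState s (clockOf s τ (fun y x => ENNReal.ofReal (g y x)) X) X) := by
  -- The dominating weight is at least 1, so it controls the unadjusted clock.
  have hfin : ∀ u : ℝ≥0∞, u ≠ ∞ → clockOf s τ (fun y x => ENNReal.ofReal (g y x)) X u ≠ ∞ := by
    intro u hu
    obtain ⟨j, hj⟩ := ENNReal.exists_nat_gt hu
    rw [clockOf_eq_add_clockInc (zero_le (a := u)), hs.clockOf_zero, zero_add]
    refine ne_top_of_le_ne_top (h1 0 j) (clockInc_mono (fun y x => ?_) X 0 hj.le)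
    exact le_mul_of_one_le_left' (hg.one_le_domWeight _)
  refine ⟨fun m j => ?_, ?_⟩
  -- As the clock is unbounded on finite times, (0, j] lies below its value at some integer `i`, and
  -- the time change applies.
  · obtain ⟨u, hu, hju⟩ := exists_lt_clockOf (tsum_clockJump_eq_top hg.pos
      (w := fun y x => ENNReal.ofReal (g y x)) (fun y x => by
        refine mul_le_of_le_one_left' ?_
        rw [nodeInd]; split_ifs <;> simp) h2) (ENNReal.natCast_ne_top j)
    obtain ⟨i, hi⟩ := ENNReal.exists_nat_gt hu
    have h3 := hs.occInt_nextState_le (τ := τ) (w := fun y x => ENNReal.ofReal (g y x)) (X := X)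
      (domWeight α g m) 0 i
    rw [hs.clockOf_zero] at h3
    exact ne_top_of_le_ne_top (h1 m i) ((occInt_mono_right _ _ _
      (hju.le.trans (clockOf_mono _ _ _ _ hi.le))).trans h3)
  · rw [hs.lintegral_nextState _ hfin]
    exact tsum_clockJump_eq_top hg.pos (fun y x => le_rfl) h2

theorem measurable_occInt (F : List ℕ → ℝ≥0∞) {Z : Type*} [MeasurableSpace Z]
    {X : Z → ℝ≥0∞ → List ℕ∞} (hX : Measurable fun q : Z × ℝ≥0∞ => X q.1 q.2) {a b : Z → ℝ≥0∞}
    (ha : Measurable a) (hb : Measurable b) : Measurable fun z => occInt F (X z) (a z) (b z) := by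
  unfold occInt
  refine Measurable.lintegral_prod_right' (f := fun q : Z × ℝ => if a q.1 < ENNReal.ofReal q.2 ∧
    ENNReal.ofReal q.2 ≤ b q.1 then extendNode F (X q.1 (ENNReal.ofReal q.2)) else 0) ?_
  have hm : Measurable fun q : Z × ℝ => ENNReal.ofReal q.2 := by fun_prop
  have h1 : MeasurableSet {q : Z × ℝ | a q.1 < ENNReal.ofReal q.2} :=
    measurableSet_lt (ha.comp measurable_fst) hm
  have h2 : MeasurableSet {q : Z × ℝ | ENNReal.ofReal q.2 ≤ b q.1} :=
    measurableSet_le hm (hb.comp measurable_fst)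
  exact Measurable.ite (h1.inter h2)
    ((measurable_extendNode_const F).comp (hX.comp (measurable_fst.prodMk hm))) measurable_const

theorem measurableSet_regularPath (α : ℕ → ℝ) (g : List ℕ → ℕ → ℝ) (k : ℕ) :
    MeasurableSet {d : Dyn | RegularPath α g k (kState g d.2 d.1 k)} := by
  have hX := measurable_kState_dyn g k
  have h1 : MeasurableSet {d : Dyn | ∀ m j : ℕ,
      occInt (domWeight α g m) (kState g d.2 d.1 k) 0 j ≠ ∞} := by
    simp only [Set.ofPred_forall]
    refine MeasurableSet.iInter fun m => MeasurableSet.iInter fun j => ?_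
    have hm : Measurable fun d : Dyn => occInt (domWeight α g m) (kState g d.2 d.1 k) 0 j :=
      measurable_occInt _ hX measurable_const measurable_const
    exact (hm (measurableSet_singleton ∞)).compl
  have h2 : MeasurableSet {d : Dyn | ∫⁻ r in Set.Ioi (0 : ℝ),
      extendNode (nodeInd (List.replicate k 0)) (kState g d.2 d.1 k (ENNReal.ofReal r)) = ∞} := by
    have hm : Measurable fun q : Dyn × ℝ => ENNReal.ofReal q.2 := by fun_prop
    have hm2 : Measurable fun d : Dyn => ∫⁻ r in Set.Ioi (0 : ℝ),
        extendNode (nodeInd (List.replicate k 0)) (kState g d.2 d.1 k (ENNReal.ofReal r)) :=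
      Measurable.lintegral_prod_right' (f := fun q : Dyn × ℝ =>
        extendNode (nodeInd (List.replicate k 0)) (kState g q.1.2 q.1.1 k (ENNReal.ofReal q.2)))
        ((measurable_extendNode_const _).comp (hX.comp (measurable_fst.prodMk hm)))
    exact hm2 (measurableSet_singleton ∞)
  convert h1.inter h2 using 1
  ext d
  exact ⟨fun h => ⟨h.1, h.2⟩, fun h => ⟨h.1, h.2⟩⟩

theorem kState_resample (g : List ℕ → ℕ → ℝ) {S : Set ℕ} {k : ℕ} (hS : ∀ j < k, j ∉ S)
    (d d' : Dyn) : kState g (resampleDyn S d d').2 (resampleDyn S d d').1 k = kState g d.2 d.1 k :=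
  kState_congr g fun j hj => resampleDyn_of_notMem (hS j hj) d d'

theorem clockComp_resample (g : List ℕ → ℕ → ℝ) {S : Set ℕ} {k m : ℕ} (hS : ∀ j < k + m, j ∉ S)
    (d d' : Dyn) : clockComp g (resampleDyn S d d').2 (resampleDyn S d d').1 k m
      = clockComp g d.2 d.1 k m :=
  clockComp_congr g fun j hj => resampleDyn_of_notMem (hS j hj) d d'

theorem kState_succ_eq_nextState (g : List ℕ → ℕ → ℝ) (d : Dyn) (k : ℕ) :
    kState g d.2 d.1 (k + 1) = nextState (d.2 k)
      (clockOf (d.2 k) (d.1 k) (fun y x => ENNReal.ofReal (g y x)) (kState g d.2 d.1 k))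
      (kState g d.2 d.1 k) := rfl

section Law

variable {ν : Measure Dyn}

/-- Induction with the levels below `k` frozen and level `k` fresh: the mean increments are bounded
by the next dominating weight, and the infinite time at 0⋯0 receives infinitely many marks. -/
theorem DynLaw.ae_regularPath (hν : DynLaw ν) {α : ℕ → ℝ} {g : List ℕ → ℕ → ℝ} (hg : GoodEnv α g)
    (k : ℕ) : ∀ᵐ d ∂ν, RegularPath α g k (kState g d.2 d.1 k) := by
  induction k with
  | zero => exact Eventually.of_forall fun d => hg.regularPath_zero
  | succ k ih =>
    refine hν.ae_of_resample {k} (measurableSet_regularPath α g (k + 1)) ?_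
    filter_upwards [ih] with d hd
    have hX := measurable_kState_time g d k
    have hB : MeasurableSet {r : ℝ | kState g d.2 d.1 k (ENNReal.ofReal r)
        = (List.replicate k 0).map (fun n : ℕ => (n : ℕ∞))} :=
      (hX.comp ENNReal.measurable_ofReal) (MeasurableSet.of_discrete (s := {_}))
    have hBv : volume ({r : ℝ | kState g d.2 d.1 k (ENNReal.ofReal r)
        = (List.replicate k 0).map (fun n : ℕ => (n : ℕ∞))} ∩ Set.Ioi 0) = ∞ := by
      rw [← hd.recurrent, ← Measure.restrict_apply hB, ← lintegral_indicator_one hB]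
      refine lintegral_congr fun r => ?_
      rw [extendNode_nodeInd, Set.indicator_apply]
      simp only [Set.mem_ofPred_eq, Pi.one_apply]
    have h1 : ∀ᵐ d' : Dyn ∂ν, ∀ m j : ℕ, clockInc (d'.2 k) (d'.1 k)
        (fun y x => domWeight α g m (y ++ [x]) * ENNReal.ofReal (g y x))
        (kState g d.2 d.1 k) 0 j ≠ ∞ := by
      refine ae_all_iff.2 fun m => ae_all_iff.2 fun j => ?_
      have hm : Measurable fun d' : Dyn => clockInc (d'.2 k) (d'.1 k)
          (fun y x => domWeight α g m (y ++ [x]) * ENNReal.ofReal (g y x))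
          (kState g d.2 d.1 k) 0 j :=
        measurable_clockInc (fun x i => measurable_dyn_mark _ x i)
          (fun x i => measurable_dyn_hold _ x i) _ (X := fun _ => kState g d.2 d.1 k)
          (hX.comp measurable_snd) measurable_const measurable_const
      have h2 : ∫⁻ d' : Dyn, clockInc (d'.2 k) (d'.1 k)
          (fun y x => domWeight α g m (y ++ [x]) * ENNReal.ofReal (g y x))
          (kState g d.2 d.1 k) 0 j ∂ν ≠ ∞ := by
        rw [hν.lintegral_clockInc k _ hX]
        exact ne_top_of_le_ne_top (hd.occInt_ne_top (m + 1) j)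
          (occInt_mono_fun (hg.childSum_domWeight_le m) _ _ _)
      filter_upwards [ae_lt_top hm h2] with d' hd' using hd'.ne
    filter_upwards [h1, hν.ae_infinite k 0 _ hB hBv, hν.ae_goodMarks] with d' h2 h3 h4
    obtain ⟨e1, e2⟩ := resampleDyn_of_mem (Set.mem_singleton k) d d'
    rw [kState_succ_eq_nextState, kState_resample g (fun j hj => by
      simp only [Set.mem_singleton_iff]; omega), e1, e2]
    exact hg.regularPath_nextState (h4 k) h2 h3

/-- The integrals of `W` along the processes over bounded intervals are finite. -/
theorem DynLaw.ae_occInt_W_ne_top (hν : DynLaw ν) {α : ℕ → ℝ} {g : List ℕ → ℕ → ℝ}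
    (hg : GoodEnv α g) (k : ℕ) :
    ∀ᵐ d ∂ν, ∀ b : ℝ≥0, occInt (W α g) (kState g d.2 d.1 k) 0 b ≠ ∞ := by
  filter_upwards [hν.ae_regularPath hg k] with d hd b
  obtain ⟨j, hj⟩ := exists_nat_ge b
  refine ne_top_of_le_ne_top (hd.occInt_ne_top 0 j) ((occInt_mono_fun (fun y => ?_) _ _ _).trans
    (occInt_mono_right _ _ _ (by exact_mod_cast hj)))
  exact le_self_add

end Law

section Law

variable {ν : Measure Dyn} {α : ℕ → ℝ} {g : List ℕ → ℕ → ℝ}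

/-! ### The supermartingale property of the adjusted clocks -/

/-- The supermartingale step. Averaging over the fresh level gives the integral of `childSum g (W α
g)` along the path; this is at most that of `W`, which the time change bounds by the previous
increment. -/
theorem DynLaw.lintegral_adjInc_succ_le (hν : DynLaw ν) (hg : GoodEnv α g) {d : Dyn}
    (hd : ∀ n, GoodMarks (d.2 n)) (k m : ℕ) (a b : ℝ≥0∞) :
    ∫⁻ d', adjInc α g (resampleDyn {k + m + 1} d d') k (m + 1) a b ∂ν ≤ adjInc α g d k m a b := by
  have hS : ∀ j < k + (m + 1), j ∉ ({k + m + 1} : Set ℕ) := fun j hj => by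
    simp only [Set.mem_singleton_iff]; omega
  have h1 : ∀ d', adjInc α g (resampleDyn {k + m + 1} d d') k (m + 1) a b
      = clockInc (d'.2 (k + m + 1)) (d'.1 (k + m + 1))
        (fun y x => W α g (y ++ [x]) * ENNReal.ofReal (g y x)) (kState g d.2 d.1 (k + m + 1))
        (clockComp g d.2 d.1 k (m + 1) a) (clockComp g d.2 d.1 k (m + 1) b) := by
    intro d'
    obtain ⟨e1, e2⟩ := resampleDyn_of_mem (Set.mem_singleton (k + m + 1)) d d'
    rw [adjInc, kState_resample g hS, clockComp_resample g hS]
    change clockInc ((resampleDyn {k + m + 1} d d').2 (k + m + 1))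
      ((resampleDyn {k + m + 1} d d').1 (k + m + 1)) _ _ _ _ = _
    rw [e1, e2]
    rfl
  simp_rw [h1]
  rw [hν.lintegral_clockInc _ _ (measurable_kState_time g d _)]
  refine (occInt_mono_fun hg.childSum_W _ _ _).trans ?_
  exact (hd (k + m)).occInt_nextState_le (W α g) _ _

/-- This allows one level to be averaged inside the conditioning on the levels below `k`. -/
theorem resampleDyn_Ici_singleton {k n : ℕ} (h : k ≤ n) (d d' d'' : Dyn) :
    resampleDyn (Set.Ici k) d (resampleDyn {n} d' d'')
      = resampleDyn {n} (resampleDyn (Set.Ici k) d d') d'' := by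
  have key : ∀ j, (resampleDyn (Set.Ici k) d (resampleDyn {n} d' d'')).1 j
        = (resampleDyn {n} (resampleDyn (Set.Ici k) d d') d'').1 j ∧
      (resampleDyn (Set.Ici k) d (resampleDyn {n} d' d'')).2 j
        = (resampleDyn {n} (resampleDyn (Set.Ici k) d d') d'').2 j := by
    intro j
    by_cases hjn : j = n
    · subst hjn
      rw [(resampleDyn_of_mem (Set.mem_Ici.2 h) _ _).1, (resampleDyn_of_mem (Set.mem_Ici.2 h) _ _).2,
        (resampleDyn_of_mem (Set.mem_singleton j) _ _).1,
        (resampleDyn_of_mem (Set.mem_singleton j) _ _).2,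
        (resampleDyn_of_mem (Set.mem_singleton j) _ _).1,
        (resampleDyn_of_mem (Set.mem_singleton j) _ _).2]
      exact ⟨rfl, rfl⟩
    · have h2 : j ∉ ({n} : Set ℕ) := hjn
      rw [(resampleDyn_of_notMem h2 (resampleDyn (Set.Ici k) d d') d'').1,
        (resampleDyn_of_notMem h2 (resampleDyn (Set.Ici k) d d') d'').2]
      by_cases hjk : j ∈ Set.Ici k
      · rw [(resampleDyn_of_mem hjk _ _).1, (resampleDyn_of_mem hjk _ _).2,
          (resampleDyn_of_mem hjk _ _).1, (resampleDyn_of_mem hjk _ _).2,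
          (resampleDyn_of_notMem h2 _ _).1, (resampleDyn_of_notMem h2 _ _).2]
        exact ⟨rfl, rfl⟩
      · rw [(resampleDyn_of_notMem hjk _ _).1, (resampleDyn_of_notMem hjk _ _).2,
          (resampleDyn_of_notMem hjk _ _).1, (resampleDyn_of_notMem hjk _ _).2]
        exact ⟨rfl, rfl⟩
  exact Prod.ext (funext fun j => (key j).1) (funext fun j => (key j).2)

/-- The supermartingale step is iterated down to level `k`, whose driving path is frozen. -/
theorem DynLaw.lintegral_adjInc_le (hν : DynLaw ν) (hg : GoodEnv α g) {k : ℕ} {d : Dyn}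
    (hd : ∀ᵐ d' ∂ν, ∀ n, GoodMarks ((resampleDyn (Set.Ici k) d d').2 n)) (m : ℕ) (a b : ℝ≥0∞) :
    ∫⁻ d', adjInc α g (resampleDyn (Set.Ici k) d d') k m a b ∂ν
      ≤ occInt (W α g) (kState g d.2 d.1 k) a b := by
  have hS : ∀ j < k, j ∉ Set.Ici k := fun j hj => by simpa using hj
  have hR : Measurable fun d' => resampleDyn (Set.Ici k) d d' :=
    (measurable_resampleDyn _).comp (measurable_const.prodMk measurable_id)
  induction m with
  | zero =>
    have h1 : ∀ d', adjInc α g (resampleDyn (Set.Ici k) d d') k 0 a b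
        = clockInc (d'.2 k) (d'.1 k)
          (fun y x => W α g (y ++ [x]) * ENNReal.ofReal (g y x)) (kState g d.2 d.1 k) a b := by
      intro d'
      obtain ⟨e1, e2⟩ := resampleDyn_of_mem (Set.mem_Ici.2 (le_refl k)) d d'
      rw [adjInc, add_zero, kState_resample g hS, e1, e2]
      rfl
    simp_rw [h1]
    rw [hν.lintegral_clockInc _ _ (measurable_kState_time g d _)]
    exact occInt_mono_fun hg.childSum_W _ _ _
  | succ m ih =>
    have hf : Measurable fun d' : Dyn =>
        adjInc α g (resampleDyn (Set.Ici k) d d') k (m + 1) a b :=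
      (measurable_adjInc α g k (m + 1) a b).comp hR
    rw [← hν.lintegral_resample {k + m + 1} hf]
    refine le_trans (lintegral_mono_ae ?_) ih
    filter_upwards [hd] with d' hd'
    simp_rw [resampleDyn_Ici_singleton (show k ≤ k + m + 1 by omega)]
    exact hν.lintegral_adjInc_succ_le hg hd' k m a b

/-! ### Convergence of the adjusted clocks -/

theorem DynLaw.ae_exists_tendsto_adjClockComp (hν : DynLaw ν) (hg : GoodEnv α g) (k : ℕ)
    (t : ℝ≥0∞) :
    ∀ᵐ d : Dyn ∂ν, ∃ c, Tendsto (fun m => adjClockComp α g d.2 d.1 k m t) atTop (𝓝 c) := by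
  have := hν.isProb
  refine ae_exists_tendsto_of_resample (M := fun n => resampleDyn {k + n + 1})
    (fun n => measurable_resampleDyn _) (fun n => hν.map_resample _)
    (fun n => measurable_adjClockComp_dyn α g k n t) (fun n m hmn z w => ?_) fun n => ?_
  · refine congrFun (adjClockComp_congr α g fun j hj => resampleDyn_of_notMem ?_ z w) t
    simp only [Set.mem_singleton_iff]
    omega
  · filter_upwards [hν.ae_goodMarks, hν.ae_resample {k + n + 1} hν.ae_goodMarks] with d hd hd'
    have hR : Measurable fun d' => resampleDyn {k + n + 1} d d' :=
      (measurable_resampleDyn _).comp (measurable_const.prodMk measurable_id)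
    -- Jensen turns the supermartingale inequality into the submartingale inequality for the
    -- transforms.
    refine le_trans ?_ (lap_lintegral_le ν ((measurable_adjClockComp_dyn α g k (n + 1) t).comp hR))
    refine lap_antitone ?_
    rw [adjClockComp_eq_adjInc hd]
    refine le_trans (le_of_eq (lintegral_congr_ae ?_))
      (hν.lintegral_adjInc_succ_le hg hd k n 0 t)
    filter_upwards [hd'] with d' hd'
    exact adjClockComp_eq_adjInc hd' _ _ _

/-- The limit of the adjusted clocks at time `t`, wherever it exists. -/
def limClock (α : ℕ → ℝ) (g : List ℕ → ℕ → ℝ) (d : Dyn) (k : ℕ) (t : ℝ≥0) : ℝ≥0∞ :=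
  limsup (fun m => adjClockComp α g d.2 d.1 k m t) atTop

theorem limClock_mono (α : ℕ → ℝ) (g : List ℕ → ℕ → ℝ) (d : Dyn) (k : ℕ) :
    Monotone (limClock α g d k) := fun a b hab =>
  limsup_le_limsup (Eventually.of_forall fun m =>
    adjClockComp_mono α g d k m (by exact_mod_cast hab))

theorem measurable_limClock (α : ℕ → ℝ) (k : ℕ) (t : ℝ≥0) :
    Measurable fun q : (List ℕ → ℕ → ℝ) × Dyn => limClock α q.1 q.2 k t :=
  Measurable.limsup fun m => (measurable_adjClockComp α k m).comp
    (g := fun q : ((List ℕ → ℕ → ℝ) × Dyn) × ℝ≥0∞ =>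
      adjClockComp α q.1.1 q.1.2.2 q.1.2.1 k m q.2)
    (f := fun q : (List ℕ → ℕ → ℝ) × Dyn => (q, (t : ℝ≥0∞)))
    (measurable_id.prodMk measurable_const)

theorem measurable_limClock_dyn (α : ℕ → ℝ) (g : List ℕ → ℕ → ℝ) (k : ℕ) (t : ℝ≥0) :
    Measurable fun d : Dyn => limClock α g d k t :=
  (measurable_limClock α k t).comp (g := fun q : (List ℕ → ℕ → ℝ) × Dyn => limClock α q.1 q.2 k t)
    (f := fun d : Dyn => (g, d)) (measurable_const.prodMk measurable_id)

theorem DynLaw.ae_tendsto_limClock (hν : DynLaw ν) (hg : GoodEnv α g) (k : ℕ) (t : ℝ≥0) :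
    ∀ᵐ d : Dyn ∂ν, Tendsto (fun m => adjClockComp α g d.2 d.1 k m t) atTop
      (𝓝 (limClock α g d k t)) := by
  filter_upwards [hν.ae_exists_tendsto_adjClockComp hg k t] with d ⟨c, hc⟩
  rw [limClock, hc.limsup_eq]
  exact hc

theorem DynLaw.lintegral_limClock_le (hν : DynLaw ν) (hg : GoodEnv α g) (k : ℕ) (t : ℝ≥0) :
    ∀ᵐ d ∂ν, ∫⁻ d', limClock α g (resampleDyn (Set.Ici k) d d') k t ∂ν
      ≤ occInt (W α g) (kState g d.2 d.1 k) 0 t := by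
  filter_upwards [hν.ae_resample (Set.Ici k) hν.ae_goodMarks,
    hν.ae_resample (Set.Ici k) (hν.ae_tendsto_limClock hg k t)] with d h1 h2
  have hR : Measurable fun d' => resampleDyn (Set.Ici k) d d' :=
    (measurable_resampleDyn _).comp (measurable_const.prodMk measurable_id)
  calc ∫⁻ d', limClock α g (resampleDyn (Set.Ici k) d d') k t ∂ν
      = ∫⁻ d', liminf (fun m => adjInc α g (resampleDyn (Set.Ici k) d d') k m 0 t) atTop ∂ν := by
        refine lintegral_congr_ae ?_
        filter_upwards [h1, h2] with d' h3 h4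
        simp_rw [← adjClockComp_eq_adjInc h3]
        exact h4.liminf_eq.symm
    _ ≤ liminf (fun m => ∫⁻ d', adjInc α g (resampleDyn (Set.Ici k) d d') k m 0 t ∂ν) atTop :=
        lintegral_liminf_le fun m => (measurable_adjInc α g k m 0 t).comp hR
    _ ≤ occInt (W α g) (kState g d.2 d.1 k) 0 t :=
        liminf_le_of_le (by isBoundedDefault) fun c hc => by
          obtain ⟨m, hm⟩ := hc.exists
          exact hm.trans (hν.lintegral_adjInc_le hg h1 m 0 t)

theorem DynLaw.ae_limClock_ne_top (hν : DynLaw ν) (hg : GoodEnv α g) (k : ℕ) (t : ℝ≥0) :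
    ∀ᵐ d ∂ν, limClock α g d k t ≠ ∞ := by
  have hm := measurable_limClock_dyn α g k t
  refine hν.ae_of_resample (Set.Ici k) (hm (measurableSet_singleton ∞)).compl ?_
  filter_upwards [hν.lintegral_limClock_le hg k t, hν.ae_occInt_W_ne_top hg k] with d h1 h2
  have hR : Measurable fun d' => resampleDyn (Set.Ici k) d d' :=
    (measurable_resampleDyn _).comp (measurable_const.prodMk measurable_id)
  filter_upwards [ae_lt_top (hm.comp hR) (ne_top_of_le_ne_top (h2 t) h1)] with d' hd' using hd'.ne

theorem DynLaw.lintegral_limClock_sub_le (hν : DynLaw ν) (hg : GoodEnv α g) (k : ℕ) {a b : ℝ≥0}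
    (hab : a ≤ b) : ∀ᵐ d ∂ν, ∫⁻ d', (limClock α g (resampleDyn (Set.Ici k) d d') k b
        - limClock α g (resampleDyn (Set.Ici k) d d') k a) ∂ν
      ≤ occInt (W α g) (kState g d.2 d.1 k) a b := by
  filter_upwards [hν.ae_resample (Set.Ici k) hν.ae_goodMarks,
    hν.ae_resample (Set.Ici k) (hν.ae_tendsto_limClock hg k a),
    hν.ae_resample (Set.Ici k) (hν.ae_tendsto_limClock hg k b),
    hν.ae_resample (Set.Ici k) (hν.ae_limClock_ne_top hg k a)] with d h1 h2 h3 h4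
  have hR : Measurable fun d' => resampleDyn (Set.Ici k) d d' :=
    (measurable_resampleDyn _).comp (measurable_const.prodMk measurable_id)
  calc ∫⁻ d', (limClock α g (resampleDyn (Set.Ici k) d d') k b
        - limClock α g (resampleDyn (Set.Ici k) d d') k a) ∂ν
      ≤ ∫⁻ d', liminf (fun m => adjInc α g (resampleDyn (Set.Ici k) d d') k m a b) atTop ∂ν := by
        refine lintegral_mono_ae ?_
        filter_upwards [h2, h3, h4] with d' h5 h6 h7
        -- Subtraction on [0, ∞] is continuous here because the limit at `a` is finite; then Fatou
        -- applies to the increments.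
        rw [← (ENNReal.Tendsto.sub h6 h5 (Or.inr h7)).liminf_eq]
        refine liminf_le_liminf (Eventually.of_forall fun m => ?_)
        rw [tsub_le_iff_left]
        exact (adjClockComp_eq_add_adjInc α g _ k m (by exact_mod_cast hab)).le
    _ ≤ liminf (fun m => ∫⁻ d', adjInc α g (resampleDyn (Set.Ici k) d d') k m a b ∂ν) atTop :=
        lintegral_liminf_le fun m => (measurable_adjInc α g k m a b).comp hR
    _ ≤ occInt (W α g) (kState g d.2 d.1 k) a b :=
        liminf_le_of_le (by isBoundedDefault) fun c hc => by
          obtain ⟨m, hm⟩ := hc.exists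
          exact hm.trans (hν.lintegral_adjInc_le hg h1 m a b)

end Law

/-! ### Measures on the line -/

/-- `ρ` is the Stieltjes measure of its distribution function, and the outer measure behind it is
the largest one bounded by the interval lengths. Hence `μ` lies below it, even on nonmeasurable
sets. -/
theorem measure_le_of_Ioc {μ ρ : Measure ℝ} (hfin : ∀ x, ρ (Set.Iic x) ≠ ∞)
    (h : ∀ a b, a < b → μ (Set.Ioc a b) ≤ ρ (Set.Ioc a b)) (s : Set ℝ) : μ s ≤ ρ s := by
  have hmono : Monotone fun x => (ρ (Set.Iic x)).toReal := fun a b hab =>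
    ENNReal.toReal_mono (hfin b) (measure_mono (Set.Iic_subset_Iic.2 hab))
  have hcont : ∀ x, ContinuousWithinAt (fun x => (ρ (Set.Iic x)).toReal) (Set.Ici x) x := by
    intro x
    rw [← continuousWithinAt_Ioi_iff_Ici]
    have h1 := tendsto_measure_biInter_gt (μ := ρ) (s := fun r : ℝ => Set.Iic r) (a := x)
      (fun r _ => measurableSet_Iic.nullMeasurableSet) (fun i j _ hij => Set.Iic_subset_Iic.2 hij)
      ⟨x + 1, by simp, hfin _⟩
    have h2 : ⋂ r > x, Set.Iic r = Set.Iic x := by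
      ext y
      simp only [Set.mem_iInter, Set.mem_Iic]
      exact ⟨fun hy => le_of_forall_gt_imp_ge_of_dense hy, fun hy r hr => hy.trans hr.le⟩
    rw [h2] at h1
    exact (ENNReal.tendsto_toReal (hfin x)).comp h1
  let G : StieltjesFunction ℝ := ⟨fun x => (ρ (Set.Iic x)).toReal, hmono, hcont⟩
  have hG : ∀ a b, a < b → G.measure (Set.Ioc a b) = ρ (Set.Ioc a b) := by
    intro a b hab
    rw [G.measure_Ioc, ← Set.Iic_sdiff_Iic, measure_sdiff (Set.Iic_subset_Iic.2 hab.le)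
      measurableSet_Iic.nullMeasurableSet (hfin a)]
    change ENNReal.ofReal ((ρ (Set.Iic b)).toReal - (ρ (Set.Iic a)).toReal) = _
    rw [ENNReal.ofReal_sub _ ENNReal.toReal_nonneg, ENNReal.ofReal_toReal (hfin b),
      ENNReal.ofReal_toReal (hfin a)]
  rw [← Measure.ext_of_Ioc G.measure ρ hG]
  have h3 : μ.toOuterMeasure ≤ G.outer := by
    refine OuterMeasure.le_ofFunction.2 fun s => ?_
    rw [G.length_eq]
    refine le_iInf fun a => le_iInf fun b => le_iInf fun hs => ?_
    have hs' : s ⊆ Set.Ioc a b := by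
      have h0 : botSet (R := ℝ) = ∅ := by
        ext x
        simp [botSet]
      simpa [h0] using hs
    rcases lt_or_ge a b with hab | hab
    · rw [← G.measure_Ioc, hG a b hab]
      exact (measure_mono hs').trans (h a b hab)
    · rw [Set.Ioc_eq_empty (not_lt.2 hab)] at hs'
      rw [Set.subset_empty_iff.1 hs']
      simp
  rw [StieltjesFunction.measure_def]
  exact h3 s

/-- Countably many of the half-lines below points of `S` cover all of `S` except possibly its
maximum, which is null; they are nested, so the bound survives their union. -/
theorem measure_le_of_Iic {μ : Measure ℝ} [NullSingletonClass μ] {S : Set ℝ} {t : ℝ≥0∞}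
    (h : ∀ s ∈ S, μ (Set.Iic s) ≤ t) : μ S ≤ t := by
  obtain ⟨T, hTS, hT, hU⟩ := TopologicalSpace.isOpen_biUnion_countable S (fun s : ℝ => Set.Iio s)
    fun s _ => isOpen_Iio
  have h1 : μ (⋃ s ∈ T, Set.Iio s) ≤ t := by
    rw [measure_biUnion_eq_iSup hT]
    · exact iSup₂_le fun s hs => (measure_mono Set.Iio_subset_Iic_self).trans (h s (hTS hs))
    · intro a ha b hb
      rcases le_total a b with hab | hab
      · exact ⟨b, hb, Set.Iio_subset_Iio hab, subset_rfl⟩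
      · exact ⟨a, ha, subset_rfl, Set.Iio_subset_Iio hab⟩
  have h2 : (S \ ⋃ s ∈ T, Set.Iio s).Subsingleton := by
    rw [hU]
    intro a ha b hb
    simp only [Set.mem_sdiff, Set.mem_iUnion, Set.mem_Iio, not_exists, not_lt] at ha hb
    exact le_antisymm (hb.2 a ha.1) (ha.2 b hb.1)
  calc μ S ≤ μ ((⋃ s ∈ T, Set.Iio s) ∪ (S \ ⋃ s ∈ T, Set.Iio s)) :=
        measure_mono (by rw [Set.union_sdiff_self]; exact Set.subset_union_right)
    _ ≤ μ (⋃ s ∈ T, Set.Iio s) + μ (S \ ⋃ s ∈ T, Set.Iio s) := measure_union_le _ _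
    _ ≤ t := by rw [h2.measure_zero, add_zero]; exact h1

/-! ### Right limits -/

/-- The right limit of a nondecreasing function. -/
def rightInf (L : ℝ≥0 → ℝ≥0∞) (t : ℝ≥0) : ℝ≥0∞ := ⨅ n : ℕ, L (t + 1 / (n + 1))

theorem rightInf_mono {L : ℝ≥0 → ℝ≥0∞} (hL : Monotone L) : Monotone (rightInf L) := fun _ _ hab =>
  iInf_mono fun _ => hL (add_le_add_left hab _)

theorem le_rightInf {L : ℝ≥0 → ℝ≥0∞} (hL : Monotone L) (t : ℝ≥0) : L t ≤ rightInf L t :=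
  le_iInf fun _ => hL le_self_add

theorem antitone_add_inv (t : ℝ≥0) : Antitone fun n : ℕ => t + 1 / ((n : ℝ≥0) + 1) := by
  intro m n hmn
  have : (m : ℝ≥0) ≤ n := by exact_mod_cast hmn
  dsimp only
  gcongr

theorem tendsto_add_inv (t : ℝ≥0) :
    Tendsto (fun n : ℕ => t + 1 / ((n : ℝ≥0) + 1)) atTop (𝓝 t) := by
  have h : Tendsto (fun n : ℕ => 1 / ((n : ℝ≥0) + 1)) atTop (𝓝 0) :=
    tendsto_one_div_add_atTop_nhds_zero_nat
  simpa using h.const_add t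

theorem tendsto_rightInf {L : ℝ≥0 → ℝ≥0∞} (hL : Monotone L) (t : ℝ≥0) :
    Tendsto (fun n : ℕ => L (t + 1 / (n + 1))) atTop (𝓝 (rightInf L t)) :=
  tendsto_atTop_iInf fun _ _ hmn => hL (antitone_add_inv t hmn)

theorem continuousWithinAt_rightInf {L : ℝ≥0 → ℝ≥0∞} (hL : Monotone L) (t : ℝ≥0) :
    ContinuousWithinAt (rightInf L) (Set.Ici t) t := by
  refine tendsto_order.2 ⟨fun c hc => ?_, fun c hc => ?_⟩
  · filter_upwards [self_mem_nhdsWithin] with u hu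
    exact hc.trans_le (rightInf_mono hL hu)
  · obtain ⟨n, hn⟩ := iInf_lt_iff.1 hc
    have h1 : t < t + 1 / ((n : ℝ≥0) + 1) := by
      have : (0 : ℝ≥0) < 1 / ((n : ℝ≥0) + 1) := by positivity
      exact lt_add_of_pos_right t this
    filter_upwards [mem_nhdsWithin_of_mem_nhds (Iio_mem_nhds h1)] with u hu
    obtain ⟨m, hm⟩ := ((tendsto_add_inv u).eventually (Iio_mem_nhds hu)).exists
    exact (iInf_le _ m).trans_lt ((hL (le_of_lt hm)).trans_lt hn)

theorem dense_compl_of_countable {S : Set ℝ≥0} (hS : S.Countable) : Dense Sᶜ := by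
  refine dense_of_exists_between fun a b hab => ?_
  have h1 : Dense (((fun x : ℝ≥0 => (x : ℝ)) '' S)ᶜ) := (hS.image _).dense_compl ℝ
  obtain ⟨c, hc, hac, hcb⟩ := h1.exists_between (NNReal.coe_lt_coe.2 hab)
  refine ⟨⟨c, a.2.trans hac.le⟩, fun hcS => hc ⟨_, hcS, rfl⟩, ?_, ?_⟩
  · exact_mod_cast hac
  · exact_mod_cast hcb

/-- A nondecreasing random function agrees almost surely with its right limit at all times of a
deterministic countable dense set. -/
theorem exists_dense_rightInf_eq {Z : Type*} [MeasurableSpace Z] (μ : Measure Z)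
    [IsProbabilityMeasure μ] {L : Z → ℝ≥0 → ℝ≥0∞} (hL : ∀ z, Monotone (L z))
    (hm : ∀ t, Measurable fun z => L z t) :
    ∃ D : Set ℝ≥0, D.Countable ∧ Dense D ∧ ∀ t ∈ D, ∀ᵐ z ∂μ, rightInf (L z) t = L z t := by
  -- The mean transform is monotone in time, hence continuous off a countable set. At a continuity
  -- point the transforms of `L` and of its right limit are ordered with equal means, so they agree
  -- almost surely.
  set φ : ℝ≥0 → ℝ≥0∞ := fun t => ∫⁻ z, lap (L z t) ∂μ with hφ
  have hanti : Antitone φ := fun a b hab => lintegral_mono fun z => lap_antitone (hL z hab)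
  have hc := hanti.countable_not_continuousAt
  obtain ⟨D, hDsub, hDc, hDd⟩ := (dense_compl_of_countable hc).exists_countable_dense_subset
  refine ⟨D, hDc, hDd, fun t ht => ?_⟩
  have hct : ContinuousAt φ t := by
    by_contra hcon
    exact hDsub ht hcon
  have h1 : Tendsto (fun n : ℕ => φ (t + 1 / (n + 1))) atTop (𝓝 (φ t)) :=
    hct.tendsto.comp (tendsto_add_inv t)
  have hmr : Measurable fun z => rightInf (L z) t := Measurable.iInf fun n => hm _
  have h2 : Tendsto (fun n : ℕ => φ (t + 1 / (n + 1))) atTop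
      (𝓝 (∫⁻ z, lap (rightInf (L z) t) ∂μ)) := by
    refine tendsto_lintegral_of_dominated_convergence (fun _ => 1)
      (fun n => measurable_lap.comp (hm _)) (fun n => Eventually.of_forall fun z => lap_le_one _)
      (by simp) (Eventually.of_forall fun z => ?_)
    exact (continuous_lap.tendsto _).comp (tendsto_rightInf (hL z) t)
  have h3 := tendsto_nhds_unique h2 h1
  have h4 : (fun z => lap (rightInf (L z) t)) =ᵐ[μ] fun z => lap (L z t) := by
    refine ae_eq_of_ae_le_of_lintegral_le
      (Eventually.of_forall fun z => lap_antitone (le_rightInf (hL z) t)) ?_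
      (measurable_lap.comp (hm t)).aemeasurable h3.ge
    refine ne_top_of_le_ne_top ENNReal.one_ne_top
      ((lintegral_mono fun z => lap_le_one _).trans ?_)
    simp
  filter_upwards [h4] with z hz using lap_strictAnti.injective hz

/-! ### The limit clock -/

open scoped Classical in
/-- The right-continuous modification of the limit of the adjusted clocks. -/
def limitClock (α : ℕ → ℝ) (g : List ℕ → ℕ → ℝ) (d : Dyn) (k : ℕ) (t : ℝ≥0) : ℝ≥0 :=
  -- The default 0 makes every path, not just almost every one, monotone and right-continuous. By
  -- monotonicity integer times suffice.
  if ∀ n : ℕ, limClock α g d k n ≠ ∞ then (rightInf (limClock α g d k) t).toNNReal else 0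

section LimitClock

variable {α : ℕ → ℝ} {g : List ℕ → ℕ → ℝ} {d : Dyn} {k : ℕ}

theorem rightInf_limClock_ne_top (h : ∀ n : ℕ, limClock α g d k n ≠ ∞) (t : ℝ≥0) :
    rightInf (limClock α g d k) t ≠ ∞ := by
  obtain ⟨n, hn⟩ := exists_nat_ge (t + 1)
  refine ne_top_of_le_ne_top (h n) ((iInf_le _ 0).trans (limClock_mono α g d k ?_))
  simpa using hn

theorem coe_limitClock (h : ∀ n : ℕ, limClock α g d k n ≠ ∞) (t : ℝ≥0) :
    (limitClock α g d k t : ℝ≥0∞) = rightInf (limClock α g d k) t := by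
  rw [limitClock, if_pos h, ENNReal.coe_toNNReal (rightInf_limClock_ne_top h t)]

theorem limitClock_mono (α : ℕ → ℝ) (g : List ℕ → ℕ → ℝ) (d : Dyn) (k : ℕ) :
    Monotone (limitClock α g d k) := by
  by_cases h : ∀ n : ℕ, limClock α g d k n ≠ ∞
  · intro a b hab
    have := rightInf_mono (limClock_mono α g d k) hab
    rw [← coe_limitClock h, ← coe_limitClock h] at this
    exact_mod_cast this
  · intro a b _
    rw [limitClock, limitClock, if_neg h, if_neg h]

theorem continuousWithinAt_limitClock (α : ℕ → ℝ) (g : List ℕ → ℕ → ℝ) (d : Dyn) (k : ℕ)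
    (t : ℝ≥0) : ContinuousWithinAt (limitClock α g d k) (Set.Ici t) t := by
  by_cases h : ∀ n : ℕ, limClock α g d k n ≠ ∞
  · have h1 : limitClock α g d k = fun t => (rightInf (limClock α g d k) t).toNNReal :=
      funext fun t => if_pos h
    rw [h1]
    exact (ENNReal.tendsto_toNNReal (rightInf_limClock_ne_top h t)).comp
      (continuousWithinAt_rightInf (limClock_mono α g d k) t)
  · have h1 : limitClock α g d k = fun _ => 0 := funext fun t => if_neg h
    rw [h1]
    exact continuousWithinAt_const

theorem measurable_limitClock (α : ℕ → ℝ) (k : ℕ) (t : ℝ≥0) :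
    Measurable fun q : (List ℕ → ℕ → ℝ) × Dyn => limitClock α q.1 q.2 k t := by
  classical
  have h1 : MeasurableSet {q : (List ℕ → ℕ → ℝ) × Dyn | ∀ n : ℕ, limClock α q.1 q.2 k n ≠ ∞} := by
    simp only [Set.ofPred_forall]
    refine MeasurableSet.iInter fun n => ?_
    have hn := measurable_limClock α k n
    exact (hn (measurableSet_singleton ∞)).compl
  have h2 : Measurable fun q : (List ℕ → ℕ → ℝ) × Dyn => rightInf (limClock α q.1 q.2 k) t :=
    Measurable.iInf fun n => measurable_limClock α k _
  unfold limitClock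
  exact Measurable.ite h1 h2.ennreal_toNNReal measurable_const

end LimitClock

/-! ### Measurability of the clock of a node -/

/-- The Stieltjes function is built from right limits; for a right-continuous `f` this changes
nothing. -/
theorem stieltjesFunction_extendZero {f : ℝ≥0 → ℝ≥0} (hf : Monotone f)
    (hc : ∀ t, ContinuousWithinAt f (Set.Ici t) t) (x : ℝ) :
    (extendZero_mono hf).stieltjesFunction x = extendZero f x := by
  have hcont : ∀ x, ContinuousWithinAt (extendZero f) (Set.Ioi x) x := by
    intro x
    rcases lt_or_ge x 0 with hx | hx
    · have h1 : extendZero f =ᶠ[𝓝 x] fun _ => 0 := by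
        filter_upwards [Iio_mem_nhds hx] with y hy
        rw [extendZero, if_neg (not_le.2 hy)]
      exact (continuousAt_const.congr h1.symm).continuousWithinAt
    · have h1 : Tendsto (fun y : ℝ => ((f y.toNNReal : ℝ≥0) : ℝ)) (𝓝[>] x)
          (𝓝 ((f x.toNNReal : ℝ≥0) : ℝ)) := by
        refine (NNReal.continuous_coe.tendsto _).comp ((hc x.toNNReal).tendsto.comp ?_)
        refine tendsto_nhdsWithin_of_tendsto_nhds_of_eventually_within _
          (continuous_real_toNNReal.continuousWithinAt.tendsto) ?_
        filter_upwards [self_mem_nhdsWithin] with y hy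
        exact Real.toNNReal_le_toNNReal (le_of_lt hy)
      rw [ContinuousWithinAt, show extendZero f x = f x.toNNReal from if_pos hx]
      refine h1.congr' ?_
      filter_upwards [self_mem_nhdsWithin] with y hy
      rw [extendZero, if_pos (hx.trans (le_of_lt hy))]
  rw [Monotone.stieltjesFunction_eq]
  exact rightLim_eq_of_tendsto (hcont x).tendsto

theorem clockMeasure_Ioc {f : ℝ≥0 → ℝ≥0} (hf : Monotone f)
    (hc : ∀ t, ContinuousWithinAt f (Set.Ici t) t) (a b : ℝ) :
    clockMeasure f (Set.Ioc a b) = ENNReal.ofReal (extendZero f b - extendZero f a) := by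
  rw [clockMeasure, dif_pos hf, StieltjesFunction.measure_Ioc, stieltjesFunction_extendZero hf hc,
    stieltjesFunction_extendZero hf hc]

theorem clockMeasure_Iic {f : ℝ≥0 → ℝ≥0} (hf : Monotone f)
    (hc : ∀ t, ContinuousWithinAt f (Set.Ici t) t) (x : ℝ) :
    clockMeasure f (Set.Iic x) = ENNReal.ofReal (extendZero f x) := by
  have h1 : Tendsto (extendZero_mono hf).stieltjesFunction atBot (𝓝 0) := by
    refine tendsto_const_nhds.congr' ?_
    filter_upwards [Iio_mem_atBot (0 : ℝ)] with y hy
    rw [stieltjesFunction_extendZero hf hc, extendZero, if_neg (not_le.2 hy)]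
  rw [clockMeasure, dif_pos hf, StieltjesFunction.measure_Iic _ h1, sub_zero,
    stieltjesFunction_extendZero hf hc]

/-- Truncation reduces joint measurability to finite kernels. -/
theorem clockMeasure_eq_iSup (f : ℝ≥0 → ℝ≥0) (A : Set ℝ) : clockMeasure f A
    = ⨆ n : ℕ, (clockMeasure f).restrict (Set.Iic (n : ℝ)) A := by
  simp_rw [Measure.restrict_apply' (measurableSet_Iic (α := ℝ))]
  have h : ⋃ n : ℕ, Set.Iic (n : ℝ) = Set.univ :=
    Set.eq_univ_of_forall fun x => Set.mem_iUnion.2 (exists_nat_ge x)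
  rw [← Monotone.measure_iUnion, ← Set.inter_iUnion, h, Set.inter_univ]
  intro m n hmn
  exact Set.inter_subset_inter_right _ (Set.Iic_subset_Iic.2 (by exact_mod_cast hmn))

section ClockMeasure

variable {Z : Type*} [MeasurableSpace Z] {f : Z → ℝ≥0 → ℝ≥0}

theorem measurable_clockMeasure_restrict (hf : ∀ z, Monotone (f z))
    (hc : ∀ z t, ContinuousWithinAt (f z) (Set.Ici t) t) (hm : ∀ t, Measurable fun z => f z t)
    (n : ℕ) : (∀ z, IsFiniteMeasure ((clockMeasure (f z)).restrict (Set.Iic (n : ℝ)))) ∧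
      Measurable fun z => (clockMeasure (f z)).restrict (Set.Iic (n : ℝ)) := by
  have hm' : ∀ x : ℝ, Measurable fun z => clockMeasure (f z) (Set.Iic x) := by
    intro x
    simp_rw [fun z => clockMeasure_Iic (hf z) (hc z) x]
    by_cases hx : 0 ≤ x
    · simp only [extendZero, if_pos hx]
      exact (measurable_coe_nnreal_real.comp (hm _)).ennreal_ofReal
    · simp only [extendZero, if_neg hx]
      exact measurable_const
  have hfin : ∀ z, IsFiniteMeasure ((clockMeasure (f z)).restrict (Set.Iic (n : ℝ))) := fun z =>
    ⟨by rw [Measure.restrict_apply_univ, clockMeasure_Iic (hf z) (hc z)]; exact ENNReal.ofReal_lt_top⟩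
  refine ⟨hfin, Measurable.measure_of_isPiSystem (borel_eq_generateFrom_Iic ℝ ▸ rfl)
    isPiSystem_Iic ?_ ?_⟩
  · rintro _ ⟨x, rfl⟩
    simp_rw [Measure.restrict_apply (measurableSet_Iic (a := x)), Set.Iic_inter_Iic]
    exact hm' _
  · simp_rw [Measure.restrict_apply_univ]
    exact hm' _

theorem measurable_clockMeasure_section (hf : ∀ z, Monotone (f z))
    (hc : ∀ z t, ContinuousWithinAt (f z) (Set.Ici t) t) (hm : ∀ t, Measurable fun z => f z t)
    {A : Set (Z × ℝ)} (hA : MeasurableSet A) :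
    Measurable fun z => clockMeasure (f z) (Prod.mk z ⁻¹' A) := by
  simp_rw [clockMeasure_eq_iSup]
  refine Measurable.iSup fun n => ?_
  obtain ⟨h1, h2⟩ := measurable_clockMeasure_restrict hf hc hm n
  exact Kernel.measurable_kernel_prodMk_left_of_finite (κ := ⟨_, h2⟩) hA h1

theorem measurable_clockMeasure (hf : ∀ z, Monotone (f z))
    (hc : ∀ z t, ContinuousWithinAt (f z) (Set.Ici t) t) (hm : ∀ t, Measurable fun z => f z t) :
    Measurable fun z => clockMeasure (f z) := by
  refine Measure.measurable_of_measurable_coe _ fun B hB => ?_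
  exact measurable_clockMeasure_section hf hc hm (measurable_snd hB)

end ClockMeasure

theorem measurableSet_isAt (x : List ℕ) :
    MeasurableSet {p : ((List ℕ → ℕ → ℝ) × Dyn) × ℝ | IsAt p.1.1 p.1.2.2 p.1.2.1 x p.2} := by
  have h1 : Measurable fun p : ((List ℕ → ℕ → ℝ) × Dyn) × ℝ => (p.1, ENNReal.ofReal p.2) := by
    fun_prop
  exact ((measurable_kState_clock x.length).1.comp h1)
    (MeasurableSet.of_discrete (s := {x.map (fun n : ℕ => (n : ℕ∞))}))

theorem measurable_occupation (x : List ℕ) :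
    Measurable fun p : ((List ℕ → ℕ → ℝ) × Dyn) × ℝ => occupation p.1.1 p.1.2.2 p.1.2.1 x p.2 := by
  have h1 : ∀ p : ((List ℕ → ℕ → ℝ) × Dyn) × ℝ, occupation p.1.1 p.1.2.2 p.1.2.1 x p.2
      = ∫⁻ s : ℝ, {q : (((List ℕ → ℕ → ℝ) × Dyn) × ℝ) × ℝ | (0 ≤ q.2 ∧ q.2 ≤ q.1.2) ∧
        IsAt q.1.1.1 q.1.1.2.2 q.1.1.2.1 x q.2}.indicator (fun _ => (1 : ℝ≥0∞)) (p, s) := by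
    intro p
    rw [occupation, ← lintegral_indicator measurableSet_Icc]
    refine lintegral_congr fun s => ?_
    rw [Set.indicator_indicator]
    rfl
  simp_rw [h1]
  refine Measurable.lintegral_prod_right' (measurable_const.indicator ?_)
  have h2 : MeasurableSet {q : (((List ℕ → ℕ → ℝ) × Dyn) × ℝ) × ℝ | 0 ≤ q.2} :=
    measurableSet_le measurable_const measurable_snd
  have h3 : MeasurableSet {q : (((List ℕ → ℕ → ℝ) × Dyn) × ℝ) × ℝ | q.2 ≤ q.1.2} :=
    measurableSet_le measurable_snd (measurable_snd.comp measurable_fst)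
  have h4 : MeasurableSet {q : (((List ℕ → ℕ → ℝ) × Dyn) × ℝ) × ℝ |
      IsAt q.1.1.1 q.1.1.2.2 q.1.1.2.1 x q.2} :=
    ((measurable_fst.comp measurable_fst).prodMk measurable_snd) (measurableSet_isAt x)
  exact (h2.inter h3).inter h4

/-- The times at the node `x` before the occupation time of `x` exceeds `t`. -/
def nodeTimes (g : List ℕ → ℕ → ℝ) (d : Dyn) (x : List ℕ) (t : ℝ≥0) : Set ℝ :=
  {s : ℝ | 0 ≤ s ∧ occupation g d.2 d.1 x s ≤ t ∧ IsAt g d.2 d.1 x s}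

theorem measurableSet_nodeTimes_prod (x : List ℕ) (t : ℝ≥0) :
    MeasurableSet {p : ((List ℕ → ℕ → ℝ) × Dyn) × ℝ | p.2 ∈ nodeTimes p.1.1 p.1.2 x t} := by
  have h1 : MeasurableSet {p : ((List ℕ → ℕ → ℝ) × Dyn) × ℝ | 0 ≤ p.2} :=
    measurableSet_le measurable_const measurable_snd
  have h2 : MeasurableSet {p : ((List ℕ → ℕ → ℝ) × Dyn) × ℝ |
      occupation p.1.1 p.1.2.2 p.1.2.1 x p.2 ≤ t} :=
    measurableSet_le (measurable_occupation x) measurable_const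
  exact h1.inter (h2.inter (measurableSet_isAt x))

theorem measurableSet_nodeTimes (g : List ℕ → ℕ → ℝ) (d : Dyn) (x : List ℕ) (t : ℝ≥0) :
    MeasurableSet (nodeTimes g d x t) := by
  have h1 : Measurable fun s : ℝ => ((g, d), s) := measurable_prodMk_left
  have h2 := h1 (measurableSet_nodeTimes_prod x t)
  rwa [Set.preimage_ofPred_eq] at h2

theorem nodeClock_eq_clockMeasure (g : List ℕ → ℕ → ℝ) (d : Dyn) (f : ℝ≥0 → ℝ≥0) (x : List ℕ)
    (t : ℝ≥0) : nodeClock g d.2 d.1 f x t = clockMeasure f (nodeTimes g d x t) := rfl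

theorem measurable_nodeClock (α : ℕ → ℝ) (k : ℕ) (x : List ℕ) (t : ℝ≥0) :
    Measurable fun q : (List ℕ → ℕ → ℝ) × Dyn =>
      nodeClock q.1 q.2.2 q.2.1 (limitClock α q.1 q.2 k) x t := by
  simp_rw [nodeClock_eq_clockMeasure]
  have h := measurable_clockMeasure_section
    (f := fun q : (List ℕ → ℕ → ℝ) × Dyn => limitClock α q.1 q.2 k)
    (fun q => limitClock_mono α q.1 q.2 k) (fun q => continuousWithinAt_limitClock α q.1 q.2 k)
    (fun t => measurable_limitClock α k t) (measurableSet_nodeTimes_prod x t)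
  simpa only [Set.preimage_ofPred_eq, Set.ofPred_mem_eq] using h

/-- The time spent at `x` before the occupation time of `x` exceeds `t` is at most `t`. -/
theorem volume_nodeTimes_le (g : List ℕ → ℕ → ℝ) (d : Dyn) (x : List ℕ) (t : ℝ≥0) :
    volume (nodeTimes g d x t) ≤ t := by
  have hE : MeasurableSet {s : ℝ | IsAt g d.2 d.1 x s} :=
    (measurable_const.prodMk measurable_id : Measurable fun s : ℝ => ((g, d), s))
      (measurableSet_isAt x)
  have hE' : MeasurableSet {s : ℝ | 0 ≤ s ∧ IsAt g d.2 d.1 x s} := measurableSet_Ici.inter hE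
  -- For Lebesgue measure restricted to the times at `x`, the mass of a half-line is the occupation
  -- time.
  have h1 := measure_le_of_Iic (μ := volume.restrict {s : ℝ | 0 ≤ s ∧ IsAt g d.2 d.1 x s})
    (S := {s : ℝ | occupation g d.2 d.1 x s ≤ t}) (t := t) fun s hs => by
      refine le_trans (le_of_eq ?_) (hs : occupation g d.2 d.1 x s ≤ t)
      rw [occupation, lintegral_indicator_const hE, one_mul, Measure.restrict_apply hE,
        Measure.restrict_apply measurableSet_Iic]
      congr 1
      ext r
      simp only [Set.mem_inter_iff, Set.mem_Iic, Set.mem_ofPred_eq, Set.mem_Icc]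
      tauto
  rw [Measure.restrict_apply' hE'] at h1
  refine (measure_mono fun s hs => ?_).trans h1
  exact ⟨hs.2.1, hs.1, hs.2.2⟩

/-! ### The mean of the random measure of the limit clock. -/

theorem lintegral_le_of_tendsto {Z : Type*} [MeasurableSpace Z] {μ : Measure Z}
    {F : ℕ → Z → ℝ≥0∞} {G : Z → ℝ≥0∞} {c : ℕ → ℝ≥0∞} {C : ℝ≥0∞} (hF : ∀ n, Measurable (F n))
    (hlim : ∀ᵐ z ∂μ, Tendsto (fun n => F n z) atTop (𝓝 (G z)))
    (hle : ∀ᶠ n in atTop, ∫⁻ z, F n z ∂μ ≤ c n) (hc : Tendsto c atTop (𝓝 C)) :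
    ∫⁻ z, G z ∂μ ≤ C := by
  calc ∫⁻ z, G z ∂μ = ∫⁻ z, liminf (fun n => F n z) atTop ∂μ := by
        refine lintegral_congr_ae ?_
        filter_upwards [hlim] with z hz using hz.liminf_eq.symm
    _ ≤ liminf (fun n => ∫⁻ z, F n z ∂μ) atTop := lintegral_liminf_le hF
    _ ≤ liminf c atTop := liminf_le_liminf hle
    _ = C := hc.liminf_eq

/-- Right limits can thus be taken along points of any dense set. -/
theorem tendsto_rightInf_of_lt {L : ℝ≥0 → ℝ≥0∞} (hL : Monotone L) {t : ℝ≥0} {u : ℕ → ℝ≥0}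
    (hu : ∀ n, t < u n) (hut : Tendsto u atTop (𝓝 t)) :
    Tendsto (fun n => L (u n)) atTop (𝓝 (rightInf L t)) := by
  refine tendsto_order.2 ⟨fun c hc => Eventually.of_forall fun n => ?_, fun c hc => ?_⟩
  · obtain ⟨m, hm⟩ := ((tendsto_add_inv t).eventually (Iio_mem_nhds (hu n))).exists
    exact hc.trans_le ((iInf_le _ m).trans (hL (le_of_lt hm)))
  · obtain ⟨n, hn⟩ := iInf_lt_iff.1 hc
    have h1 : t < t + 1 / ((n : ℝ≥0) + 1) := by
      have : (0 : ℝ≥0) < 1 / ((n : ℝ≥0) + 1) := by positivity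
      exact lt_add_of_pos_right t this
    filter_upwards [hut.eventually (Iio_mem_nhds h1)] with m hm
    exact (hL (le_of_lt hm)).trans_lt hn

/-- The measure on `(0, ∞)` with density `F` along the path `X`. -/
def pathMeasure (F : List ℕ → ℝ≥0∞) (X : ℝ≥0∞ → List ℕ∞) : Measure ℝ :=
  (volume.restrict (Set.Ioi (0 : ℝ))).withDensity fun r => extendNode F (X (ENNReal.ofReal r))

theorem pathMeasure_Ioc (F : List ℕ → ℝ≥0∞) (X : ℝ≥0∞ → List ℕ∞) (a b : ℝ≥0) :
    pathMeasure F X (Set.Ioc (a : ℝ) b) = occInt F X a b := by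
  rw [pathMeasure, withDensity_apply _ measurableSet_Ioc, ← lintegral_indicator measurableSet_Ioc,
    occInt]
  refine setLIntegral_congr_fun measurableSet_Ioi fun r hr => ?_
  have h1 : (a : ℝ≥0∞) < ENNReal.ofReal r ↔ (a : ℝ) < r := by
    rw [← ENNReal.ofReal_coe_nnreal, ENNReal.ofReal_lt_ofReal_iff hr]
  have h2 : ENNReal.ofReal r ≤ (b : ℝ≥0∞) ↔ r ≤ (b : ℝ) := by
    rw [← ENNReal.ofReal_coe_nnreal, ENNReal.ofReal_le_ofReal_iff (NNReal.coe_nonneg b)]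
  simp only [Set.indicator, Set.mem_Ioc, h1, h2]

theorem pathMeasure_Iic (F : List ℕ → ℝ≥0∞) (X : ℝ≥0∞ → List ℕ∞) (x : ℝ) :
    pathMeasure F X (Set.Iic x) = pathMeasure F X (Set.Ioc 0 x) := by
  rw [pathMeasure, withDensity_apply _ measurableSet_Iic, withDensity_apply _ measurableSet_Ioc,
    Measure.restrict_restrict measurableSet_Iic, Measure.restrict_restrict measurableSet_Ioc,
    Set.inter_comm, Set.Ioi_inter_Iic,
    Set.inter_eq_left.2 (fun r (hr : r ∈ Set.Ioc 0 x) => (Set.mem_Ioi.2 hr.1))]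

theorem tendsto_pathMeasure_Ioc {F : List ℕ → ℝ≥0∞} {X : ℝ≥0∞ → List ℕ∞}
    (hfin : ∀ x, pathMeasure F X (Set.Iic x) ≠ ∞) (a b : ℝ≥0) {v : ℕ → ℝ≥0} (hv : ∀ n, b < v n)
    (hvb : Tendsto v atTop (𝓝 b)) :
    Tendsto (fun n => pathMeasure F X (Set.Ioc (a : ℝ) (v n))) atTop
      (𝓝 (pathMeasure F X (Set.Ioc (a : ℝ) b))) := by
  have h1 := tendsto_measure_biInter_gt (μ := pathMeasure F X)
    (s := fun r : ℝ => Set.Ioc (a : ℝ) r) (a := (b : ℝ))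
    (fun r _ => measurableSet_Ioc.nullMeasurableSet)
    (fun i j _ hij => Set.Ioc_subset_Ioc_right hij)
    ⟨b + 1, by simp, ne_top_of_le_ne_top (hfin _) (measure_mono Set.Ioc_subset_Iic_self)⟩
  have h2 : ⋂ r > (b : ℝ), Set.Ioc (a : ℝ) r = Set.Ioc (a : ℝ) b := by
    ext y
    simp only [Set.mem_iInter, Set.mem_Ioc]
    refine ⟨fun hy => ⟨(hy (b + 1) (by simp)).1,
      le_of_forall_gt_imp_ge_of_dense fun r hr => (hy r hr).2⟩, fun hy r hr => ⟨hy.1, hy.2.trans hr.le⟩⟩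
  rw [h2] at h1
  refine h1.comp (tendsto_nhdsWithin_of_tendsto_nhds_of_eventually_within _
    ((NNReal.continuous_coe.tendsto b).comp hvb) (Eventually.of_forall fun n => ?_))
  exact NNReal.coe_lt_coe.2 (hv n)

/-- The density measure of `F` along the path gives the times at `x` a mass of at most
`t * F x`. -/
theorem pathMeasure_nodeTimes_le (F : List ℕ → ℝ≥0∞) (g : List ℕ → ℕ → ℝ) (d : Dyn) (x : List ℕ)
    (t : ℝ≥0) : pathMeasure F (kState g d.2 d.1 x.length) (nodeTimes g d x t) ≤ t * F x := by
  have hA := measurableSet_nodeTimes g d x t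
  rw [pathMeasure, withDensity_apply _ hA]
  calc ∫⁻ r in nodeTimes g d x t, extendNode F (kState g d.2 d.1 x.length (ENNReal.ofReal r))
        ∂(volume.restrict (Set.Ioi (0 : ℝ)))
      = ∫⁻ r in nodeTimes g d x t, F x ∂(volume.restrict (Set.Ioi (0 : ℝ))) := by
        refine setLIntegral_congr_fun hA fun r hr => ?_
        have h1 : kState g d.2 d.1 x.length (ENNReal.ofReal r) = x.map (fun n : ℕ => (n : ℕ∞)) :=
          hr.2.2
        simp only [h1, extendNode_map]
    _ = F x * (volume.restrict (Set.Ioi (0 : ℝ))) (nodeTimes g d x t) := setLIntegral_const _ _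
    _ ≤ t * F x := by
        rw [mul_comm]
        exact mul_le_mul_left ((Measure.restrict_apply_le _ _).trans
          (volume_nodeTimes_le g d x t)) _

/-- These times depend only on the levels below the depth of `x`, so they stay fixed while the mean
measure is taken. -/
theorem nodeTimes_resample (g : List ℕ → ℕ → ℝ) (d d' : Dyn) (x : List ℕ) (t : ℝ≥0) :
    nodeTimes g (resampleDyn (Set.Ici x.length) d d') x t = nodeTimes g d x t := by
  have hS : ∀ j < x.length, j ∉ Set.Ici x.length := fun j hj => by simpa using hj
  simp only [nodeTimes, occupation, IsAt, kState_resample g hS]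

section Law

variable {ν : Measure Dyn} {α : ℕ → ℝ} {g : List ℕ → ℕ → ℝ}

theorem measurable_limitClock_dyn (α : ℕ → ℝ) (g : List ℕ → ℕ → ℝ) (k : ℕ) (t : ℝ≥0) :
    Measurable fun d : Dyn => limitClock α g d k t :=
  (measurable_limitClock α k t).comp (g := fun q : (List ℕ → ℕ → ℝ) × Dyn => limitClock α q.1 q.2 k t)
    (f := fun d : Dyn => (g, d)) (measurable_const.prodMk measurable_id)

/-- Given the levels below `k`, the mean of the random measure of the limit clock is at most the
measure with density `W` along the path of the `k`-level process. -/
theorem DynLaw.ae_lintegral_clockMeasure_le (hν : DynLaw ν) (hg : GoodEnv α g) (k : ℕ) :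
    ∀ᵐ d ∂ν, ∀ A, MeasurableSet A →
      ∫⁻ d', clockMeasure (limitClock α g (resampleDyn (Set.Ici k) d d') k) A ∂ν
        ≤ pathMeasure (W α g) (kState g d.2 d.1 k) A := by
  -- Each mean bound holds off a null set depending on the times. A countable dense set gives one
  -- null set, and other times are approached from the right.
  obtain ⟨S, hSc, hSd⟩ := TopologicalSpace.exists_countable_dense ℝ≥0
  have H1 : ∀ᵐ d ∂ν, ∀ b ∈ S, ∫⁻ d', limClock α g (resampleDyn (Set.Ici k) d d') k b ∂ν
      ≤ occInt (W α g) (kState g d.2 d.1 k) 0 b :=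
    (ae_ball_iff hSc).2 fun b _ => hν.lintegral_limClock_le hg k b
  have H2 : ∀ᵐ d ∂ν, ∀ a ∈ S, ∀ b ∈ S, a ≤ b →
      ∫⁻ d', (limClock α g (resampleDyn (Set.Ici k) d d') k b
        - limClock α g (resampleDyn (Set.Ici k) d d') k a) ∂ν
      ≤ occInt (W α g) (kState g d.2 d.1 k) a b := by
    refine (ae_ball_iff hSc).2 fun a _ => (ae_ball_iff hSc).2 fun b _ => ?_
    by_cases hab : a ≤ b
    · filter_upwards [hν.lintegral_limClock_sub_le hg k hab] with d hd _ using hd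
    · exact Eventually.of_forall fun d h => absurd h hab
  have H3 : ∀ᵐ d ∂ν, ∀ n : ℕ, limClock α g d k n ≠ ∞ :=
    ae_all_iff.2 fun n => by simpa using hν.ae_limClock_ne_top hg k n
  filter_upwards [H1, H2, hν.ae_resample (Set.Ici k) H3, hν.ae_occInt_W_ne_top hg k]
    with d h1 h2 h3 h4
  set X := kState g d.2 d.1 k with hX
  set R := resampleDyn (Set.Ici k) d with hR
  have hRm : Measurable R := (measurable_resampleDyn _).comp (measurable_const.prodMk measurable_id)
  have hLm : ∀ t, Measurable fun d' => limClock α g (R d') k t := fun t =>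
    (measurable_limClock_dyn α g k t).comp hRm
  have hmono : ∀ d', Monotone (limitClock α g (R d') k) := fun d' => limitClock_mono _ _ _ _
  have hcont : ∀ d' t, ContinuousWithinAt (limitClock α g (R d') k) (Set.Ici t) t := fun d' =>
    continuousWithinAt_limitClock _ _ _ _
  have hfin : ∀ x, pathMeasure (W α g) X (Set.Iic x) ≠ ∞ := by
    intro x
    rw [pathMeasure_Iic]
    have h5 := pathMeasure_Ioc (W α g) X 0 x.toNNReal
    refine ne_top_of_le_ne_top (h4 x.toNNReal) ?_
    rw [ENNReal.coe_zero] at h5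
    rw [← h5]
    exact measure_mono (Set.Ioc_subset_Ioc (by simp) (Real.le_coe_toNNReal x))
  -- the mean of the limit clock at a given time
  have hA : ∀ b : ℝ≥0, ∫⁻ d', (limitClock α g (R d') k b : ℝ≥0∞) ∂ν
      ≤ pathMeasure (W α g) X (Set.Ioc ((0 : ℝ≥0) : ℝ) b) := by
    intro b
    obtain ⟨v, -, hv, hvb⟩ := hSd.exists_seq_strictAnti_tendsto b
    refine lintegral_le_of_tendsto (F := fun n d' => limClock α g (R d') k (v n))
      (fun n => hLm _) ?_ (Eventually.of_forall fun n => h1 _ (hv n).2) ?_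
    · filter_upwards [h3] with d' h5
      rw [coe_limitClock h5]
      exact tendsto_rightInf_of_lt (limClock_mono _ _ _ _) (fun n => (hv n).1) hvb
    · have h6 := tendsto_pathMeasure_Ioc hfin 0 b (fun n => (hv n).1) hvb
      simpa only [pathMeasure_Ioc, ENNReal.coe_zero] using h6
  -- the mean of its increments
  have hB : ∀ a b : ℝ≥0, a < b →
      ∫⁻ d', ((limitClock α g (R d') k b : ℝ≥0∞) - limitClock α g (R d') k a) ∂ν
      ≤ pathMeasure (W α g) X (Set.Ioc (a : ℝ) b) := by
    intro a b hab
    obtain ⟨u, -, hu, hua⟩ := hSd.exists_seq_strictAnti_tendsto a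
    obtain ⟨v, -, hv, hvb⟩ := hSd.exists_seq_strictAnti_tendsto b
    refine lintegral_le_of_tendsto
      (F := fun n d' => limClock α g (R d') k (v n) - limClock α g (R d') k (u n))
      (c := fun n => pathMeasure (W α g) X (Set.Ioc (a : ℝ) (v n)))
      (fun n => (hLm _).sub (hLm _)) ?_ ?_ (tendsto_pathMeasure_Ioc hfin a b (fun n => (hv n).1) hvb)
    · filter_upwards [h3] with d' h5
      rw [coe_limitClock h5, coe_limitClock h5]
      exact ENNReal.Tendsto.sub
        (tendsto_rightInf_of_lt (limClock_mono _ _ _ _) (fun n => (hv n).1) hvb)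
        (tendsto_rightInf_of_lt (limClock_mono _ _ _ _) (fun n => (hu n).1) hua)
        (Or.inl (rightInf_limClock_ne_top h5 b))
    -- Once u n < b the two times are ordered; since a < u n, the interval may be enlarged to start
    -- at `a`.
    · filter_upwards [hua.eventually (Iio_mem_nhds hab)] with n hn
      refine (h2 _ (hu n).2 _ (hv n).2 ((le_of_lt hn).trans (hv n).1.le)).trans ?_
      rw [← pathMeasure_Ioc]
      exact measure_mono (Set.Ioc_subset_Ioc_left (NNReal.coe_le_coe.2 (hu n).1.le))
  have hmm : Measurable fun d' => clockMeasure (limitClock α g (R d') k) :=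
    measurable_clockMeasure hmono hcont fun t => (measurable_limitClock_dyn α g k t).comp hRm
  have key : ∀ a b : ℝ, a < b → (ν.bind fun d' => clockMeasure (limitClock α g (R d') k)) (Set.Ioc a b)
      ≤ pathMeasure (W α g) X (Set.Ioc a b) := by
    intro a b hab
    rw [Measure.bind_apply measurableSet_Ioc hmm.aemeasurable]
    simp_rw [fun d' => clockMeasure_Ioc (hmono d') (hcont d')]
    rcases lt_or_ge b 0 with hb | hb
    · simp [extendZero, not_le.2 hb, not_le.2 (hab.trans hb)]
    lift b to ℝ≥0 using hb
    -- For a < 0 the interval also contains the atom of mass f 0 at the origin, so the bound on the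
    -- clock itself is used instead of one on increments.
    rcases lt_or_ge a 0 with ha | ha
    · simp only [extendZero, if_neg (not_le.2 ha), if_pos (NNReal.coe_nonneg b), sub_zero,
        Real.toNNReal_coe, ENNReal.ofReal_coe_nnreal]
      exact (hA b).trans (measure_mono (Set.Ioc_subset_Ioc_left (by simpa using ha.le)))
    · lift a to ℝ≥0 using ha
      simp only [extendZero, if_pos (NNReal.coe_nonneg a), if_pos (NNReal.coe_nonneg b), Real.toNNReal_coe]
      refine le_trans (le_of_eq (lintegral_congr fun d' => ?_)) (hB a b (by exact_mod_cast hab))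
      rw [ENNReal.ofReal_sub _ (NNReal.coe_nonneg _), ENNReal.ofReal_coe_nnreal,
        ENNReal.ofReal_coe_nnreal]
  intro A hAm
  rw [← Measure.bind_apply hAm hmm.aemeasurable]
  exact measure_le_of_Ioc hfin key A

theorem measurable_nodeClock_dyn (α : ℕ → ℝ) (g : List ℕ → ℕ → ℝ) (k : ℕ) (x : List ℕ) (t : ℝ≥0) :
    Measurable fun d : Dyn => nodeClock g d.2 d.1 (limitClock α g d k) x t :=
  (measurable_nodeClock α k x t).comp (g := fun q : (List ℕ → ℕ → ℝ) × Dyn =>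
    nodeClock q.1 q.2.2 q.2.1 (limitClock α q.1 q.2 k) x t)
    (f := fun d : Dyn => (g, d)) (measurable_const.prodMk measurable_id)

/-- The mean of the clock of the node `x` in a fixed environment. -/
theorem DynLaw.lintegral_nodeClock_le (hν : DynLaw ν) (hg : GoodEnv α g) (x : List ℕ) (t : ℝ≥0) :
    ∫⁻ d : Dyn, nodeClock g d.2 d.1 (limitClock α g d x.length) x t ∂ν ≤ t * W α g x := by
  have := hν.isProb
  rw [← hν.lintegral_resample (Set.Ici x.length) (measurable_nodeClock_dyn α g x.length x t)]
  calc ∫⁻ d, ∫⁻ d', nodeClock g (resampleDyn (Set.Ici x.length) d d').2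
          (resampleDyn (Set.Ici x.length) d d').1
          (limitClock α g (resampleDyn (Set.Ici x.length) d d') x.length) x t ∂ν ∂ν
      ≤ ∫⁻ d : Dyn, t * W α g x ∂ν := by
        refine lintegral_mono_ae ?_
        filter_upwards [hν.ae_lintegral_clockMeasure_le hg x.length] with d hd
        simp_rw [nodeClock_eq_clockMeasure, nodeTimes_resample]
        exact (hd _ (measurableSet_nodeTimes g d x t)).trans (pathMeasure_nodeTimes_le _ g d x t)
    _ = t * W α g x := by simp

end Law

/-! ### From a fixed environment to the original probability space. -/

section Input

variable {Ω : Type*} [MeasurableSpace Ω] {P : Measure Ω}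
  {α : ℕ → ℝ} {γ : Ω → List ℕ → ℕ → ℝ} {σ T : Ω → ℕ → ℕ → ℕ → ℝ}

theorem IsInput.measurable_input (h : IsInput α γ σ T P) :
    Measurable fun ω => (γ ω, (T ω, σ ω)) := h.measurable_env.prodMk h.measurable_dyn

theorem IsInput.measurable_nodeClock_input (h : IsInput α γ σ T P) (k : ℕ) (x : List ℕ) (t : ℝ≥0) :
    Measurable fun ω =>
      nodeClock (γ ω) (σ ω) (T ω) (limitClock α (γ ω) (T ω, σ ω) k) x t :=
  (measurable_nodeClock α k x t).comp (g := fun q : (List ℕ → ℕ → ℝ) × Dyn =>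
    nodeClock q.1 q.2.2 q.2.1 (limitClock α q.1 q.2 k) x t)
    (f := fun ω => (γ ω, (T ω, σ ω))) h.measurable_input

theorem IsInput.measurable_limClock_input (h : IsInput α γ σ T P) (k : ℕ) (t : ℝ≥0) :
    Measurable fun ω => limClock α (γ ω) (T ω, σ ω) k t :=
  (measurable_limClock α k t).comp (g := fun q : (List ℕ → ℕ → ℝ) × Dyn => limClock α q.1 q.2 k t)
    (f := fun ω => (γ ω, (T ω, σ ω))) h.measurable_input

theorem IsInput.measurable_limitClock_input (h : IsInput α γ σ T P) (k : ℕ) (t : ℝ≥0) :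
    Measurable fun ω => limitClock α (γ ω) (T ω, σ ω) k t :=
  (measurable_limitClock α k t).comp
    (g := fun q : (List ℕ → ℕ → ℝ) × Dyn => limitClock α q.1 q.2 k t)
    (f := fun ω => (γ ω, (T ω, σ ω))) h.measurable_input

variable [IsProbabilityMeasure P]

theorem IsInput.map_input (h : IsInput α γ σ T P) :
    P.map (fun ω => (γ ω, (T ω, σ ω))) = (P.map γ).prod (P.map fun ω => (T ω, σ ω)) :=
  (indepFun_iff_map_prod_eq_prod_map_map h.measurable_env.aemeasurable
    h.measurable_dyn.aemeasurable).1 h.env_indep_dynamics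

/-- Environment and dynamics are independent, so Fubini lifts statements proved in almost every
fixed environment. -/
theorem IsInput.ae_of_ae_ae (h : IsInput α γ σ T P) {p : (List ℕ → ℕ → ℝ) × Dyn → Prop}
    (hp : MeasurableSet {q | p q})
    (hae : ∀ᵐ g ∂(P.map γ), ∀ᵐ d ∂(P.map fun ω => (T ω, σ ω)), p (g, d)) :
    ∀ᵐ ω ∂P, p (γ ω, (T ω, σ ω)) := by
  have := Measure.isProbabilityMeasure_map (μ := P) h.measurable_dyn.aemeasurable
  refine ae_of_ae_map h.measurable_input.aemeasurable ?_
  rw [h.map_input]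
  exact (Measure.ae_prod_iff_ae_ae hp).2 hae

theorem IsInput.ae_tendsto_limClock (h : IsInput α γ σ T P)
    (hg : ∀ᵐ g ∂(P.map γ), GoodEnv α g) (k : ℕ) (t : ℝ≥0) :
    ∀ᵐ ω ∂P, Tendsto (fun m => adjClockComp α (γ ω) (σ ω) (T ω) k m t) atTop
      (𝓝 (limClock α (γ ω) (T ω, σ ω) k t)) := by
  have hm : ∀ m, Measurable fun q : (List ℕ → ℕ → ℝ) × Dyn =>
      adjClockComp α q.1 q.2.2 q.2.1 k m t := fun m =>
    (measurable_adjClockComp α k m).comp (g := fun q : ((List ℕ → ℕ → ℝ) × Dyn) × ℝ≥0∞ =>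
      adjClockComp α q.1.1 q.1.2.2 q.1.2.1 k m q.2)
      (f := fun q : (List ℕ → ℕ → ℝ) × Dyn => (q, (t : ℝ≥0∞)))
      (measurable_id.prodMk measurable_const)
  -- Stating convergence as equality of lower and upper limits makes the event visibly measurable.
  have h1 := h.ae_of_ae_ae (p := fun q => liminf (fun m => adjClockComp α q.1 q.2.2 q.2.1 k m t) atTop
      = limClock α q.1 q.2 k t)
    (measurableSet_eq_fun (Measurable.liminf hm) (measurable_limClock α k t)) (by
      filter_upwards [hg] with g hg
      filter_upwards [h.dynLaw.ae_tendsto_limClock hg k t] with d hd using hd.liminf_eq)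
  filter_upwards [h1] with ω hω
  exact tendsto_of_liminf_eq_limsup hω rfl

theorem IsInput.ae_limClock_ne_top (h : IsInput α γ σ T P)
    (hg : ∀ᵐ g ∂(P.map γ), GoodEnv α g) (k : ℕ) (t : ℝ≥0) :
    ∀ᵐ ω ∂P, limClock α (γ ω) (T ω, σ ω) k t ≠ ∞ := by
  have hm := measurable_limClock α k t
  refine h.ae_of_ae_ae (p := fun q => limClock α q.1 q.2 k t ≠ ∞)
    (hm (measurableSet_singleton ∞)).compl ?_
  filter_upwards [hg] with g hg
  exact h.dynLaw.ae_limClock_ne_top hg k t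

theorem IsInput.condLExp_nodeClock_le (h : IsInput α γ σ T P)
    (hg : ∀ᵐ g ∂(P.map γ), GoodEnv α g) (x : List ℕ) (t : ℝ≥0) :
    condLExp (envSigma γ) P
        (fun ω => nodeClock (γ ω) (σ ω) (T ω) (limitClock α (γ ω) (T ω, σ ω) x.length) x t)
      ≤ᵐ[P] fun ω => t * W α (γ ω) x := by
  have hm : envSigma γ ≤ _ := h.measurable_env.comap_le
  have hWm : Measurable fun g : List ℕ → ℕ → ℝ => (t : ℝ≥0∞) * W α g x :=
    (measurable_W α x).const_mul _
  have hWγ : Measurable[envSigma γ] fun ω => (t : ℝ≥0∞) * W α (γ ω) x :=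
    hWm.comp (comap_measurable γ)
  have hN := measurable_nodeClock α x.length x t
  have := Measure.isProbabilityMeasure_map (μ := P) h.measurable_dyn.aemeasurable
  -- The bound is itself measurable with respect to the environment, so it is enough to compare
  -- integrals over environment events; there the dynamics are integrated out first.
  refine ae_le_of_ae_le_trim (hm := hm) (ae_le_of_forall_setLIntegral_le_of_sigmaFinite
    (measurable_condLExp _ _ _) fun s hs _ => ?_)
  rw [setLIntegral_condLExp_trim hm _ _ hs, setLIntegral_trim hm hWγ hs]
  obtain ⟨B, hB, rfl⟩ := hs
  have hBm : MeasurableSet {q : (List ℕ → ℕ → ℝ) × Dyn | q.1 ∈ B} := measurable_fst hB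
  calc ∫⁻ ω in γ ⁻¹' B, nodeClock (γ ω) (σ ω) (T ω) (limitClock α (γ ω) (T ω, σ ω) x.length) x t ∂P
      = ∫⁻ q in {q : (List ℕ → ℕ → ℝ) × Dyn | q.1 ∈ B},
          nodeClock q.1 q.2.2 q.2.1 (limitClock α q.1 q.2 x.length) x t
            ∂(P.map fun ω => (γ ω, (T ω, σ ω))) := by
        rw [setLIntegral_map hBm hN h.measurable_input]
        rfl
    _ = ∫⁻ g in B, ∫⁻ d : Dyn, nodeClock g d.2 d.1 (limitClock α g d x.length) x t
          ∂(P.map fun ω => (T ω, σ ω)) ∂(P.map γ) := by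
        rw [h.map_input, ← lintegral_indicator hBm, lintegral_prod _ (hN.indicator hBm).aemeasurable,
          ← lintegral_indicator hB]
        refine lintegral_congr fun g => ?_
        by_cases hgB : g ∈ B
        · simp [hgB, Set.indicator]
        · simp [hgB, Set.indicator]
    _ ≤ ∫⁻ g in B, t * W α g x ∂(P.map γ) := by
        refine lintegral_mono_ae (ae_restrict_of_ae ?_)
        filter_upwards [hg] with g hg
        exact h.dynLaw.lintegral_nodeClock_le hg x t
    _ = ∫⁻ ω in γ ⁻¹' B, t * W α (γ ω) x ∂P := setLIntegral_map hB hWm h.measurable_env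

end Input

end KTree

end

theorem mainTheorem2 (α : ℕ → ℝ) (hα_mono : StrictMono α) (hα_pos : 0 < α 0)
    (hα_lim : Tendsto α atTop (𝓝 1))
    {Ω : Type*} [MeasurableSpace Ω] (P : Measure Ω) [IsProbabilityMeasure P]
    (γ : Ω → List ℕ → ℕ → ℝ) (σ T : Ω → ℕ → ℕ → ℕ → ℝ) (h : KTree.IsInput α γ σ T P) :
    (∀ᵐ ω ∂P, ∀ x : List ℕ, KTree.W α (γ ω) x ≠ ∞ ∧
      Tendsto (KTree.WApprox α (γ ω) x) atTop (𝓝 (KTree.W α (γ ω) x))) ∧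
    ∀ k : ℕ, ∃ (D : Set ℝ≥0) (θ : Ω → ℝ≥0 → ℝ≥0),
      D.Countable ∧ Dense D ∧
      (∀ t, Measurable (fun ω => θ ω t)) ∧
      (∀ᵐ ω ∂P, Monotone (θ ω) ∧ (∀ t, ContinuousWithinAt (θ ω) (Set.Ici t) t) ∧
        ∀ t ∈ D, Tendsto (fun m : ℕ => KTree.adjClockComp α (γ ω) (σ ω) (T ω) k m (t : ℝ≥0∞))
          atTop (𝓝 (θ ω t : ℝ≥0∞))) ∧
      ∀ x : List ℕ, x.length = k → ∀ t : ℝ≥0,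
        AEMeasurable (fun ω => KTree.nodeClock (γ ω) (σ ω) (T ω) (θ ω) x t) P ∧
        ∀ᵐ ω ∂P,
          condLExp (KTree.envSigma γ) P
            (fun ω' => KTree.nodeClock (γ ω') (σ ω') (T ω') (θ ω') x t) ω
            ≤ (t : ℝ≥0∞) * KTree.W α (γ ω) x := by
  have hg := h.ae_goodEnv hα_mono hα_pos hα_lim
  refine ⟨?_, fun k => ?_⟩
  · filter_upwards [ae_of_ae_map h.measurable_env.aemeasurable hg] with ω hω x
    exact ⟨hω.W_ne_top x, hω.W_tendsto x⟩
  · obtain ⟨D, hDc, hDd, hD⟩ := KTree.exists_dense_rightInf_eq P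
      (L := fun ω => KTree.limClock α (γ ω) (T ω, σ ω) k)
      (fun ω => KTree.limClock_mono α _ _ k)
      (fun t => h.measurable_limClock_input k t)
    refine ⟨D, fun ω => KTree.limitClock α (γ ω) (T ω, σ ω) k, hDc, hDd,
      fun t => h.measurable_limitClock_input k t, ?_, ?_⟩
    · have h1 : ∀ᵐ ω ∂P, ∀ n : ℕ, KTree.limClock α (γ ω) (T ω, σ ω) k n ≠ ∞ :=
        ae_all_iff.2 fun n => h.ae_limClock_ne_top hg k n
      have h2 := (ae_ball_iff hDc).2 hD
      have h3 := (ae_ball_iff hDc).2 fun t (_ : t ∈ D) => h.ae_tendsto_limClock hg k t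
      filter_upwards [h1, h2, h3] with ω h4 h5 h6
      refine ⟨KTree.limitClock_mono _ _ _ _, KTree.continuousWithinAt_limitClock _ _ _ _,
        fun t ht => ?_⟩
      -- At times in `D` the right-continuous modification coincides with the limit.
      rw [KTree.coe_limitClock h4, h5 t ht]
      exact h6 t ht
    · rintro x rfl t
      exact ⟨(h.measurable_nodeClock_input x.length x t).aemeasurable, h.condLExp_nodeClock_le hg x t⟩
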